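/- **Setting.** A housing market has agents $1,\dots,n$ and $n$ houses. Each agent $a$ has a strict preference list over a subset of the houses (its acceptable houses) and initially owns one house $\mu_0(a)$, which is on its list; $\mu_0$ is a bijection. A matching assigns distinct acceptable houses to some of the agents; being unmatched is worse than any acceptable house. A set $S$ of agents is a coalition with respect to a matching $\mu$ if there is a matching $\nu$ with $\nu(a)\in\{\mu_0(b): b\in S\}$ for all $a\in S$, such that every $a\in S$ likes $\nu(a)$ at least as much as $\mu(a)$, and some $a\in S$ strictly prefers $\nu(a)$. The core is the set of matchings with respect to which there is no coalition. **Model.** In the broadcast congested clique, $n$ nodes run the same program in synchronous rounds, each node with its identifier, its local input and one fresh fair random bit per round. In each round a node may send one message, the same to every node in a set of recipients of its choice; a message to $k$ recipients counts as $k$ messages. Node $a$ initially knows $n$, the preference list of $a$ and $\mu_0(a)$. **Algorithm.** In the first round every node broadcasts its house. Then the nodes work in stages. At the start of a stage every unassigned node sets its successor to the holder of its favourite house among those not yet removed, is active, and has no children. Cycle finding proceeds in iterations. 1. *Symmetry breaking.* With Algorithm 1 (randomized), each active node flips a coin, and becomes inactive if it shows heads while its successor's coin shows tails. With Algorithm 2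 (deterministic), the active nodes are coloured with at most six colours by the deterministic coin tossing of Cole and Vishkin, starting from the identifiers, such that a node and its successor, if distinct, have different colours; a node becomes inactive if its colour is smaller than that of its successor. 2. *Explore.* While the successor of an active node is inactive, the node adds this successor to its children and replaces it by the successor's successor. (Six request/answer exchanges are reserved for this.) 3. *Check.* A node that is its own successor is a root, and broadcasts $\mathrm{remove}(h)$, where $h$ is its current top house. If there is no root, the next iteration starts. Otherwise cycle finding ends for this stage; cycles not found yet are left to later stages. When roots have been found, each of them sends a message "cycle" down the tree given by the children sets. Every root and every node that receives "cycle" is assigned its current top house $h$, broadcasts $\mathrm{remove}(h)$ and forwards "cycle" to its children; all nodes delete removed houses from their lists. A convergecast follows: a node that has received "ok" from all its children sends "ok" to its parent, or, if it is a root, broadcasts "nextStage". When all roots of the stage have broadcast "nextStage", assigned nodes halt and the others start the next stage. **Theorem.** * All messages, for both subroutines, have $O(\log n)$ bits (precisely, at most $B(\lfloor\log_2 n\rfloor+1)$ bits for an absolute constant $B$). * For both subroutines and every outcome of the random bits, if all nodes have halted, then the houses that they hold form a matching $\mu$, and the core of the market is exactly $\{\mu\}$. * With Algorithm 1 as a subroutine,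 all nodes halt with probability $1$. Moreover, with high probability the algorithm takes $O(n)$ rounds and $O(n^2)$ messages: for every $c\in\mathbb N$ there is a constant $C$ such that for every $n$ and every housing market with $n$ agents, with probability at least $1-n^{-c}$, all nodes have halted after some $t\le Cn$ rounds in which at most $Cn^2$ messages have been sent. * With Algorithm 2 as a subroutine, the complexity has an additional factor $\log^* n$: there is a constant $C$ such that for every $n$ and every housing market with $n$ agents, all nodes have halted after some $t\le Cn(\log^* n+1)$ rounds in which at most $Cn^2(\log^* n+1)$ messages have been sent. -/

import Mathlib

/-! ### Housing markets and their core -/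

/-- A housing market with `n` agents and `n` houses, both numbered by `Fin n`.  Every agent has a
strict preference list (best house first) of the houses acceptable to it, initially owns the house
`endow a`, and finds that house acceptable. -/
structure HousingMarket (n : ℕ) where
  prefs : Fin n → List (Fin n)
  nodup : ∀ a, (prefs a).Nodup
  endow : Equiv.Perm (Fin n)
  endow_mem : ∀ a, endow a ∈ prefs a

namespace HousingMarket

variable {n : ℕ}

/-- A matching of agents to acceptable houses; `house a = none` means that `a` is unmatched. -/
@[ext]
structure Matching (M : HousingMarket n) where
  house : Fin n → Option (Fin n)
  acceptable : ∀ a h, house a = some h → h ∈ M.prefs a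
  injective : ∀ a b h, house a = some h → house b = some h → a = b

/-- `M.Prefers a x y`: agent `a` strictly prefers the outcome `x` to the outcome `y`. Of two houses
the one that comes first in the list is preferred, and every house is preferred to being
unmatched. -/
def Prefers (M : HousingMarket n) (a : Fin n) : Option (Fin n) → Option (Fin n) → Prop
  | some h, some g => (M.prefs a).idxOf h < (M.prefs a).idxOf g
  | some _, none => True
  | none, _ => False

/-- The set `S` of agents is a coalition with respect to `μ`. -/
def IsCoalition (M : HousingMarket n) (μ : M.Matching) (S : Set (Fin n)) : Prop :=
  ∃ ν : M.Matching,
    (∀ a ∈ S, ∃ b ∈ S, ν.house a = some (M.endow b)) ∧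
    (∀ a ∈ S, ν.house a = μ.house a ∨ M.Prefers a (ν.house a) (μ.house a)) ∧
    (∃ a ∈ S, M.Prefers a (ν.house a) (μ.house a))

/-- The core: the matchings with respect to which there is no coalition. -/
def core (M : HousingMarket n) : Set M.Matching :=
  {μ | ¬ ∃ S : Set (Fin n), M.IsCoalition μ S}

end HousingMarket

/-! ### The broadcast congested clique -/

/-- A synchronous message passing protocol on the complete network with nodes `Fin n`; all nodes run
the same program, which is given the identifier and the local input of the node, and one fresh
random bit per round.

In each round a node sends one and the same message to a set of recipients of its choice (`send`
gives the message and the recipients), or is silent.  It then updates its state from the random bit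
and from the messages received in this round, indexed by their senders (`receive`). -/
structure CliqueProtocol (n : ℕ) (Input State Message : Type) where
  start : Fin n → Input → State
  send : Fin n → State → Option (Message × Finset (Fin n))
  receive : Fin n → State → Bool → (Fin n → Option Message) → State
  halted : State → Prop

namespace CliqueProtocol

variable {n : ℕ} {Input State Message : Type}

/-- What node `j` receives in a round in which the nodes are in the states `σ`. -/
def inbox (P : CliqueProtocol n Input State Message) (σ : Fin n → State) (j : Fin n) :
    Fin n → Option Message := fun i =>
  match P.send i (σ i) with
  | some (m, R) => if j ∈ R then some m else none
  | none => none

/-- The states of the nodes after `t` rounds; `ω (t, i)` is the random bit of node `i` in the round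
that leads from time `t` to time `t + 1`. -/
def run (P : CliqueProtocol n Input State Message) (inp : Fin n → Input)
    (ω : ℕ × Fin n → Bool) : ℕ → Fin n → State
  | 0 => fun i => P.start i (inp i)
  | t + 1 => fun i =>
      P.receive i (P.run inp ω t i) (ω (t, i)) (P.inbox (P.run inp ω t) i)

/-- The number of messages sent in one round: a message to `k` recipients counts `k` times. -/
def roundMessages (P : CliqueProtocol n Input State Message) (σ : Fin n → State) : ℕ :=
  ∑ i, match P.send i (σ i) with
    | some (_, R) => R.card
    | none => 0

/-- The number of messages sent in the first `t` rounds. -/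
def messages (P : CliqueProtocol n Input State Message) (inp : Fin n → Input)
    (ω : ℕ × Fin n → Bool) (t : ℕ) : ℕ :=
  ∑ s ∈ Finset.range t, P.roundMessages (P.run inp ω s)

/-- All nodes have halted after `t` rounds. -/
def HaltedAt (P : CliqueProtocol n Input State Message) (inp : Fin n → Input)
    (ω : ℕ × Fin n → Bool) (t : ℕ) : Prop :=
  ∀ i, P.halted (P.run inp ω t i)

end CliqueProtocol

/-- The law of the random bits: independent fair coins, one for each round and each node. -/
noncomputable def coinMeasure (n : ℕ) : MeasureTheory.Measure (ℕ × Fin n → Bool) :=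
  MeasureTheory.Measure.infinitePi fun _ => (PMF.uniformOfFintype Bool).toMeasure

/-! ### Auxiliary functions -/

theorem clog_two_lt_self {n : ℕ} (hn : 1 < n) : Nat.clog 2 n < n :=
  have h : 2 ^ (Nat.clog 2 n - 1) < n := by
    simpa using Nat.pow_pred_clog_lt_self (b := 2) (by norm_num) hn
  have h2 : Nat.clog 2 n - 1 < 2 ^ (Nat.clog 2 n - 1) := Nat.lt_two_pow_self
  by omega

theorem two_mul_clog_two_lt_self {n : ℕ} (hn : 6 < n) : 2 * Nat.clog 2 n < n := by
  have h : 2 ^ (Nat.clog 2 n - 1) < n := by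
    simpa using Nat.pow_pred_clog_lt_self (b := 2) (by norm_num) (by omega : 1 < n)
  by_cases h3 : Nat.clog 2 n ≤ 3
  · omega
  · obtain ⟨k, hk⟩ : ∃ k, Nat.clog 2 n = k + 4 := ⟨Nat.clog 2 n - 4, by omega⟩
    rw [hk] at h ⊢
    have h4 : k < 2 ^ k := Nat.lt_two_pow_self
    have h5 : 2 ^ (k + 4 - 1) = 8 * 2 ^ k := by
      rw [show k + 4 - 1 = k + 3 by omega, pow_add]; ring
    omega

/-- The iterated logarithm `log*` to base two: the number of times that the (rounded up) binary
logarithm has to be applied to `n` until the result is at most one. Rounding up does not change this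
number, because a real number is at most a given tower of twos if and only if its ceiling is. -/
def logStar (n : ℕ) : ℕ :=
  if n ≤ 1 then 0 else logStar (Nat.clog 2 n) + 1
termination_by n
decreasing_by exact clog_two_lt_self (by omega)

/-- One step of deterministic coin tossing: a node of colour `c` whose successor has colour `d` gets
the new colour `2 * k + b`, where `k` is the lowest position in which the binary expansions of `c`
and `d` differ (`k = 0` if there is none) and `b` is the bit of `c` in this position. -/
def tossColor (c d : ℕ) : ℕ :=
  let k := ((List.range (c + d)).find? fun k => c.testBit k != d.testBit k).getD 0
  2 * k + (c.testBit k).toNat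

/-- The number of coin tossing steps that turn a colouring with `N` colours into one with six
colours: a step replaces `N` colours, which have `Nat.clog 2 N` bits, by `2 * Nat.clog 2 N`. -/
def tossSteps (N : ℕ) : ℕ :=
  if N ≤ 6 then 0 else tossSteps (2 * Nat.clog 2 N) + 1
termination_by N
decreasing_by exact two_mul_clog_two_lt_self (by omega)

/-! ### The distributed top trading cycle algorithm -/

namespace DistributedTTC

/-- The subroutine that finds the cycles: the randomized one, in which a node is deactivated if it
flips heads and its successor flips tails, or the deterministic one, which uses a 6-colouring. -/
inductive Subroutine
  | coinFlip
  | coloring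

/-- The messages. -/
inductive Message (n : ℕ)
  | owner (h : Fin n)
  | request
  | color (c : ℕ)
  | status (active : Bool) (succ : Fin n)
  | remove (h : Fin n)
  | cycle
  | ok
  | nextStage
  deriving DecidableEq

/-- The binary encoding of the messages: three bits for the kind, followed by the contents. -/
def Message.encode {n : ℕ} : Message n → List Bool
  | .owner h => false :: false :: false :: Nat.bits h
  | .request => [false, false, true]
  | .color c => false :: true :: false :: Nat.bits c
  | .status a s => false :: true :: true :: a :: Nat.bits s
  | .remove h => true :: false :: false :: Nat.bits h
  | .cycle => [true, false, true]
  | .ok => [true, true, false]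
  | .nextStage => [true, true, true]

theorem bits_injective : Function.Injective Nat.bits := by
  intro a
  induction a using Nat.binaryRec' with
  | zero =>
    intro b h
    induction b using Nat.binaryRec' with
    | zero => rfl
    | bit x m hm _ => rw [Nat.bits_append_bit m x hm] at h; simp at h
  | bit x m hm ih =>
    intro b h
    induction b using Nat.binaryRec' with
    | zero => rw [Nat.bits_append_bit m x hm] at h; simp at h
    | bit y k hk _ =>
      rw [Nat.bits_append_bit m x hm, Nat.bits_append_bit k y hk] at h
      simp only [List.cons.injEq] at h
      rw [h.1, ih h.2]

theorem Message.encode_injective {n : ℕ} : Function.Injective (Message.encode (n := n)) := by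
  intro a b h
  cases a <;> cases b <;> simp [Message.encode] at h ⊢
  · exact Fin.ext (bits_injective h)
  · exact bits_injective h
  · exact ⟨h.1, Fin.ext (bits_injective h.2)⟩
  · exact Fin.ext (bits_injective h)

/-- An exchange consists of two rounds: nodes send requests to their current successors, and then
the successors answer.  `toss k` is a colour reduction step, in `mark` the symmetry between
consecutive active nodes is broken, `explore k` is one pass through the loop of the explore step. -/
inductive Exchange
  | toss (k : ℕ)
  | mark
  | explore (k : ℕ)
  deriving DecidableEq

/-- The control state of a node. -/
inductive Phase
  | hello
  | request (e : Exchange)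
  | reply (e : Exchange)
  | check
  | trade
  | done
  deriving DecidableEq

/-- What a node does in the phase `trade`: it waits whether it turns out to be a cycle node (`idle`);
a cycle node then broadcasts `remove`, forwards `cycle` to its children, waits for the `ok` of all
its children before it reports, and is `finished`. -/
inductive Progress
  | idle
  | announce
  | forward
  | wait
  | finished
  deriving DecidableEq

/-- The local input of an agent: its preference list and its initial house. -/
structure LocalInput (n : ℕ) where
  prefs : List (Fin n)
  house : Fin n

/-- The variables of a node. -/
structure NodeState (n : ℕ) where
  phase : Phase
  /-- the house that the node holds -/
  house : Fin n
  /-- whether the node has been assigned its final house -/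
  assigned : Bool
  /-- the node that initially holds a given house -/
  holder : Fin n → Fin n
  /-- the preference list without the houses that have been removed -/
  prefs : List (Fin n)
  /-- the current top choice -/
  top : Fin n
  /-- cycle finding: whether the node is active -/
  active : Bool
  /-- cycle finding: the current successor -/
  succ : Fin n
  /-- cycle finding: whether the current successor is known to be active -/
  succActive : Bool
  /-- cycle finding: the nodes traversed so far, that is, the children in the tree -/
  children : Finset (Fin n)
  /-- cycle finding: the current colour (or coin: `0` for heads and `1` for tails) -/
  color : ℕ
  /-- the nodes whose requests are to be answered -/
  requesters : Finset (Fin n)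
  /-- whether the node knows that it lies on a cycle -/
  inCycle : Bool
  progress : Progress
  /-- the parent in the tree -/
  parent : Fin n
  /-- the children that have sent `ok` -/
  oks : Finset (Fin n)
  /-- the roots of this stage that have not yet broadcast `nextStage` -/
  pending : Finset (Fin n)

variable {n : ℕ}

/-- The nodes from which the message `m` has been received. -/
def senders (inbox : Fin n → Option (Message n)) (m : Message n) : Finset (Fin n) :=
  Finset.univ.filter fun j => inbox j = some m

/-- The nodes from which a message `remove` has been received. -/
def removers (inbox : Fin n → Option (Message n)) : Finset (Fin n) :=
  Finset.univ.filter fun j => ∃ h, inbox j = some (.remove h)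

/-- The list of houses `l` without those named in the received messages `remove`. -/
def dropRemoved (inbox : Fin n → Option (Message n)) (l : List (Fin n)) : List (Fin n) :=
  l.filter fun h => senders inbox (.remove h) = ∅

/-- The first node, if any, from which the message `m` has been received. -/
def firstSender (inbox : Fin n → Option (Message n)) (m : Message n) : Option (Fin n) :=
  (List.finRange n).find? fun j => inbox j = some m

/-- The explore step is a loop in which an active node replaces its successor by the successor of
its successor until this is active.  At most five consecutive nodes are inactive, so that six
exchanges are reserved for it. -/
def exploreLength : ℕ := 6

/-- Start an iteration of the cycle finding subroutine. -/
def beginIteration (alg : Subroutine) (i : Fin n) (s : NodeState n) : NodeState n :=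
  match alg with
  | .coinFlip => { s with phase := .request .mark }
  | .coloring =>
      { s with
        phase := .request (if tossSteps n = 0 then .mark else .toss 0)
        color := i }

/-- Start a stage: the successor is the holder of the current top choice. -/
def beginStage (alg : Subroutine) (i : Fin n) (s : NodeState n) : NodeState n :=
  let top := s.prefs.headD s.house
  beginIteration alg i
    { s with
      top := top
      active := true
      succ := s.holder top
      succActive := false
      children := ∅
      inCycle := false
      progress := .idle
      parent := i
      oks := ∅
      pending := ∅ }

/-- A node learns that it lies on a cycle: it is assigned its current top choice. -/
def enterCycle (parent : Fin n) (p : Progress) (s : NodeState n) : NodeState n :=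
  { s with
    active := false
    inCycle := true
    house := s.top
    assigned := true
    parent := parent
    progress := p }

/-- The phase that follows the replies of an exchange. -/
def phaseAfter (n : ℕ) : Exchange → Phase
  | .toss k => .request (if k + 1 < tossSteps n then .toss (k + 1) else .mark)
  | .mark => .request (.explore 0)
  | .explore k => if k + 1 < exploreLength then .request (.explore (k + 1)) else .check

/-- Whether a node sends a request in an exchange. -/
def wantsReply (s : NodeState n) : Exchange → Bool
  | .toss _ => s.active
  | .mark => s.active
  | .explore _ => s.active && !s.succActive

/-- The answer of a node to requests. -/
def answer (s : NodeState n) : Exchange → Message n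
  | .toss _ => .color s.color
  | .mark => .color s.color
  | .explore _ => .status s.active s.succ

/-- What a node does with the answer of its successor. -/
def processAnswer (s : NodeState n) : Exchange → Option (Message n) → NodeState n
  | .toss _, some (.color c) => { s with color := tossColor s.color c }
  | .mark, some (.color c) =>
      { s with
        active := decide (¬ s.color < c)
        succActive := false }
  | .explore _, some (.status true _) => { s with succActive := true }
  | .explore _, some (.status false j) =>
      { s with
        children := insert s.succ s.children
        succ := j }
  | _, _ => s

/-- The initial state. -/
def start (i : Fin n) (inp : LocalInput n) : NodeState n where
  phase := .hello
  house := inp.house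
  assigned := false
  holder := fun _ => i
  prefs := inp.prefs
  top := inp.house
  active := true
  succ := i
  succActive := false
  children := ∅
  color := 0
  requesters := ∅
  inCycle := false
  progress := .idle
  parent := i
  oks := ∅
  pending := ∅

/-- The message that a node sends in a round, and its recipients.  A node is the root of a tree if it
has become its own successor. -/
def send (i : Fin n) (s : NodeState n) : Option (Message n × Finset (Fin n)) :=
  match s.phase with
  | .hello => some (.owner s.house, Finset.univ)
  | .request e => if wantsReply s e then some (.request, {s.succ}) else none
  | .reply e => if s.requesters = ∅ then none else some (answer s e, s.requesters)
  | .check => if s.succ = i then some (.remove s.top, Finset.univ) else none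
  | .trade =>
      match s.progress with
      | .idle => none
      | .announce => some (.remove s.top, Finset.univ)
      | .forward => some (.cycle, s.children)
      | .wait =>
          if s.children ⊆ s.oks then
            if s.succ = i then some (.nextStage, Finset.univ) else some (.ok, {s.parent})
          else none
      | .finished => none
  | .done => none

/-- The activity of a node in the phase `trade`, apart from the bookkeeping. -/
def advance (s : NodeState n) (inbox : Fin n → Option (Message n)) : NodeState n :=
  match s.progress with
  | .idle =>
      match firstSender inbox .cycle with
      | some j => enterCycle j .announce s
      | none => s
  | .announce => { s with progress := .forward }
  | .forward => { s with progress := .wait }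
  | .wait => if s.children ⊆ s.oks then { s with progress := .finished } else s
  | .finished => s

/-- The new state of a node at the end of a round.

* `hello`: the nodes learn who holds which house, and start the first stage.
* `check`: the roots of the cycles found in this iteration have broadcast `remove`. If there are
  none, the next iteration begins.  Otherwise cycle finding ends for this stage, and the cycles that
  have been found are traded; nodes of other cycles will be served in a later stage.
* `trade`: the stage is over when all its roots have broadcast `nextStage`. -/
def receive (alg : Subroutine) (i : Fin n) (s : NodeState n) (coin : Bool)
    (inbox : Fin n → Option (Message n)) : NodeState n :=
  match s.phase with
  | .hello =>
      beginStage alg i { s with holder := fun h => (firstSender inbox (.owner h)).getD i }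
  | .request e =>
      { s with
        phase := .reply e
        requesters := senders inbox .request
        color :=
          match alg, e with
          | .coinFlip, .mark => coin.toNat
          | _, _ => s.color }
  | .reply e =>
      { processAnswer s e (inbox s.succ) with
        phase := phaseAfter n e
        requesters := ∅ }
  | .check =>
      let roots := removers inbox
      let s₁ := { s with prefs := dropRemoved inbox s.prefs }
      if roots = ∅ then beginIteration alg i s₁
      else
        let s₂ := { s₁ with phase := .trade, pending := roots }
        if s.succ = i then enterCycle i .forward s₂ else s₂
  | .trade =>
      let pending := s.pending \ senders inbox .nextStage
      let s₁ :=
        { advance s inbox with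
          prefs := dropRemoved inbox s.prefs
          oks := s.oks ∪ senders inbox .ok
          pending := pending }
      if pending = ∅ then
        if s₁.assigned then { s₁ with phase := .done } else beginStage alg i s₁
      else s₁
  | .done => s

/-- The distributed top trading cycle algorithm for `n` agents, with a given cycle finding
subroutine. -/
def protocol (n : ℕ) (alg : Subroutine) :
    CliqueProtocol n (LocalInput n) (NodeState n) (Message n) where
  start := start
  send := send
  receive := receive alg
  halted := fun s => s.phase = .done

/-- The local inputs given by a housing market. -/
def inputs (M : HousingMarket n) : Fin n → LocalInput n :=
  fun i => ⟨M.prefs i, M.endow i⟩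

end DistributedTTC

/-!
The algorithm is a distributed version of Gale's top trading cycles. `HousingMarket.TradedUntil` is
the invariant that makes it correct: the agents that have left are ranked by the stage in which they
left, the agents of each stage exchange their houses among themselves, and each gets the best house
not traded in an earlier stage. The order in which disjoint cycles are traded is irrelevant.
A coalition cannot improve on such an assignment, by induction on the rank; and if another matching
differs from it, the agents of the lowest rank where it does so block that matching
(`HousingMarket.TradedUntil.core_eq`).

Within a stage, let `f` map each remaining agent to the holder of its favourite house. Only the
cycles of `f` matter, because current successors are iterates of `f`, so that agents off the cycles
never become roots. On the cycles, `PointerForest` describes the pointer jumping: the children sets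
form a forest, the current successors permute its tops, and the tree of a node can be left along `f`
only at its current successor. Hence the tree of a root is closed under `f`: it is a whole cycle.
A chain of inactive nodes has increasing colours below six, and therefore six explore exchanges
suffice to jump over it (`Exploring.settled`). Since the depth of a node in the tree determines in
which rounds it acts, the state is known in closed form during the trade (`Schedule`, `Trading`),
which takes linear time in the number of trading agents.

For the running time, let `C` be a shortest cycle of the stage. The potential is twice the number of
remaining agents minus the number of inactive nodes on `C`. As long as no root is found, an
iteration deactivates a node of `C` always (colours) or with probability at least one quarter
(coins); when roots are found, at least as many agents leave as `C` has nodes, and this pays for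
the trade (`Ready.iterate`). The potential starts at `2 * n`, which settles the deterministic
subroutine (`Ready.halts`), since an iteration takes `2 * tossSteps n + 15` rounds and two coin
tossing steps shrink the palette at least as much as one logarithm (`tossSteps_le`). For the
randomized one, consider `2 ^ φ * (120 / 119) ^ t`, where `φ` is the potential at time `t`. Observed
at the beginnings of the iterations, until all nodes have halted, it is a supermartingale, so that
the probability of not having halted decays exponentially (`Ready.failure_le`).

The number of messages is bounded node by node (`messages_le`), for every outcome of the coins.
-/

/-! ### Top trading cycles and the core -/

namespace HousingMarket

variable {n : ℕ}

/-- The agents outside `L` have been assigned the houses `m a` in rounds of top trading: `rank a` is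
the round in which `a` is assigned its house (the agents in `L` have the largest rank `r`). In every
round the agents trade their own houses among themselves, and each of them gets the best house among
those that have not been traded in earlier rounds. -/
structure TradedUntil (M : HousingMarket n) (L : Finset (Fin n)) (m : Fin n → Fin n)
    (rank : Fin n → ℕ) (r : ℕ) : Prop where
  rank_of_mem : ∀ a ∈ L, rank a = r
  rank_lt : ∀ a ∉ L, rank a < r
  injOn : ∀ a ∉ L, ∀ b ∉ L, m a = m b → a = b
  mem_prefs : ∀ a ∉ L, m a ∈ M.prefs a
  rank_owner : ∀ a ∉ L, rank (M.endow.symm (m a)) = rank a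
  best : ∀ a ∉ L, ∀ h ∈ M.prefs a, rank a ≤ rank (M.endow.symm h) →
    (M.prefs a).idxOf (m a) ≤ (M.prefs a).idxOf h

theorem tradedUntil_univ (M : HousingMarket n) (m : Fin n → Fin n) :
    M.TradedUntil Finset.univ m (fun _ => 0) 0 := by
  constructor <;> simp

/-- One more round of top trading: the agents in `K` trade their houses. -/
theorem TradedUntil.sdiff {M : HousingMarket n} {L : Finset (Fin n)} {m : Fin n → Fin n}
    {rank : Fin n → ℕ} {r : ℕ} (h : M.TradedUntil L m rank r) {K : Finset (Fin n)} (hK : K ⊆ L)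
    {m' : Fin n → Fin n} (hm : ∀ a ∉ L, m' a = m a)
    (hinj : ∀ a ∈ K, ∀ b ∈ K, m' a = m' b → a = b)
    (hown : ∀ a ∈ K, M.endow.symm (m' a) ∈ K)
    (hmem : ∀ a ∈ K, m' a ∈ M.prefs a)
    (hbest : ∀ a ∈ K, ∀ x ∈ M.prefs a, M.endow.symm x ∈ L →
      (M.prefs a).idxOf (m' a) ≤ (M.prefs a).idxOf x) :
    M.TradedUntil (L \ K) m' (fun a => if a ∈ L \ K then r + 1 else rank a) (r + 1) := by
  have hout : ∀ a, a ∉ L \ K → a ∉ L ∨ a ∈ K := by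
    intro a ha
    by_cases h1 : a ∈ K
    · exact Or.inr h1
    · exact Or.inl fun h2 => ha (Finset.mem_sdiff.2 ⟨h2, h1⟩)
  have hKn : ∀ a ∈ K, a ∉ L \ K := fun a ha h2 => (Finset.mem_sdiff.1 h2).2 ha
  have hLn : ∀ a, a ∉ L → a ∉ L \ K := fun a ha h2 => ha (Finset.mem_sdiff.1 h2).1
  -- the owner of a house traded earlier is an agent who left earlier
  have hownL : ∀ a ∉ L, M.endow.symm (m' a) ∉ L := by
    intro a ha h2
    have h3 := h.rank_owner a ha
    rw [hm a ha] at h2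
    rw [h.rank_of_mem _ h2] at h3
    have := h.rank_lt a ha
    omega
  refine ⟨fun a ha => by simp only [ha, if_true], fun a ha => ?_, fun a ha b hb hab => ?_,
    fun a ha => ?_, fun a ha => ?_, fun a ha x hx hr => ?_⟩
  · simp only [ha, if_false]
    rcases hout a ha with h1 | h1
    · have := h.rank_lt a h1; omega
    · have := h.rank_of_mem a (hK h1); omega
  · rcases hout a ha with h1 | h1 <;> rcases hout b hb with h2 | h2
    · exact h.injOn a h1 b h2 (by rw [← hm a h1, ← hm b h2, hab])
    · exact absurd (hK (hown b h2)) (hab ▸ hownL a h1)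
    · exact absurd (hK (hown a h1)) (hab ▸ hownL b h2)
    · exact hinj a h1 b h2 hab
  · rcases hout a ha with h1 | h1
    · rw [hm a h1]; exact h.mem_prefs a h1
    · exact hmem a h1
  · simp only [ha, if_false]
    rcases hout a ha with h1 | h1
    · rw [if_neg (hLn _ (hownL a h1)), hm a h1]; exact h.rank_owner a h1
    · rw [if_neg (hKn _ (hown a h1)), h.rank_of_mem _ (hK (hown a h1)),
        h.rank_of_mem _ (hK h1)]
  · simp only [ha, if_false] at hr
    rcases hout a ha with h1 | h1
    · rw [hm a h1]
      refine h.best a h1 x hx ?_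
      by_cases h2 : M.endow.symm x ∈ L
      · have := h.rank_lt a h1; rw [h.rank_of_mem _ h2]; omega
      · rwa [if_neg (hLn _ h2)] at hr
    · refine hbest a h1 x hx ?_
      by_contra h2
      rw [if_neg (hLn _ h2), h.rank_of_mem _ (hK h1)] at hr
      have := h.rank_lt _ h2
      omega

/-- The matching that results from top trading. -/
def TradedUntil.matching {M : HousingMarket n} {m : Fin n → Fin n} {rank : Fin n → ℕ} {r : ℕ}
    (h : M.TradedUntil ∅ m rank r) : M.Matching where
  house a := some (m a)
  acceptable a x hx := by
    simp only [Option.some.injEq] at hx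
    exact hx ▸ h.mem_prefs a (Finset.notMem_empty a)
  injective a b x ha hb := by
    simp only [Option.some.injEq] at ha hb
    exact h.injOn a (Finset.notMem_empty a) b (Finset.notMem_empty b) (ha.trans hb.symm)

/-- If a set contains the owners of the houses that its members get, then the house of a member goes
to a member of the same rank. -/
theorem TradedUntil.exists_eq_endow {M : HousingMarket n} {m : Fin n → Fin n} {rank : Fin n → ℕ}
    {r : ℕ} (h : M.TradedUntil ∅ m rank r) (S : Finset (Fin n))
    (hS : ∀ a ∈ S, M.endow.symm (m a) ∈ S) {b : Fin n} (hb : b ∈ S) :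
    ∃ a ∈ S, rank a = rank b ∧ m a = M.endow b := by
  classical
  set S' := S.filter fun a => rank a = rank b
  have hmaps : ∀ a ∈ S', M.endow.symm (m a) ∈ S' := by
    intro a ha
    rw [Finset.mem_filter] at ha ⊢
    exact ⟨hS a ha.1, (h.rank_owner a (Finset.notMem_empty a)).trans ha.2⟩
  have hinj : Set.InjOn (fun a => M.endow.symm (m a)) S' := by
    intro a _ c _ hac
    exact h.injOn a (Finset.notMem_empty a) c (Finset.notMem_empty c)
      (M.endow.symm.injective hac)
  have hsurj := Finset.surjOn_of_injOn_of_card_le (s := S') (t := S')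
    (fun a => M.endow.symm (m a)) hmaps hinj le_rfl
  obtain ⟨a, ha, hab⟩ := hsurj (show b ∈ (S' : Set (Fin n)) by simp [S', hb])
  have ha' := Finset.mem_filter.1 (Finset.mem_coe.1 ha)
  refine ⟨a, ha'.1, ha'.2, ?_⟩
  rw [← hab]; simp

theorem TradedUntil.core_eq {M : HousingMarket n} {m : Fin n → Fin n} {rank : Fin n → ℕ} {r : ℕ}
    (h : M.TradedUntil ∅ m rank r) : M.core = {h.matching} := by
  classical
  have hidx : ∀ a x y, x ∈ M.prefs a → (M.prefs a).idxOf x = (M.prefs a).idxOf y → x = y :=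
    fun a x y hx hxy => (List.idxOf_inj hx).1 hxy
  ext μ
  rw [Set.mem_singleton_iff]
  constructor
  · intro hμ
    by_contra hne
    -- the agents of the lowest rank at which `μ` differs from the assignment form a coalition
    have hex : ∃ k, ∃ a, rank a = k ∧ μ.house a ≠ some (m a) := by
      by_contra hcon
      push Not at hcon
      exact hne (Matching.ext (funext fun a => hcon (rank a) a rfl))
    obtain ⟨a, hak, ha⟩ := Nat.find_spec hex
    have hmin : ∀ b, rank b < rank a → μ.house b = some (m b) := by
      intro b hb
      by_contra hc
      exact Nat.find_min hex (hak ▸ hb) ⟨b, rfl, hc⟩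
    have hpref : ∀ b, rank b = rank a → some (m b) ≠ μ.house b →
        M.Prefers b (some (m b)) (μ.house b) := by
      intro b hb hne'
      cases hx : μ.house b with
      | none => trivial
      | some x =>
        rw [hx] at hne'
        have hxm := μ.acceptable b x hx
        have hle : (M.prefs b).idxOf (m b) ≤ (M.prefs b).idxOf x := by
          refine h.best b (Finset.notMem_empty b) x hxm ?_
          by_contra hlt
          push Not at hlt
          obtain ⟨c, -, hc, hcx⟩ := h.exists_eq_endow Finset.univ (by simp)
            (Finset.mem_univ (M.endow.symm x))
          have h1 := hmin c (by omega)
          rw [hcx, Equiv.apply_symm_apply] at h1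
          have h2 := μ.injective b c x hx h1
          subst h2
          omega
        refine lt_of_le_of_ne hle fun he => hne' ?_
        rw [hidx b _ _ (h.mem_prefs b (Finset.notMem_empty b)) he]
    refine hμ ⟨{b | rank b = rank a}, h.matching, ?_, ?_, a, rfl, hpref a rfl fun he => ha he.symm⟩
    · intro b hb
      refine ⟨M.endow.symm (m b), ?_, by simp [TradedUntil.matching]⟩
      exact (h.rank_owner b (Finset.notMem_empty b)).trans hb
    · intro b hb
      by_cases he : some (m b) = μ.house b
      · exact Or.inl he
      · exact Or.inr (hpref b hb he)
  · rintro rfl ⟨S, ν, hS, hle, a₀, ha₀, hlt⟩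
    have hsame : ∀ k, ∀ a ∈ S, rank a = k → ν.house a = some (m a) := by
      intro k
      induction k using Nat.strong_induction_on with
      | _ k ih =>
        intro a ha hak
        obtain ⟨b, hb, hab⟩ := hS a ha
        rcases hle a ha with h1 | h1
        · exact h1
        exfalso
        have h1' : (M.prefs a).idxOf (M.endow b) < (M.prefs a).idxOf (m a) := by
          rw [hab] at h1; exact h1
        have hbk : rank b < k := by
          by_contra hc
          have := h.best a (Finset.notMem_empty a) _ (ν.acceptable a _ hab) (by simp; omega)
          omega
        -- the members of `S` that leave before `a` exhaust their own houses
        let T : Finset (Fin n) := Finset.univ.filter fun c => c ∈ S ∧ rank c < k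
        obtain ⟨c, hc, -, hcb⟩ := h.exists_eq_endow T (fun c hc => by
          simp only [T, Finset.mem_filter, Finset.mem_univ, true_and] at hc ⊢
          obtain ⟨d, hd, hcd⟩ := hS c hc.1
          rw [ih _ hc.2 c hc.1 rfl, Option.some.injEq] at hcd
          refine ⟨by rw [hcd]; simpa using hd, ?_⟩
          rw [h.rank_owner c (Finset.notMem_empty c)]; exact hc.2)
          (show b ∈ T by simp [T, hb, hbk])
        simp only [T, Finset.mem_filter, Finset.mem_univ, true_and] at hc
        have h2 := ih _ hc.2 c hc.1 rfl
        rw [hcb] at h2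
        have h3 := ν.injective a c _ hab h2
        subst h3
        omega
    rw [hsame _ a₀ ha₀ rfl] at hlt
    exact lt_irrefl _ hlt

end HousingMarket

/-! ### Deterministic coin tossing -/

/-- Different colours differ in a position below their sum, so that the search for it succeeds. -/
theorem tossColor_spec {c d : ℕ} (h : c ≠ d) :
    ∃ k, c.testBit k ≠ d.testBit k ∧ tossColor c d = 2 * k + (c.testBit k).toNat := by
  unfold tossColor
  cases hf : (List.range (c + d)).find? fun k => c.testBit k != d.testBit k with
  | some k =>
    refine ⟨k, ?_, by simp⟩
    have := List.find?_some hf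
    simpa using this
  | none =>
    exfalso
    rw [List.find?_eq_none] at hf
    obtain ⟨k, hk⟩ := Nat.exists_testBit_ne_of_ne h
    refine hf k ?_ (by simpa using hk)
    rw [List.mem_range]
    by_contra hle
    push Not at hle
    have h1 : k < 2 ^ k := Nat.lt_two_pow_self
    rw [Nat.testBit_eq_false_of_lt (by omega), Nat.testBit_eq_false_of_lt (by omega)] at hk
    exact hk rfl

theorem tossColor_self (c : ℕ) : tossColor c c = (c.testBit 0).toNat := by
  have : (List.range (c + c)).find? (fun k => c.testBit k != c.testBit k) = none := by
    rw [List.find?_eq_none]; simp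
  unfold tossColor
  rw [this]
  simp

/-- Consecutive nodes get different colours; the last node may be its own successor. -/
theorem tossColor_ne {c d e : ℕ} (h : c ≠ d) : tossColor c d ≠ tossColor d e := by
  obtain ⟨k, hk, h1⟩ := tossColor_spec h
  have key : ∀ l, tossColor d e = 2 * l + (d.testBit l).toNat → tossColor c d ≠ tossColor d e := by
    intro l h2 h3
    rw [h1, h2] at h3
    have ha := Bool.toNat_lt (c.testBit k)
    have hb := Bool.toNat_lt (d.testBit l)
    have hkl : k = l := by omega
    subst hkl
    cases h4 : c.testBit k <;> cases h5 : d.testBit k <;> simp_all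
  by_cases hde : d = e
  · subst hde
    exact key 0 (by simp [tossColor_self])
  · obtain ⟨l, -, h2⟩ := tossColor_spec hde
    exact key l h2

theorem tossColor_lt {c d N : ℕ} (hN : 2 ≤ N) (hc : c < N) (hd : d < N) :
    tossColor c d < 2 * Nat.clog 2 N := by
  have hpos : 0 < Nat.clog 2 N := Nat.clog_pos (by norm_num) hN
  by_cases h : c = d
  · subst h
    rw [tossColor_self]
    have := Bool.toNat_lt (c.testBit 0)
    omega
  · obtain ⟨k, hk, h1⟩ := tossColor_spec h
    have hkN : k < Nat.clog 2 N := by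
      by_contra hle
      push Not at hle
      have h2 : N ≤ 2 ^ k := (Nat.le_pow_clog (by norm_num) N).trans
        (Nat.pow_le_pow_right (by norm_num) hle)
      rw [Nat.testBit_eq_false_of_lt (by omega), Nat.testBit_eq_false_of_lt (by omega)] at hk
      exact hk rfl
    have := Bool.toNat_lt (c.testBit k)
    omega

/-- The size of the palette after `k` steps of deterministic coin tossing. -/
def palette (N : ℕ) : ℕ → ℕ
  | 0 => N
  | k + 1 => 2 * Nat.clog 2 (palette N k)

theorem palette_succ' (N k : ℕ) : palette N (k + 1) = palette (2 * Nat.clog 2 N) k := by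
  induction k with
  | zero => rfl
  | succ k ih => rw [palette, ih, palette]

theorem tossSteps_of_le {N : ℕ} (h : N ≤ 6) : tossSteps N = 0 := by
  rw [tossSteps, if_pos h]

theorem tossSteps_of_lt {N : ℕ} (h : 6 < N) :
    tossSteps N = tossSteps (2 * Nat.clog 2 N) + 1 := by
  rw [tossSteps, if_neg (by omega)]

theorem palette_tossSteps_le (N : ℕ) : palette N (tossSteps N) ≤ 6 := by
  induction N using Nat.strong_induction_on with
  | _ N ih =>
    by_cases h : N ≤ 6
    · rw [tossSteps_of_le h]; exact h
    · rw [tossSteps_of_lt (by omega), palette_succ']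
      exact ih _ (two_mul_clog_two_lt_self (by omega))

theorem six_lt_palette {N k : ℕ} (hk : k < tossSteps N) : 6 < palette N k := by
  induction k generalizing N with
  | zero =>
    by_contra h
    rw [tossSteps_of_le (by simpa [palette] using h)] at hk
    omega
  | succ k ih =>
    rw [palette_succ']
    apply ih
    by_cases h : N ≤ 6
    · rw [tossSteps_of_le h] at hk; omega
    · rw [tossSteps_of_lt (by omega)] at hk; omega

theorem tossSteps_mono : Monotone tossSteps := by
  intro a b
  induction b using Nat.strong_induction_on generalizing a with
  | _ b ih =>
    intro hab
    by_cases h : a ≤ 6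
    · rw [tossSteps_of_le h]; omega
    · rw [tossSteps_of_lt (by omega), tossSteps_of_lt (N := b) (by omega)]
      have := ih _ (two_mul_clog_two_lt_self (by omega))
        (Nat.mul_le_mul_left 2 (Nat.clog_mono_right 2 hab))
      omega

theorem clog_two_two_mul {m : ℕ} (hm : 0 < m) : Nat.clog 2 (2 * m) = Nat.clog 2 m + 1 := by
  rw [Nat.clog_of_two_le (by norm_num) (by omega)]
  congr 2
  omega

theorem two_mul_clog_two_add_two_le {m : ℕ} (hm : 10 ≤ m) : 2 * Nat.clog 2 m + 2 ≤ m := by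
  induction m using Nat.strong_induction_on with
  | _ m ih =>
    rw [Nat.clog_of_two_le (by norm_num) (by omega)]
    by_cases h : (m + 2 - 1) / 2 < 10
    · have h1 : Nat.clog 2 ((m + 2 - 1) / 2) ≤ Nat.clog 2 8 ∨ 16 < m := by
        by_cases h2 : 16 < m
        · exact Or.inr h2
        · exact Or.inl (Nat.clog_mono_right 2 (by omega))
      have h3 : Nat.clog 2 8 = 3 := by
        rw [show (8 : ℕ) = 2 ^ 3 by norm_num, Nat.clog_pow 2 3 (by norm_num)]
      have h4 : Nat.clog 2 ((m + 2 - 1) / 2) ≤ Nat.clog 2 16 := Nat.clog_mono_right 2 (by omega)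
      have h5 : Nat.clog 2 16 = 4 := by
        rw [show (16 : ℕ) = 2 ^ 4 by norm_num, Nat.clog_pow 2 4 (by norm_num)]
      omega
    · have := ih ((m + 2 - 1) / 2) (by omega) (by omega)
      omega

/-- Two coin tossing steps reduce the palette at least as much as one logarithm, once this is at
least ten, that is, for palettes of more than `2 ^ 9` colours. -/
theorem tossSteps_le (N : ℕ) : tossSteps N ≤ 2 * logStar N + tossSteps 512 := by
  induction N using Nat.strong_induction_on with
  | _ N ih =>
    by_cases h : N ≤ 512
    · have := tossSteps_mono h; omega
    · have hm : 10 ≤ Nat.clog 2 N := by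
        have h1 : (512 : ℕ) < N := by omega
        by_contra hlt
        have h2 : N ≤ 2 ^ 9 := (Nat.le_pow_clog (by norm_num) N).trans
          (Nat.pow_le_pow_right (by norm_num) (by omega))
        norm_num at h2
        omega
      have h1 : tossSteps N = tossSteps (2 * Nat.clog 2 (2 * Nat.clog 2 N)) + 1 + 1 := by
        rw [tossSteps_of_lt (by omega), tossSteps_of_lt (N := 2 * Nat.clog 2 N) (by omega)]
      have h2 : 2 * Nat.clog 2 (2 * Nat.clog 2 N) ≤ Nat.clog 2 N := by
        rw [clog_two_two_mul (by omega)]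
        have := two_mul_clog_two_add_two_le hm
        omega
      have h3 := tossSteps_mono h2
      have h4 := ih _ (clog_two_lt_self (n := N) (by omega))
      have h5 : logStar N = logStar (Nat.clog 2 N) + 1 := by
        rw [logStar, if_neg (by omega)]
      omega

namespace DistributedTTC

variable {n : ℕ}

/-! ### One round of the protocol -/

/-- What node `j` receives when the nodes are in the states `σ`. -/
abbrev inbox (σ : Fin n → NodeState n) (j : Fin n) : Fin n → Option (Message n) :=
  (protocol n .coinFlip).inbox σ j

/-- The states after one round in which the nodes draw the random bits `x`. -/
def step (alg : Subroutine) (σ : Fin n → NodeState n) (x : Fin n → Bool) :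
    Fin n → NodeState n :=
  fun i => receive alg i (σ i) (x i) (inbox σ i)

theorem run_succ (alg : Subroutine) (inp : Fin n → LocalInput n) (ω : ℕ × Fin n → Bool) (t : ℕ) :
    (protocol n alg).run inp ω (t + 1) =
      step alg ((protocol n alg).run inp ω t) fun i => ω (t, i) := rfl

theorem inbox_eq_some {σ : Fin n → NodeState n} {i j : Fin n} {m : Message n} :
    inbox σ j i = some m ↔ ∃ R, send i (σ i) = some (m, R) ∧ j ∈ R := by
  simp only [inbox, CliqueProtocol.inbox, protocol]
  cases h : send i (σ i) with
  | none => simp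
  | some p =>
    obtain ⟨m', R⟩ := p
    by_cases hj : j ∈ R
    · simp [hj]
    · simp only [hj, if_false, Option.some.injEq, Prod.mk.injEq]
      simp only [reduceCtorEq, false_iff, not_exists, not_and]
      rintro R' ⟨-, rfl⟩; exact hj

theorem mem_senders {σ : Fin n → NodeState n} {i j : Fin n} {m : Message n} :
    i ∈ senders (inbox σ j) m ↔ ∃ R, send i (σ i) = some (m, R) ∧ j ∈ R := by
  rw [← inbox_eq_some]; simp [senders]

theorem mem_removers {σ : Fin n → NodeState n} {i j : Fin n} :
    i ∈ removers (inbox σ j) ↔ ∃ h R, send i (σ i) = some (.remove h, R) ∧ j ∈ R := by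
  simp [removers, inbox_eq_some]

/-! ### The size of the messages -/

theorem beginIteration_color (alg : Subroutine) (i : Fin n) (s : NodeState n) :
    (beginIteration alg i s).color = s.color ∨ (beginIteration alg i s).color = i := by
  cases alg <;> simp [beginIteration]

theorem beginStage_color (alg : Subroutine) (i : Fin n) (s : NodeState n) :
    (beginStage alg i s).color = s.color ∨ (beginStage alg i s).color = i := by
  unfold beginStage
  exact beginIteration_color alg i _

theorem color_eq_of_send {i : Fin n} {s : NodeState n} {c : ℕ} {R : Finset (Fin n)}
    (h : send i s = some (.color c, R)) : c = s.color := by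
  unfold send at h
  split at h
  · simp at h
  · split_ifs at h; simp at h
  · rename_i e _
    split_ifs at h
    cases e <;> simp [answer] at h
    all_goals exact h.1.symm
  · split_ifs at h; simp at h
  · split at h <;> (try split_ifs at h) <;> simp at h
  · simp at h

theorem advance_color (s : NodeState n) (inb : Fin n → Option (Message n)) :
    (advance s inb).color = s.color := by
  unfold advance
  cases s.progress
  · cases firstSender inb .cycle <;> rfl
  · rfl
  · rfl
  · dsimp only; split_ifs <;> rfl
  · rfl

theorem processAnswer_color_lt {N : ℕ} (hN : 6 < N) {s : NodeState n} (hs : s.color < N)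
    (e : Exchange) (m : Option (Message n)) (hm : ∀ c, m = some (.color c) → c < N) :
    (processAnswer s e m).color < N := by
  unfold processAnswer
  split
  · rename_i c
    have h1 := tossColor_lt (by omega) hs (hm c rfl)
    have h2 := two_mul_clog_two_lt_self hN
    dsimp only; omega
  all_goals exact hs

theorem step_color_lt {alg : Subroutine} {σ : Fin n → NodeState n}
    (hσ : ∀ i, (σ i).color < n + 7) (x : Fin n → Bool) (i : Fin n) :
    (step alg σ x i).color < n + 7 := by
  have hin : ∀ j c, inbox σ i j = some (.color c) → c < n + 7 := by
    intro j c h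
    obtain ⟨R, h1, -⟩ := inbox_eq_some.1 h
    rw [color_eq_of_send h1]; exact hσ j
  have hi := hσ i
  have hlt := i.isLt
  have hst : ∀ s : NodeState n, s.color = (σ i).color → (beginStage alg i s).color < n + 7 := by
    intro s hs
    rcases beginStage_color alg i s with h | h <;> omega
  have hit : ∀ s : NodeState n, s.color = (σ i).color →
      (beginIteration alg i s).color < n + 7 := by
    intro s hs
    rcases beginIteration_color alg i s with h | h <;> omega
  unfold step receive
  split
  · exact hst _ rfl
  · dsimp only
    split
    · have := Bool.toNat_lt (x i); omega
    · exact hi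
  · exact processAnswer_color_lt (by omega) hi _ _ (hin _)
  · dsimp only
    split_ifs
    · exact hit _ rfl
    · exact hi
    · exact hi
  · dsimp only
    split_ifs
    · dsimp only; rw [advance_color]; exact hi
    · exact hst _ (advance_color _ _)
    · dsimp only; rw [advance_color]; exact hi
  · exact hi

theorem run_color_lt (alg : Subroutine) (inp : Fin n → LocalInput n) (ω : ℕ × Fin n → Bool)
    (t : ℕ) (i : Fin n) : ((protocol n alg).run inp ω t i).color < n + 7 := by
  induction t generalizing i with
  | zero => exact Nat.lt_of_lt_of_le (Nat.zero_lt_succ 6) (Nat.le_add_left 7 n)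
  | succ t ih => rw [run_succ]; exact step_color_lt ih _ i

theorem length_bits_le {a : ℕ} (ha : a < n + 7) : (Nat.bits a).length ≤ Nat.log 2 n + 4 := by
  rw [Nat.size_eq_bits_len, Nat.size_le]
  have h1 : n < 2 ^ (Nat.log 2 n + 1) := Nat.lt_pow_succ_log_self (by norm_num) n
  have h2 : 2 ^ (Nat.log 2 n + 4) = 8 * 2 ^ (Nat.log 2 n + 1) := by ring
  omega

/-- The contents of a message is a number below `n + 7`. -/
theorem length_encode_le {m : Message n} (hm : ∀ c, m = .color c → c < n + 7) :
    m.encode.length ≤ 8 * (Nat.log 2 n + 1) := by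
  have hfin : ∀ h : Fin n, (Nat.bits h).length ≤ Nat.log 2 n + 4 :=
    fun h => length_bits_le (by omega)
  cases m with
  | owner h => simp only [Message.encode, List.length_cons]; have := hfin h; omega
  | request => simp only [Message.encode, List.length_cons, List.length_nil]; omega
  | color c =>
    simp only [Message.encode, List.length_cons]
    have := length_bits_le (hm c rfl); omega
  | status a h => simp only [Message.encode, List.length_cons]; have := hfin h; omega
  | remove h => simp only [Message.encode, List.length_cons]; have := hfin h; omega
  | cycle => simp only [Message.encode, List.length_cons, List.length_nil]; omega
  | ok => simp only [Message.encode, List.length_cons, List.length_nil]; omega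
  | nextStage => simp only [Message.encode, List.length_cons, List.length_nil]; omega

/-! ### The number of messages -/

/-- What is known about a single node at any time: it takes part in trading only in the phase
`trade`, has found its final house if it does so, and keeps requests only until it answers them. -/
structure NodeState.Sound (s : NodeState n) : Prop where
  idle : s.phase ≠ .trade → s.phase ≠ .done → s.progress = .idle ∧ s.assigned = false
  trade : s.phase = .trade → (s.progress = .idle ↔ s.assigned = false)
  requesters : (∀ e, s.phase ≠ .reply e) → s.requesters = ∅

/-- The number of messages that a node may still send in the future, apart from requests and
replies. -/
def NodeState.budget (s : NodeState n) : ℕ :=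
  match s.phase, s.progress with
  | .hello, _ => 5 * n
  | .done, _ => 0
  | _, .idle => 4 * n
  | _, .announce => 3 * n
  | _, .forward => 2 * n
  | _, .wait => n
  | _, .finished => 0

theorem beginIteration_sound {alg : Subroutine} {i : Fin n} {s : NodeState n}
    (hp : s.progress = .idle) (ha : s.assigned = false) (hr : s.requesters = ∅) :
    (beginIteration alg i s).Sound ∧ (beginIteration alg i s).budget = 4 * n := by
  cases alg <;> simp only [beginIteration] <;> refine ⟨⟨?_, ?_, ?_⟩, ?_⟩ <;>
    simp [hp, ha, hr, NodeState.budget]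

theorem beginStage_sound {alg : Subroutine} {i : Fin n} {s : NodeState n}
    (ha : s.assigned = false) (hr : s.requesters = ∅) :
    (beginStage alg i s).Sound ∧ (beginStage alg i s).budget = 4 * n :=
  beginIteration_sound rfl ha hr

/-- The number of messages that a node sends in a round. -/
def cost (i : Fin n) (s : NodeState n) : ℕ :=
  match send i s with
  | some (_, R) => R.card
  | none => 0

theorem roundMessages_eq (alg : Subroutine) (σ : Fin n → NodeState n) :
    (protocol n alg).roundMessages σ = ∑ i, cost i (σ i) := by
  refine Finset.sum_congr rfl fun i _ => ?_
  simp only [cost, protocol]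
  cases send i (σ i) <;> rfl

theorem processAnswer_progress (s : NodeState n) (e : Exchange) (m : Option (Message n)) :
    (processAnswer s e m).progress = s.progress := by
  unfold processAnswer; split <;> rfl

theorem processAnswer_assigned (s : NodeState n) (e : Exchange) (m : Option (Message n)) :
    (processAnswer s e m).assigned = s.assigned := by
  unfold processAnswer; split <;> rfl

theorem phaseAfter_ne (e : Exchange) :
    phaseAfter n e ≠ .trade ∧ phaseAfter n e ≠ .done ∧ phaseAfter n e ≠ .hello ∧
      ∀ e', phaseAfter n e ≠ .reply e' := by
  cases e <;> simp only [phaseAfter] <;> (try split_ifs) <;> simp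

theorem requesters_subset_senders {alg : Subroutine} {σ : Fin n → NodeState n}
    (hσ : ∀ i, (σ i).Sound) (x : Fin n → Bool) (i : Fin n) :
    (step alg σ x i).requesters ⊆ senders (inbox σ i) .request := by
  have hi := (hσ i).requesters
  have key : ∀ s : NodeState n, s.requesters = (σ i).requesters →
      (∀ e, (σ i).phase ≠ .reply e) → s.requesters ⊆ senders (inbox σ i) .request := by
    intro s hs h
    rw [hs, hi h]; exact Finset.empty_subset _
  have hst : ∀ s : NodeState n, (beginStage alg i s).requesters = s.requesters := by
    intro s; cases alg <;> rfl
  have hit : ∀ s : NodeState n, (beginIteration alg i s).requesters = s.requesters := by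
    intro s; cases alg <;> rfl
  have hadv : (advance (σ i) (inbox σ i)).requesters = (σ i).requesters := by
    unfold advance
    cases (σ i).progress
    · cases firstSender (inbox σ i) .cycle <;> rfl
    · rfl
    · rfl
    · dsimp only; split_ifs <;> rfl
    · rfl
  unfold step receive
  split
  · rename_i h; exact key _ (hst _) (by simp [h])
  · exact subset_rfl
  · exact Finset.empty_subset _
  · rename_i h
    dsimp only
    split_ifs
    · exact key _ (hit _) (by simp [h])
    · exact key _ rfl (by simp [h])
    · exact key _ rfl (by simp [h])
  · rename_i h
    dsimp only
    split_ifs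
    · exact key _ hadv (by simp [h])
    · exact key _ ((hst _).trans hadv) (by simp [h])
    · exact key _ hadv (by simp [h])
  · rename_i h; exact key _ rfl (by simp [h])

theorem step_sound {alg : Subroutine} {σ : Fin n → NodeState n}
    (hσ : ∀ i, (σ i).Sound) (x : Fin n → Bool) (i : Fin n) :
    (step alg σ x i).Sound ∧
      cost i (σ i) + (step alg σ x i).budget ≤
        (σ i).budget + 1 + (σ i).requesters.card := by
  have hn : 0 < n := i.pos
  obtain ⟨h1, h2, h3⟩ := hσ i
  set s := σ i with hs
  have hcheck : s.phase = .check → s.succ = i → removers (inbox σ i) ≠ ∅ := by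
    intro hp hsucc
    have : i ∈ removers (inbox σ i) := by
      rw [mem_removers]
      exact ⟨s.top, Finset.univ, by rw [← hs]; simp [send, hp, hsucc], Finset.mem_univ _⟩
    exact Finset.ne_empty_of_mem this
  unfold step receive
  rw [← hs]
  split
  · rename_i hp
    obtain ⟨h4, h5⟩ := h1 (by simp [hp]) (by simp [hp])
    have h6 := h3 (by simp [hp])
    have := beginStage_sound (alg := alg) (i := i)
      (s := { s with holder := fun h => (firstSender (inbox σ i) (.owner h)).getD i }) h5 h6
    refine ⟨this.1, ?_⟩
    rw [this.2]
    simp [cost, send, hp, NodeState.budget]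
    omega
  · rename_i e hp
    obtain ⟨h4, h5⟩ := h1 (by simp [hp]) (by simp [hp])
    refine ⟨⟨by simp [h4, h5], by simp, by simp⟩, ?_⟩
    simp only [cost, send, hp, NodeState.budget, h4]
    split_ifs <;> simp <;> omega
  · rename_i e hp
    obtain ⟨h4, h5⟩ := h1 (by simp [hp]) (by simp [hp])
    have h6 := phaseAfter_ne (n := n) e
    refine ⟨⟨fun _ _ => ⟨?_, ?_⟩, fun h => absurd h h6.1, fun _ => rfl⟩, ?_⟩
    · exact (processAnswer_progress _ _ _).trans h4
    · exact (processAnswer_assigned _ _ _).trans h5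
    · have h7 : cost i s ≤ s.requesters.card := by
        simp only [cost, send, hp]
        split_ifs <;> simp
      have h8 : s.budget = 4 * n := by simp [NodeState.budget, hp, h4]
      have h9 : ∀ s' : NodeState n, s'.phase = phaseAfter n e → s'.progress = .idle →
          s'.budget = 4 * n := by
        intro s' ha hb
        unfold NodeState.budget
        rw [ha, hb]
        cases hq : phaseAfter n e <;> simp_all
      rw [h9]
      · omega
      · rfl
      · exact (processAnswer_progress _ _ _).trans h4
  · rename_i hp
    obtain ⟨h4, h5⟩ := h1 (by simp [hp]) (by simp [hp])
    have h6 := h3 (by simp [hp])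
    dsimp only
    split_ifs with h7 h8
    · have h9 : s.succ ≠ i := fun h => hcheck hp h h7
      have := beginIteration_sound (alg := alg) (i := i)
        (s := { s with prefs := dropRemoved (inbox σ i) s.prefs }) h4 h5 h6
      refine ⟨this.1, ?_⟩
      rw [this.2]
      simp [cost, send, hp, h9, NodeState.budget, h4]
      omega
    · refine ⟨⟨by simp [enterCycle], by simp [enterCycle], by simp [enterCycle, h6]⟩, ?_⟩
      simp [cost, send, hp, h8, NodeState.budget, h4, enterCycle]
      omega
    · refine ⟨⟨by simp, by simp [h4, h5], by simp [h6]⟩, ?_⟩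
      simp [cost, send, hp, h8, NodeState.budget, h4]
      omega
  · rename_i hp
    have h6 := h3 (by simp [hp])
    have h4 := h2 hp
    have hadv : (advance s (inbox σ i)).requesters = ∅ ∧
        ((advance s (inbox σ i)).progress = .idle ↔ (advance s (inbox σ i)).assigned = false) ∧
        ((advance s (inbox σ i)).assigned = false → s.progress = .idle) ∧
        (advance s (inbox σ i)).phase = .trade ∧
        cost i s + (advance s (inbox σ i)).budget ≤ s.budget := by
      unfold advance
      cases hpr : s.progress with
      | idle =>
        have h7 : cost i s = 0 := by simp [cost, send, hp, hpr]
        cases firstSender (inbox σ i) .cycle with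
        | none => simp [h6, hpr, h4.1 hpr, hp, h7]
        | some j =>
          simp [h6, hpr, hp, h7, enterCycle, NodeState.budget]
          omega
      | announce =>
        have h7 : s.assigned = true := by
          by_contra hc; simp [h4.2 (by simpa using hc)] at hpr
        simp [h6, hpr, hp, h7, NodeState.budget, cost, send]
        omega
      | forward =>
        have h7 : s.assigned = true := by
          by_contra hc; simp [h4.2 (by simpa using hc)] at hpr
        have h8 := Finset.card_le_univ s.children
        simp at h8
        simp [h6, hpr, hp, h7, NodeState.budget, cost, send]
        omega
      | wait =>
        have h7 : s.assigned = true := by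
          by_contra hc; simp [h4.2 (by simpa using hc)] at hpr
        by_cases h8 : s.children ⊆ s.oks
        · simp [h6, hpr, hp, h7, NodeState.budget, cost, send, h8]
          split_ifs <;> simp
          all_goals omega
        · simp [h6, hpr, hp, h7, NodeState.budget, cost, send, h8]
      | finished =>
        have h7 : s.assigned = true := by
          by_contra hc; simp [h4.2 (by simpa using hc)] at hpr
        simp [h6, hpr, hp, h7, NodeState.budget, cost, send]
    obtain ⟨ha, hb, hc, hd, he⟩ := hadv
    have hbud : ∀ (p : List (Fin n)) (o q : Finset (Fin n)),
        ({ advance s (inbox σ i) with prefs := p, oks := o, pending := q } : NodeState n).budget =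
          (advance s (inbox σ i)).budget := fun _ _ _ => rfl
    dsimp only
    split_ifs with h7 h8
    · refine ⟨⟨by simp, by simp, by simp [ha]⟩, ?_⟩
      simp only [NodeState.budget]
      simp only [NodeState.budget] at he
      omega
    · simp only [Bool.not_eq_true] at h8
      have := beginStage_sound (alg := alg) (i := i)
        (s := { advance s (inbox σ i) with
          prefs := dropRemoved (inbox σ i) s.prefs
          oks := s.oks ∪ senders (inbox σ i) .ok
          pending := s.pending \ senders (inbox σ i) .nextStage }) h8 ha
      refine ⟨this.1, ?_⟩
      rw [this.2]
      simp [cost, send, hp, NodeState.budget, hc h8]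
      omega
    · refine ⟨⟨by simp [hd], by simpa [hd] using hb, by simp [ha]⟩, ?_⟩
      rw [hbud]
      omega
  · rename_i hp
    refine ⟨⟨h1, h2, h3⟩, ?_⟩
    simp [cost, send, hp]
    omega

/-- Every node sends at most one request per round, so that at most `n` replies are due. -/
theorem sum_card_requesters_le {σ : Fin n → NodeState n} :
    ∑ i, (senders (inbox σ i) .request).card ≤ n := by
  rw [← Finset.card_biUnion]
  · exact (Finset.card_le_univ _).trans (by simp)
  · intro i _ j _ hij
    refine Finset.disjoint_left.2 fun k hk hk' => ?_
    rw [mem_senders] at hk hk'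
    obtain ⟨R, hR, hi⟩ := hk
    obtain ⟨R', hR', hj⟩ := hk'
    have : ∃ l, R = {l} := by
      unfold send at hR
      split at hR
      · simp at hR
      · split_ifs at hR; simp at hR; exact ⟨_, hR.symm⟩
      · rename_i e _
        split_ifs at hR
        cases e <;> simp [answer] at hR
      · split_ifs at hR; simp at hR
      · split at hR <;> (try split_ifs at hR) <;> simp at hR
      · simp at hR
    obtain ⟨l, rfl⟩ := this
    rw [hR, Option.some.injEq, Prod.mk.injEq] at hR'
    rw [← hR'.2, Finset.mem_singleton] at hj
    rw [Finset.mem_singleton] at hi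
    exact hij (hi.trans hj.symm)

/-- The number of messages is bounded for every outcome of the random bits: a request and a reply
per node and round, and at most `5 * n` other messages per node in total. -/
theorem messages_le (alg : Subroutine) (inp : Fin n → LocalInput n) (ω : ℕ × Fin n → Bool)
    (t : ℕ) : (protocol n alg).messages inp ω t ≤ 2 * n * t + 5 * n ^ 2 := by
  have key : (∀ i, ((protocol n alg).run inp ω t i).Sound) ∧
      (protocol n alg).messages inp ω t +
        ∑ i, (((protocol n alg).run inp ω t i).budget +
          ((protocol n alg).run inp ω t i).requesters.card) ≤ 2 * n * t + 5 * n ^ 2 := by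
    induction t with
    | zero =>
      refine ⟨fun i => ⟨?_, ?_, ?_⟩, ?_⟩
      · exact fun _ _ => ⟨rfl, rfl⟩
      · intro h; cases h
      · exact fun _ => rfl
      · have : ∀ i, ((protocol n alg).run inp ω 0 i).budget +
            ((protocol n alg).run inp ω 0 i).requesters.card = 5 * n := fun i => rfl
        simp only [this]
        simp [CliqueProtocol.messages]
        nlinarith
    | succ t ih =>
      obtain ⟨ih1, ih2⟩ := ih
      rw [run_succ]
      generalize hσ : (protocol n alg).run inp ω t = σ at *
      have h1 := fun i => step_sound (alg := alg) ih1 (fun j => ω (t, j)) i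
      refine ⟨fun i => (h1 i).1, ?_⟩
      have h2 : (protocol n alg).messages inp ω (t + 1) =
          (protocol n alg).messages inp ω t + ∑ i, cost i (σ i) := by
        unfold CliqueProtocol.messages
        rw [Finset.sum_range_succ, roundMessages_eq, hσ]
      have h3 := Finset.sum_le_sum fun i (_ : i ∈ Finset.univ) => (h1 i).2
      have h4 : ∑ i, (step alg σ (fun j => ω (t, j)) i).requesters.card ≤ n :=
        (Finset.sum_le_sum fun i _ =>
          Finset.card_le_card (requesters_subset_senders ih1 _ i)).trans sum_card_requesters_le
      simp only [Finset.sum_add_distrib] at h3 ih2 ⊢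
      simp only [Finset.sum_const, Finset.card_univ, Fintype.card_fin, smul_eq_mul, mul_one] at h3
      rw [h2]
      linarith
  exact le_trans (Nat.le_add_right _ _) key.2

/-! ### Pointer jumping on the cycles of a function -/

section Forest

variable {α : Type*} {f : α → α} {L : Finset α} {act : α → Prop} {succ : α → α}
  {ch : α → Finset α}

/-- The elements of `L` that lie on cycles of `f`. -/
def cycleNodes (f : α → α) (L : Finset α) : Set α := {i | i ∈ L ∧ i ∈ Function.periodicPts f}

/-- `Desc ch p c`: in the forest with the children sets `ch`, the node `c` is `p` or below `p`. -/
def Desc (ch : α → Finset α) : α → α → Prop := Relation.ReflTransGen fun p c => c ∈ ch p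

/-- The nodes on cycles of `f` that have no parent on a cycle. -/
def IsTop (f : α → α) (L : Finset α) (ch : α → Finset α) (i : α) : Prop :=
  i ∈ cycleNodes f L ∧ ∀ p ∈ cycleNodes f L, i ∉ ch p

/-- The situation during cycle finding.  The successor graph of the stage is `f`; the current
successors are `succ`, and a node has the nodes as children that it has jumped over.  On the cycles
of `f`, the children sets define a forest, in which the active nodes are tops, and the current
successors permute the tops.  The tree of a node consists of the part of the cycle from this node to
its current successor: it can only be left, along `f`, at the current successor of its top. -/
structure PointerForest (f : α → α) (L : Finset α) (act : α → Prop) (succ : α → α)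
    (ch : α → Finset α) : Prop where
  maps : ∀ i ∈ L, f i ∈ L
  succ_reach : ∀ i ∈ L, ∃ m, 0 < m ∧ succ i = f^[m] i
  child_reach : ∀ i ∈ L, ∀ c ∈ ch i, ∃ m, 0 < m ∧ c = f^[m] i
  child_inactive : ∀ i ∈ L, ∀ c ∈ ch i, ¬ act c
  parent_unique : ∀ p ∈ cycleNodes f L, ∀ q ∈ cycleNodes f L, ∀ c, c ∈ ch p → c ∈ ch q → p = q
  exists_rank : ∃ rk : α → ℕ, (∀ p ∈ cycleNodes f L, ∀ c ∈ ch p, rk c < rk p) ∧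
    ∀ a ∈ cycleNodes f L, ∀ c ∈ cycleNodes f L, act a → ¬ act c → rk c < rk a
  succ_top : ∀ i, IsTop f L ch i → IsTop f L ch (succ i)
  succ_inj : ∀ i j, IsTop f L ch i → IsTop f L ch j → succ i = succ j → i = j
  closed : ∀ i ∈ cycleNodes f L, ∀ x, Desc ch i x → Desc ch i (f x) ∨ f x = succ i
  succ_ne : ∀ i ∈ cycleNodes f L, ¬ act i → succ i ≠ i

theorem iterate_mem (h : ∀ i ∈ L, f i ∈ L) {i : α} (hi : i ∈ L) (m : ℕ) : f^[m] i ∈ L := by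
  induction m generalizing i with
  | zero => exact hi
  | succ m ih => rw [Function.iterate_succ_apply]; exact ih (h i hi)

theorem iterate_mem_cycleNodes (h : ∀ i ∈ L, f i ∈ L) {i : α} (hi : i ∈ cycleNodes f L) (m : ℕ) :
    f^[m] i ∈ cycleNodes f L := by
  refine ⟨iterate_mem h hi.1 m, ?_⟩
  obtain ⟨k, hk, hp⟩ := hi.2
  exact ⟨k, hk, hp.apply_iterate m⟩

theorem injOn_cycleNodes : Set.InjOn f (cycleNodes f L) := fun _ hi _ hj hij =>
  (Function.bijOn_periodicPts f).injOn hi.2 hj.2 hij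

/-- On a cycle one comes back. -/
theorem exists_iterate_eq {i : α} (hi : i ∈ cycleNodes f L) (m : ℕ) :
    ∃ k, f^[k] (f^[m] i) = i := by
  obtain ⟨p, hp, hper⟩ := hi.2
  refine ⟨p * m - m, ?_⟩
  rw [← Function.iterate_add_apply, Nat.sub_add_cancel (Nat.le_mul_of_pos_left m hp)]
  exact hper.mul_const m

theorem cycleNodes_nonempty [Finite α] (h : ∀ i ∈ L, f i ∈ L) {i : α} (hi : i ∈ L) :
    ∃ j, j ∈ cycleNodes f L := by
  obtain ⟨a, b, hab, hne⟩ : ∃ a b, a < b ∧ f^[a] i = f^[b] i := by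
    by_contra hcon
    push Not at hcon
    refine not_injective_infinite_finite (fun k => f^[k] i) fun a b hab => ?_
    rcases lt_trichotomy a b with h1 | h1 | h1
    · exact absurd hab (hcon a b h1)
    · exact h1
    · exact absurd hab.symm (hcon b a h1)
  refine ⟨f^[a] i, iterate_mem h hi a, b - a, by omega, ?_⟩
  change f^[b - a] (f^[a] i) = f^[a] i
  rw [← Function.iterate_add_apply, Nat.sub_add_cancel hab.le, hne]

theorem pointerForest_init (h : ∀ i ∈ L, f i ∈ L) (hact : ∀ i, act i)
    (hs : ∀ i ∈ L, succ i = f i) (hc : ∀ i ∈ L, ch i = ∅) : PointerForest f L act succ ch where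
  maps := h
  succ_reach i hi := ⟨1, one_pos, hs i hi⟩
  child_reach i hi c hc' := by simp [hc i hi] at hc'
  child_inactive i hi c hc' := by simp [hc i hi] at hc'
  parent_unique p hp q _ c hc' := by simp [hc p hp.1] at hc'
  exists_rank := ⟨fun _ => 0, fun p hp c hc' => by simp [hc p hp.1] at hc',
    fun _ _ c _ _ h1 => absurd (hact c) h1⟩
  succ_top i hi := by
    refine ⟨?_, fun p hp => by simp [hc p hp.1]⟩
    rw [hs i hi.1.1]; exact iterate_mem_cycleNodes h hi.1 1
  succ_inj i j hi hj hij := by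
    rw [hs i hi.1.1, hs j hj.1.1] at hij
    exact injOn_cycleNodes hi.1 hj.1 hij
  closed i hi x hx := by
    rcases Relation.ReflTransGen.cases_head hx with rfl | ⟨c, hc', -⟩
    · exact Or.inr (hs i hi.1).symm
    · simp [hc i hi.1] at hc'
  succ_ne i _ h1 := absurd (hact i) h1

namespace PointerForest

variable (F : PointerForest f L act succ ch)
include F

theorem succ_mem {i : α} (hi : i ∈ L) : succ i ∈ L := by
  obtain ⟨m, -, h⟩ := F.succ_reach i hi
  rw [h]; exact iterate_mem F.maps hi m

theorem succ_mem_cycleNodes {i : α} (hi : i ∈ cycleNodes f L) : succ i ∈ cycleNodes f L := by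
  obtain ⟨m, -, h⟩ := F.succ_reach i hi.1
  rw [h]; exact iterate_mem_cycleNodes F.maps hi m

theorem desc_reach {i x : α} (hi : i ∈ L) (h : Desc ch i x) : x ∈ L ∧ ∃ m, x = f^[m] i := by
  induction h with
  | refl => exact ⟨hi, 0, rfl⟩
  | tail _ h2 ih =>
    obtain ⟨h3, m, h4⟩ := ih
    obtain ⟨k, -, h5⟩ := F.child_reach _ h3 _ h2
    rw [h4, ← Function.iterate_add_apply] at h5
    exact ⟨h5 ▸ iterate_mem F.maps hi _, _, h5⟩

theorem desc_mem {i x : α} (hi : i ∈ cycleNodes f L) (h : Desc ch i x) : x ∈ cycleNodes f L := by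
  obtain ⟨-, m, rfl⟩ := F.desc_reach hi.1 h
  exact iterate_mem_cycleNodes F.maps hi m

theorem isTop_of_act {i : α} (hi : i ∈ cycleNodes f L) (h : act i) : IsTop f L ch i :=
  ⟨hi, fun p hp hip => F.child_inactive p hp.1 i hip h⟩

/-- Nodes that are not their own successors may become inactive. -/
theorem deactivate {act' : α → Prop} (h : ∀ i ∈ L, act' i → act i)
    (hne : ∀ i ∈ L, act i → ¬ act' i → succ i ≠ i) [Fintype α] :
    PointerForest f L act' succ ch where
  maps := F.maps
  succ_reach := F.succ_reach
  child_reach := F.child_reach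
  child_inactive i hi c hc hac :=
    F.child_inactive i hi c hc (h c (F.desc_reach hi (.single hc)).1 hac)
  parent_unique := F.parent_unique
  exists_rank := by
    classical
    obtain ⟨rk, h1, h2⟩ := F.exists_rank
    set N := Finset.univ.sup rk + 1 with hN
    have hlt : ∀ i, rk i < N := fun i => Nat.lt_succ_of_le (Finset.le_sup (Finset.mem_univ i))
    refine ⟨fun i => if act' i then N else rk i, fun p hp c hc => ?_, fun a _ c _ ha' hc' => ?_⟩
    · have h3 : ¬ act' c := fun h4 =>
        F.child_inactive p hp.1 c hc (h c (F.desc_reach hp.1 (.single hc)).1 h4)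
      simp only [h3, if_false]
      split_ifs
      · exact hlt c
      · exact h1 p hp c hc
    · simp only [ha', hc', if_true, if_false]; exact hlt c
  succ_top := F.succ_top
  succ_inj := F.succ_inj
  closed := F.closed
  succ_ne i hi h1 := by
    by_cases h2 : act i
    · exact hne i hi.1 h2 h1
    · exact F.succ_ne i hi h2

/-- One parallel step of pointer jumping: active nodes adopt their inactive successors. -/
theorem jump [DecidableEq α] {J : α → Prop} [DecidablePred J]
    (hJ : ∀ i ∈ L, J i → act i ∧ ¬ act (succ i)) {succ' : α → α} {ch' : α → Finset α}
    (hs : ∀ i ∈ L, succ' i = if J i then succ (succ i) else succ i)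
    (hc : ∀ i ∈ L, ch' i = if J i then insert (succ i) (ch i) else ch i) :
    PointerForest f L act succ' ch' := by
  have hmem : ∀ i ∈ L, ∀ c, c ∈ ch' i ↔ c ∈ ch i ∨ (J i ∧ c = succ i) := by
    intro i hi c
    rw [hc i hi]
    by_cases h : J i
    · simp [h, or_comm]
    · simp [h]
  have htop : ∀ i, IsTop f L ch' i ↔ IsTop f L ch i ∧ ∀ p ∈ cycleNodes f L, J p → succ p ≠ i := by
    intro i
    constructor
    · rintro ⟨h1, h2⟩
      refine ⟨⟨h1, fun p hp h3 => h2 p hp ((hmem p hp.1 i).2 (Or.inl h3))⟩, fun p hp h3 h4 => ?_⟩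
      exact h2 p hp ((hmem p hp.1 i).2 (Or.inr ⟨h3, h4.symm⟩))
    · rintro ⟨⟨h1, h2⟩, h3⟩
      refine ⟨h1, fun p hp h4 => ?_⟩
      rcases (hmem p hp.1 i).1 h4 with h5 | ⟨h5, h6⟩
      · exact h2 p hp h5
      · exact h3 p hp h5 h6.symm
  have hJtop : ∀ p ∈ cycleNodes f L, J p → IsTop f L ch p := fun p hp h =>
    F.isTop_of_act hp (hJ p hp.1 h).1
  have hmono : ∀ i ∈ L, ∀ x, Desc ch i x → Desc ch' i x := by
    intro i hi x hx
    induction hx with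
    | refl => exact .refl
    | tail h1 h2 ih => exact .tail ih ((hmem _ (F.desc_reach hi h1).1 _).2 (Or.inl h2))
  -- below inactive nodes the forest does not change
  have hinact : ∀ c ∈ L, ¬ act c → ∀ x, Desc ch' c x → Desc ch c x ∧ ¬ act x := by
    intro c hcL hca x hx
    induction hx with
    | refl => exact ⟨.refl, hca⟩
    | tail _ h2 ih =>
      have hy := (F.desc_reach hcL ih.1).1
      rcases (hmem _ hy _).1 h2 with h3 | ⟨h3, -⟩
      · exact ⟨.tail ih.1 h3, F.child_inactive _ hy _ h3⟩
      · exact absurd (hJ _ hy h3).1 ih.2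
  have hdesc : ∀ i ∈ L, ∀ x, Desc ch' i x → Desc ch i x ∨ (J i ∧ Desc ch (succ i) x) := by
    intro i hi x hx
    rcases Relation.ReflTransGen.cases_head hx with rfl | ⟨c, h1, h2⟩
    · exact Or.inl .refl
    rcases (hmem i hi c).1 h1 with h3 | ⟨h3, rfl⟩
    · exact Or.inl (.head h3 (hinact c (F.desc_reach hi (.single h3)).1
        (F.child_inactive i hi c h3) x h2).1)
    · exact Or.inr ⟨h3, (hinact _ (F.succ_mem hi) (hJ i hi h3).2 x h2).1⟩
  refine ⟨F.maps, fun i hi => ?_, fun i hi c h1 => ?_, fun i hi c h1 => ?_, ?_, ?_, ?_, ?_, ?_, ?_⟩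
  · obtain ⟨m, hm, h1⟩ := F.succ_reach i hi
    rw [hs i hi]
    split_ifs
    · obtain ⟨k, hk, h2⟩ := F.succ_reach _ (F.succ_mem hi)
      exact ⟨k + m, by omega, by rw [h2, h1, ← Function.iterate_add_apply]⟩
    · exact ⟨m, hm, h1⟩
  · rcases (hmem i hi c).1 h1 with h2 | ⟨-, rfl⟩
    · exact F.child_reach i hi c h2
    · exact F.succ_reach i hi
  · rcases (hmem i hi c).1 h1 with h2 | ⟨h2, rfl⟩
    · exact F.child_inactive i hi c h2
    · exact (hJ i hi h2).2
  · intro p hp q hq c h1 h2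
    rcases (hmem p hp.1 c).1 h1 with h3 | ⟨h3, h4⟩ <;>
      rcases (hmem q hq.1 c).1 h2 with h5 | ⟨h5, h6⟩
    · exact F.parent_unique p hp q hq c h3 h5
    · exact absurd (h6 ▸ h3) ((F.succ_top q (hJtop q hq h5)).2 p hp)
    · exact absurd (h4 ▸ h5) ((F.succ_top p (hJtop p hp h3)).2 q hq)
    · exact F.succ_inj p q (hJtop p hp h3) (hJtop q hq h5) (h4.symm.trans h6)
  · obtain ⟨rk, h1, h2⟩ := F.exists_rank
    refine ⟨rk, fun p hp c h3 => ?_, h2⟩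
    rcases (hmem p hp.1 c).1 h3 with h4 | ⟨h4, rfl⟩
    · exact h1 p hp c h4
    · exact h2 p hp _ (F.succ_mem_cycleNodes hp) (hJ p hp.1 h4).1 (hJ p hp.1 h4).2
  · intro i hi
    have h1 := ((htop i).1 hi).1
    rw [hs i h1.1.1, htop]
    split_ifs with h2
    · refine ⟨F.succ_top _ (F.succ_top i h1), fun p hp h3 h4 => ?_⟩
      have h5 := F.succ_inj p _ (hJtop p hp h3) (F.succ_top i h1) h4
      exact (hJ i h1.1.1 h2).2 (h5 ▸ (hJ p hp.1 h3).1)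
    · refine ⟨F.succ_top i h1, fun p hp h3 h4 => h2 ?_⟩
      exact F.succ_inj p i (hJtop p hp h3) h1 h4 ▸ h3
  · intro i j hi hj hij
    obtain ⟨h1, h2⟩ := (htop i).1 hi
    obtain ⟨h3, h4⟩ := (htop j).1 hj
    rw [hs i h1.1.1, hs j h3.1.1] at hij
    split_ifs at hij with h5 h6 h6
    · exact F.succ_inj i j h1 h3 (F.succ_inj _ _ (F.succ_top i h1) (F.succ_top j h3) hij)
    · exact absurd (F.succ_inj _ _ (F.succ_top i h1) h3 hij) (h4 i h1.1 h5)
    · exact absurd (F.succ_inj _ _ h1 (F.succ_top j h3) hij).symm (h2 j h3.1 h6)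
    · exact F.succ_inj i j h1 h3 hij
  · intro i hi x hx
    rw [hs i hi.1]
    have hch : J i → Desc ch' i (succ i) := fun h => .single ((hmem i hi.1 _).2 (Or.inr ⟨h, rfl⟩))
    rcases hdesc i hi.1 x hx with h1 | ⟨h1, h2⟩
    · rcases F.closed i hi x h1 with h3 | h3
      · exact Or.inl (hmono i hi.1 _ h3)
      · split_ifs with h4
        · rw [h3]; exact Or.inl (hch h4)
        · exact Or.inr h3
    · rw [if_pos h1]
      rcases F.closed _ (F.succ_mem_cycleNodes hi) x h2 with h3 | h3
      · exact Or.inl ((hch h1).trans (hmono _ (F.succ_mem hi.1) _ h3))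
      · exact Or.inr h3
  · intro i hi h1
    rw [hs i hi.1, if_neg fun h2 => h1 (hJ i hi.1 h2).1]
    exact F.succ_ne i hi h1

/-- Every node on a cycle belongs to the tree of a top. -/
theorem exists_top [Fintype α] {c : α} (hc : c ∈ cycleNodes f L) :
    ∃ a, IsTop f L ch a ∧ Desc ch a c := by
  obtain ⟨rk, h1, -⟩ := F.exists_rank
  have hle : ∀ i, rk i ≤ Finset.univ.sup rk := fun i => Finset.le_sup (Finset.mem_univ i)
  obtain ⟨k, hk⟩ : ∃ k, k = Finset.univ.sup rk - rk c := ⟨_, rfl⟩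
  induction k using Nat.strong_induction_on generalizing c with
  | _ k ih =>
    by_cases h : IsTop f L ch c
    · exact ⟨c, h, .refl⟩
    · have h2 : ∃ p ∈ cycleNodes f L, c ∈ ch p := by
        by_contra h3
        push Not at h3
        exact h ⟨hc, h3⟩
      obtain ⟨p, hp, hcp⟩ := h2
      have h3 := h1 p hp c hcp
      have h4 := hle p
      obtain ⟨a, ha, had⟩ := ih _ (by omega) hp rfl
      exact ⟨a, ha, had.tail hcp⟩

/-- A set that is closed under `f` contains with a node of a cycle the top of its tree. -/
theorem exists_top_mem [Fintype α] {C : Finset α} (hCP : ∀ i ∈ C, i ∈ cycleNodes f L)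
    (hC : ∀ i ∈ C, f i ∈ C) (hne : C.Nonempty) : ∃ a ∈ C, IsTop f L ch a := by
  obtain ⟨c, hc⟩ := hne
  obtain ⟨a, ha, hac⟩ := F.exists_top (hCP c hc)
  obtain ⟨-, m, rfl⟩ := F.desc_reach ha.1.1 hac
  obtain ⟨k, hk⟩ := exists_iterate_eq ha.1 m
  exact ⟨a, hk ▸ iterate_mem hC hc k, ha⟩

theorem succ_mem_of_closed {C : Finset α} (hCL : C ⊆ L) (hC : ∀ i ∈ C, f i ∈ C) {i : α}
    (hi : i ∈ C) : succ i ∈ C := by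
  obtain ⟨m, -, h⟩ := F.succ_reach i (hCL hi)
  rw [h]; exact iterate_mem hC hi m

theorem mem_cycleNodes_of_root {r : α} (hr : r ∈ L) (h : succ r = r) : r ∈ cycleNodes f L := by
  obtain ⟨m, hm, h1⟩ := F.succ_reach r hr
  exact ⟨hr, m, hm, h1.symm.trans h⟩

end PointerForest

end Forest

/-! ### The trees of the roots -/

section Schedule

variable {α : Type*} {f : α → α} {L : Finset α} {act : α → Prop} {succ : α → α}
  {ch : α → Finset α}

/-- When the cycles of the roots trade, in which rounds do the nodes act?  `K` is the set of the
nodes below roots, `d` is the depth of a node, and `w` is the round in which it sends `ok` or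
`nextStage`: a node of depth `d` learns in round `2 * d - 1` that it trades, and waits from round
`2 * d + 1` on, until all its children have sent `ok`. -/
structure Schedule (f : α → α) (L : Finset α) (succ : α → α) (ch : α → Finset α)
    (K : Finset α) (d w : α → ℕ) : Prop where
  mem_cycleNodes : ∀ i ∈ K, i ∈ cycleNodes f L
  closed : ∀ i ∈ K, f i ∈ K
  root : ∀ r ∈ L, succ r = r → r ∈ K ∧ d r = 0
  exists_parent : ∀ i ∈ K, succ i ≠ i → ∃ p ∈ K, i ∈ ch p
  child : ∀ p ∈ K, ∀ c ∈ ch p, c ∈ K ∧ d c = d p + 1 ∧ w c < w p ∧ succ c ≠ c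
  parent_unique : ∀ p ∈ K, ∀ q ∈ K, ∀ c, c ∈ ch p → c ∈ ch q → p = q
  le_w : ∀ i ∈ K, 2 * d i + 1 ≤ w i
  w_eq : ∀ i ∈ K, w i = 2 * d i + 1 ∨ ∃ c ∈ ch i, w i = w c + 1
  le_root : ∀ i ∈ K, ∃ r ∈ K, succ r = r ∧ w i ≤ w r
  w_lt : ∀ i ∈ K, w i < 3 * K.card

theorem PointerForest.desc_antisymm (F : PointerForest f L act succ ch) {i j : α}
    (hi : i ∈ cycleNodes f L) (hij : Desc ch i j) (hji : Desc ch j i) : i = j := by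
  obtain ⟨rk, h1, -⟩ := F.exists_rank
  have hrk : ∀ a ∈ cycleNodes f L, ∀ b, Desc ch a b → a = b ∨ rk b < rk a := by
    intro a ha b hab
    induction hab with
    | refl => exact Or.inl rfl
    | tail h2 h3 ih =>
      have h4 := h1 _ (F.desc_mem ha h2) _ h3
      rcases ih with rfl | ih
      · exact Or.inr h4
      · exact Or.inr (h4.trans ih)
  rcases hrk i hi j hij with h | h
  · exact h
  rcases hrk j (F.desc_mem hi hij) i hji with h2 | h2
  · exact h2.symm
  · omega

theorem PointerForest.exists_schedule [Fintype α] (F : PointerForest f L act succ ch) :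
    ∃ (K : Finset α) (d w : α → ℕ), Schedule f L succ ch K d w := by
  classical
  have hroot : ∀ r ∈ cycleNodes f L, succ r = r → IsTop f L ch r := fun r hr h =>
    F.isTop_of_act hr (by_contra fun h1 => F.succ_ne r hr h1 h)
  set K : Finset α := Finset.univ.filter fun x => ∃ r ∈ cycleNodes f L, succ r = r ∧ Desc ch r x
    with hK
  have hmemK : ∀ x, x ∈ K ↔ ∃ r ∈ cycleNodes f L, succ r = r ∧ Desc ch r x := by simp [hK]
  have hKP : ∀ i ∈ K, i ∈ cycleNodes f L := by
    intro i hi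
    obtain ⟨r, hr, -, h⟩ := (hmemK i).1 hi
    exact F.desc_mem hr h
  have hKclosed : ∀ i ∈ K, f i ∈ K := by
    intro i hi
    obtain ⟨r, hr, h1, h⟩ := (hmemK i).1 hi
    rcases F.closed r hr i h with h2 | h2
    · exact (hmemK _).2 ⟨r, hr, h1, h2⟩
    · exact (hmemK _).2 ⟨r, hr, h1, by rw [h2, h1]; exact .refl⟩
  have hKdesc : ∀ i ∈ K, ∀ x, Desc ch i x → x ∈ K := by
    intro i hi x hx
    obtain ⟨r, hr, h1, h⟩ := (hmemK i).1 hi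
    exact (hmemK _).2 ⟨r, hr, h1, h.trans hx⟩
  -- the depth is the number of strict ancestors
  set anc : α → Finset α := fun i =>
    Finset.univ.filter fun p => p ∈ cycleNodes f L ∧ p ≠ i ∧ Desc ch p i with hanc
  have hmem_anc : ∀ i p, p ∈ anc i ↔ p ∈ cycleNodes f L ∧ p ≠ i ∧ Desc ch p i := by simp [hanc]
  have hanc_top : ∀ i, IsTop f L ch i → anc i = ∅ := by
    intro i hi
    refine Finset.eq_empty_of_forall_notMem fun p hp => ?_
    obtain ⟨h1, h2, h3⟩ := (hmem_anc i p).1 hp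
    rcases Relation.ReflTransGen.cases_tail h3 with h4 | ⟨q, h4, h5⟩
    · exact h2 h4.symm
    · exact hi.2 q (F.desc_mem h1 h4) h5
  have hanc_child : ∀ p ∈ cycleNodes f L, ∀ c ∈ ch p, (anc c).card = (anc p).card + 1 := by
    intro p hp c hc
    have hpc : p ≠ c := by
      rintro rfl
      obtain ⟨rk, h1, -⟩ := F.exists_rank
      exact lt_irrefl _ (h1 p hp p hc)
    have : anc c = insert p (anc p) := by
      ext q
      rw [Finset.mem_insert, hmem_anc, hmem_anc]
      constructor
      · rintro ⟨h1, h2, h3⟩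
        by_cases hqp : q = p
        · exact Or.inl hqp
        refine Or.inr ⟨h1, hqp, ?_⟩
        rcases Relation.ReflTransGen.cases_tail h3 with h4 | ⟨q', h4, h5⟩
        · exact absurd h4.symm h2
        · rwa [← F.parent_unique _ (F.desc_mem h1 h4) _ hp c h5 hc]
      · rintro (rfl | ⟨h1, h2, h3⟩)
        · exact ⟨hp, hpc, .single hc⟩
        · refine ⟨h1, ?_, h3.tail hc⟩
          rintro rfl
          exact hpc (F.desc_antisymm hp (.single hc) h3)
    rw [this, Finset.card_insert_of_notMem]
    intro h
    exact ((hmem_anc p p).1 h).2.1 rfl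
  set d : α → ℕ := fun i => (anc i).card with hd
  have hd_lt : ∀ i ∈ K, d i < K.card := by
    intro i hi
    refine Finset.card_lt_card ⟨fun p hp => ?_, fun h => ?_⟩
    · obtain ⟨h1, -, h3⟩ := (hmem_anc i p).1 hp
      obtain ⟨-, m, rfl⟩ := F.desc_reach h1.1 h3
      obtain ⟨k, hk⟩ := exists_iterate_eq h1 m
      rw [← hk]; exact iterate_mem hKclosed hi k
    · exact ((hmem_anc i i).1 (h hi)).2.1 rfl
  -- the greatest depth below a node
  set E : α → ℕ := fun i => (Finset.univ.filter fun y => Desc ch i y).sup d with hE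
  have hle_E : ∀ i y, Desc ch i y → d y ≤ E i := fun i y h =>
    Finset.le_sup (f := d) (by simpa using h)
  have hE_mono : ∀ i y, Desc ch i y → E y ≤ E i := fun i y h =>
    Finset.sup_le fun z hz => hle_E i z (h.trans (Finset.mem_filter.1 hz).2)
  have hE_attained : ∀ i, ∃ y, Desc ch i y ∧ E i = d y := by
    intro i
    obtain ⟨y, hy, h⟩ := Finset.exists_mem_eq_sup (Finset.univ.filter fun y => Desc ch i y)
      ⟨i, Finset.mem_filter.2 ⟨Finset.mem_univ i, .refl⟩⟩ d
    exact ⟨y, (Finset.mem_filter.1 hy).2, h⟩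
  have hdE : ∀ i, d i ≤ E i := fun i => hle_E i i .refl
  refine ⟨K, d, fun i => 3 * E i + 1 - d i, hKP, hKclosed, ?_, ?_, ?_, ?_, ?_, ?_, ?_, ?_⟩
  · intro r hr h
    have h1 := F.mem_cycleNodes_of_root hr h
    exact ⟨(hmemK r).2 ⟨r, h1, h, .refl⟩, by simp [hd, hanc_top r (hroot r h1 h)]⟩
  · intro i hi h
    obtain ⟨r, hr, h1, h2⟩ := (hmemK i).1 hi
    rcases Relation.ReflTransGen.cases_tail h2 with h4 | ⟨q, h4, h5⟩
    · exact absurd (h4 ▸ h1) h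
    · exact ⟨q, hKdesc r ((hmemK r).2 ⟨r, hr, h1, .refl⟩) q h4, h5⟩
  · intro p hp c hc
    have h1 : d c = d p + 1 := hanc_child p (hKP p hp) c hc
    have h2 := hE_mono p c (.single hc)
    have h3 := hdE c
    have h4 := hKdesc p hp c (.single hc)
    exact ⟨h4, h1, by omega, fun h5 => (hroot c (hKP c h4) h5).2 p (hKP p hp) hc⟩
  · intro p hp q hq c h1 h2
    exact F.parent_unique p (hKP p hp) q (hKP q hq) c h1 h2
  · intro i hi
    have := hdE i
    omega
  · intro i hi
    have := hdE i
    by_cases h : E i = d i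
    · left; omega
    right
    obtain ⟨y, hy, hyE⟩ := hE_attained i
    rcases Relation.ReflTransGen.cases_head hy with rfl | ⟨c, h1, h2⟩
    · exact absurd hyE h
    have h3 : E c = E i := le_antisymm (hE_mono i c (.single h1)) (hyE ▸ hle_E c y h2)
    have h4 : d c = d i + 1 := hanc_child i (hKP i hi) c h1
    have h5 := hdE c
    exact ⟨c, h1, by omega⟩
  · intro i hi
    obtain ⟨r, hr, h1, h2⟩ := (hmemK i).1 hi
    refine ⟨r, (hmemK r).2 ⟨r, hr, h1, .refl⟩, h1, ?_⟩
    have h3 := hE_mono r i h2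
    have h4 : d r = 0 := by simp [hd, hanc_top r (hroot r hr h1)]
    omega
  · intro i hi
    obtain ⟨y, hy, hyE⟩ := hE_attained i
    have := hd_lt y (hKdesc i hi y hy)
    omega

end Schedule

/-! ### Several rounds of the protocol -/

/-- The states after `t` further rounds in which the nodes draw the random bits `y 0`, `y 1`, … -/
def evolve (alg : Subroutine) : (Fin n → NodeState n) → (ℕ → Fin n → Bool) → ℕ → Fin n → NodeState n
  | σ, _, 0 => σ
  | σ, y, t + 1 => evolve alg (step alg σ (y 0)) (fun s => y (s + 1)) t

/-- `t` rounds lead from `σ` to `σ'`, whatever the random bits. -/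
def Evolves (alg : Subroutine) (t : ℕ) (σ σ' : Fin n → NodeState n) : Prop :=
  ∀ y, evolve alg σ y t = σ'

theorem evolve_add (alg : Subroutine) (σ : Fin n → NodeState n) (y : ℕ → Fin n → Bool) (s t : ℕ) :
    evolve alg σ y (s + t) = evolve alg (evolve alg σ y s) (fun r => y (r + s)) t := by
  induction s generalizing σ y with
  | zero => rw [Nat.zero_add]; rfl
  | succ s ih =>
    rw [Nat.succ_add]
    refine (ih _ _).trans ?_
    rw [evolve]
    simp only [Nat.add_assoc]

theorem Evolves.refl (alg : Subroutine) (σ : Fin n → NodeState n) : Evolves alg 0 σ σ :=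
  fun _ => rfl

theorem Evolves.trans {alg : Subroutine} {s t : ℕ} {σ σ' σ'' : Fin n → NodeState n}
    (h : Evolves alg s σ σ') (h' : Evolves alg t σ' σ'') : Evolves alg (s + t) σ σ'' := by
  intro y
  rw [evolve_add, h, h']

theorem evolves_one {alg : Subroutine} {σ σ' : Fin n → NodeState n}
    (h : ∀ x, step alg σ x = σ') : Evolves alg 1 σ σ' := fun _ => h _

theorem step_of_done {alg : Subroutine} {σ : Fin n → NodeState n} {i : Fin n}
    (h : (σ i).phase = .done) (x : Fin n → Bool) : step alg σ x i = σ i := by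
  simp [step, receive, h]

theorem send_of_done {s : NodeState n} (h : s.phase = .done) (i : Fin n) : send i s = none := by
  simp [send, h]

/-! ### Exchanges -/

/-- The colour of a node after the first round of an exchange. -/
def drawn (alg : Subroutine) (e : Exchange) (x : Bool) (c : ℕ) : ℕ :=
  match alg, e with
  | .coinFlip, .mark => x.toNat
  | _, _ => c

theorem processAnswer_with (s : NodeState n) (e : Exchange) (m : Option (Message n))
    (p p' : Phase) (r r' : Finset (Fin n)) :
    { processAnswer { s with phase := p, requesters := r } e m with
      phase := p', requesters := r' } =
    { processAnswer s e m with phase := p', requesters := r' } := by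
  unfold processAnswer; split <;> rfl

/-- An exchange, in which the nodes of `L` send requests to their successors and get the answers. -/
theorem step_step_request {alg : Subroutine} {σ : Fin n → NodeState n} {L : Finset (Fin n)}
    {e : Exchange} (hL : ∀ i ∈ L, (σ i).phase = .request e) (hd : ∀ i ∉ L, (σ i).phase = .done)
    (hs : ∀ i ∈ L, (σ i).succ ∈ L) (x x' : Fin n → Bool) {i : Fin n} (hi : i ∈ L) :
    step alg (step alg σ x) x' i =
      { processAnswer { σ i with color := drawn alg e (x i) (σ i).color } e
          (if wantsReply (σ i) e then
            some (answer { σ (σ i).succ with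
              color := drawn alg e (x (σ i).succ) (σ (σ i).succ).color } e) else none) with
        phase := phaseAfter n e
        requesters := ∅ } := by
  set σ₁ := step alg σ x with hσ₁
  have h1 : ∀ j ∈ L, σ₁ j = { { σ j with color := drawn alg e (x j) (σ j).color } with
      phase := .reply e, requesters := senders (inbox σ j) .request } := by
    intro j hj
    simp only [hσ₁, step, receive, hL j hj]
    rfl
  have hreq : ∀ j ∈ L, ∀ k, k ∈ senders (inbox σ j) .request ↔
      k ∈ L ∧ wantsReply (σ k) e = true ∧ (σ k).succ = j := by
    intro j _ k
    rw [mem_senders]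
    by_cases hk : k ∈ L
    · simp only [send, hL k hk, hk, true_and]
      by_cases hw : wantsReply (σ k) e = true
      · simp [hw, eq_comm]
      · simp [hw]
    · simp [send_of_done (hd k hk), hk]
  have h2 : inbox σ₁ i (σ i).succ =
      if wantsReply (σ i) e then some (answer { σ (σ i).succ with
        color := drawn alg e (x (σ i).succ) (σ (σ i).succ).color } e) else none := by
    have hj := hs i hi
    have hans : answer (σ₁ (σ i).succ) e = answer { σ (σ i).succ with
        color := drawn alg e (x (σ i).succ) (σ (σ i).succ).color } e := by
      rw [h1 _ hj]; cases e <;> rfl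
    have hsend : send (σ i).succ (σ₁ (σ i).succ) =
        if senders (inbox σ (σ i).succ) .request = ∅ then none
        else some (answer (σ₁ (σ i).succ) e, senders (inbox σ (σ i).succ) .request) := by
      have hph : (σ₁ (σ i).succ).phase = .reply e := by rw [h1 _ hj]
      have hr : (σ₁ (σ i).succ).requesters = senders (inbox σ (σ i).succ) .request := by
        rw [h1 _ hj]
      simp only [send, hph, hr]
    split_ifs with hw
    · rw [inbox_eq_some]
      have hmem := (hreq _ hj i).2 ⟨hi, hw, rfl⟩
      exact ⟨_, by rw [hsend, if_neg (Finset.ne_empty_of_mem hmem), hans], hmem⟩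
    · rw [Option.eq_none_iff_forall_ne_some]
      intro m hm
      obtain ⟨R, h3, h4⟩ := inbox_eq_some.1 hm
      rw [hsend] at h3
      split_ifs at h3
      simp only [Option.some.injEq, Prod.mk.injEq] at h3
      rw [← h3.2, hreq _ hj] at h4
      exact hw h4.2.1
  have h3 : step alg σ₁ x' i = { processAnswer (σ₁ i) e (inbox σ₁ i (σ₁ i).succ) with
      phase := phaseAfter n e, requesters := ∅ } := by
    have hph : (σ₁ i).phase = .reply e := by rw [h1 i hi]
    simp only [step, receive, hph]
  have h4 : (σ₁ i).succ = (σ i).succ := by rw [h1 i hi]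
  rw [h3, h4, h2, h1 i hi]
  exact processAnswer_with _ _ _ _ _ _ _

/-! ### The invariants of cycle finding -/

/-- The part of the state that does not change while the nodes search for cycles. The agents outside
`L` have left with the houses assigned to them, and those in `L` have top choices among the houses
that have not been removed; `f` is the successor graph of the stage. -/
structure Stage (M : HousingMarket n) (L : Finset (Fin n)) (f : Fin n → Fin n)
    (σ : Fin n → NodeState n) : Prop where
  done : ∀ i ∉ L, (σ i).phase = .done
  holder : ∀ i ∈ L, ∀ h, (σ i).holder h = M.endow.symm h
  prefs : ∀ i ∈ L, (σ i).prefs = (M.prefs i).filter fun h => M.endow.symm h ∈ L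
  assigned : ∀ i ∈ L, (σ i).assigned = false
  progress : ∀ i ∈ L, (σ i).progress = .idle
  oks : ∀ i ∈ L, (σ i).oks = ∅
  traded : ∃ rank r, M.TradedUntil L (fun i => (σ i).house) rank r
  graph : ∀ i ∈ L, f i = M.endow.symm (σ i).top
  top_mem : ∀ i ∈ L, (σ i).top ∈ M.prefs i
  top_best : ∀ i ∈ L, ∀ h ∈ M.prefs i, M.endow.symm h ∈ L →
    (M.prefs i).idxOf (σ i).top ≤ (M.prefs i).idxOf h

/-- The nodes of `L` search for cycles, in the phase `ph`; the nodes in `act` are active. -/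
structure Finding (M : HousingMarket n) (L : Finset (Fin n)) (f : Fin n → Fin n)
    (act : Fin n → Prop) (ph : Phase) (σ : Fin n → NodeState n) : Prop extends
    Stage M L f σ where
  phase : ∀ i ∈ L, (σ i).phase = ph
  active : ∀ i ∈ L, (σ i).active = true ↔ act i
  forest : PointerForest f L act (fun i => (σ i).succ) fun i => (σ i).children

/-- At the beginning of an iteration, the active nodes of the cycles are linked: inactive nodes have
been jumped over. -/
def Settled (L : Finset (Fin n)) (f : Fin n → Fin n) (act : Fin n → Prop)
    (σ : Fin n → NodeState n) : Prop :=
  ∀ i, IsTop f L (fun i => (σ i).children) i → act i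

theorem Stage.congr {M : HousingMarket n} {L : Finset (Fin n)} {f : Fin n → Fin n}
    {σ σ' : Fin n → NodeState n} (h : Stage M L f σ) (hout : ∀ i ∉ L, σ' i = σ i)
    (hin : ∀ i ∈ L, (σ' i).holder = (σ i).holder ∧ (σ' i).prefs = (σ i).prefs ∧
      (σ' i).assigned = (σ i).assigned ∧ (σ' i).progress = (σ i).progress ∧
      (σ' i).oks = (σ i).oks ∧ (σ' i).house = (σ i).house ∧ (σ' i).top = (σ i).top) :
    Stage M L f σ' where
  done i hi := by rw [hout i hi]; exact h.done i hi
  holder i hi := by rw [(hin i hi).1]; exact h.holder i hi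
  prefs i hi := by rw [(hin i hi).2.1]; exact h.prefs i hi
  assigned i hi := by rw [(hin i hi).2.2.1]; exact h.assigned i hi
  progress i hi := by rw [(hin i hi).2.2.2.1]; exact h.progress i hi
  oks i hi := by rw [(hin i hi).2.2.2.2.1]; exact h.oks i hi
  traded := by
    have : (fun i => (σ' i).house) = fun i => (σ i).house := by
      funext i
      by_cases hi : i ∈ L
      · exact (hin i hi).2.2.2.2.2.1
      · rw [hout i hi]
    rw [this]; exact h.traded
  graph i hi := by rw [(hin i hi).2.2.2.2.2.2]; exact h.graph i hi
  top_mem i hi := by rw [(hin i hi).2.2.2.2.2.2]; exact h.top_mem i hi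
  top_best i hi := by rw [(hin i hi).2.2.2.2.2.2]; exact h.top_best i hi

theorem PointerForest.congr {α : Type*} {f : α → α} {L : Finset α} {act act' : α → Prop}
    {succ succ' : α → α} {ch ch' : α → Finset α} (F : PointerForest f L act succ ch)
    (ha : ∀ i ∈ L, act' i ↔ act i) (hs : ∀ i ∈ L, succ' i = succ i)
    (hc : ∀ i ∈ L, ch' i = ch i) [Finite α] : PointerForest f L act' succ' ch' := by
  classical
  have := Fintype.ofFinite α
  have F' := F.deactivate (act' := act') (fun i hi h => (ha i hi).1 h)
    fun i hi h h' => absurd ((ha i hi).2 h) h'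
  exact F'.jump (J := fun _ => False) (fun _ _ h => h.elim) (by simpa using hs) (by simpa using hc)

theorem settled_congr {L : Finset (Fin n)} {f : Fin n → Fin n} {act : Fin n → Prop}
    {σ σ' : Fin n → NodeState n} (h : Settled L f act σ)
    (hc : ∀ i ∈ L, (σ' i).children = (σ i).children) : Settled L f act σ' := by
  intro i hi
  exact h i ⟨hi.1, fun p hp hip => hi.2 p hp (by simpa only [hc p hp.1] using hip)⟩

/-! ### Colour reduction -/

section

variable {M : HousingMarket n} {L : Finset (Fin n)} {f : Fin n → Fin n} {act : Fin n → Prop}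
  {σ : Fin n → NodeState n}

/-- The active nodes of the cycles have colours below `N`, and a node and its successor, if
distinct, have different colours. -/
def ProperlyColored (L : Finset (Fin n)) (f : Fin n → Fin n) (act : Fin n → Prop) (N : ℕ)
    (σ : Fin n → NodeState n) : Prop :=
  ∀ i ∈ cycleNodes f L, act i → (σ i).color < N ∧
    ((σ i).succ ≠ i → (σ i).color ≠ (σ (σ i).succ).color)

theorem Finding.act_succ {ph : Phase} (h : Finding M L f act ph σ) (hs : Settled L f act σ)
    {i : Fin n} (hi : i ∈ cycleNodes f L) (ha : act i) : act (σ i).succ :=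
  hs _ (h.forest.succ_top i (h.forest.isTop_of_act hi ha))

/-- If the fields that are fixed during the colour reduction do not change, the invariants
persist. -/
theorem Finding.recolor {ph ph' : Phase} (h : Finding M L f act ph σ) {σ' : Fin n → NodeState n}
    (hout : ∀ i ∉ L, σ' i = σ i)
    (hin : ∀ i ∈ L, ∃ r c, σ' i = { σ i with phase := ph', requesters := r, color := c }) :
    Finding M L f act ph' σ' where
  toStage := h.toStage.congr hout fun i hi => by
    obtain ⟨r, c, hc⟩ := hin i hi
    rw [hc]; exact ⟨rfl, rfl, rfl, rfl, rfl, rfl, rfl⟩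
  phase i hi := by obtain ⟨r, c, hc⟩ := hin i hi; rw [hc]
  active i hi := by obtain ⟨r, c, hc⟩ := hin i hi; rw [hc]; exact h.active i hi
  forest := h.forest.congr (fun _ _ => Iff.rfl)
    (fun i hi => by obtain ⟨r, c, hc⟩ := hin i hi; rw [hc])
    (fun i hi => by obtain ⟨r, c, hc⟩ := hin i hi; rw [hc])

theorem Finding.step_step_out {ph : Phase} (h : Finding M L f act ph σ) (alg : Subroutine)
    (x x' : Fin n → Bool) {i : Fin n} (hi : i ∉ L) : step alg (step alg σ x) x' i = σ i := by
  have h1 := step_of_done (alg := alg) (h.done i hi) x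
  rw [step_of_done (by rw [h1]; exact h.done i hi) x', h1]

/-- A coin tossing step reduces a palette of `N` colours to `2 * Nat.clog 2 N` colours. -/
theorem Finding.toss {k N : ℕ} (h : Finding M L f act (.request (.toss k)) σ)
    (hs : Settled L f act σ) (hN : 2 ≤ N) (hc : ProperlyColored L f act N σ) :
    ∃ σ', Evolves .coloring 2 σ σ' ∧ Finding M L f act (phaseAfter n (.toss k)) σ' ∧
      Settled L f act σ' ∧ ProperlyColored L f act (2 * Nat.clog 2 N) σ' ∧
      ∀ i ∈ L, (σ' i).succ = (σ i).succ := by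
  classical
  let σ' : Fin n → NodeState n := fun i => if i ∈ L then { σ i with
    phase := phaseAfter n (.toss k)
    requesters := ∅
    color := if (σ i).active then tossColor (σ i).color (σ (σ i).succ).color else (σ i).color }
    else σ i
  have hin : ∀ i ∈ L, σ' i = { σ i with
      phase := phaseAfter n (.toss k)
      requesters := ∅
      color := if (σ i).active then tossColor (σ i).color (σ (σ i).succ).color
        else (σ i).color } := fun i hi => if_pos hi
  have hout : ∀ i ∉ L, σ' i = σ i := fun i hi => if_neg hi
  have hsuccL : ∀ i ∈ L, (σ i).succ ∈ L := fun i hi => h.forest.succ_mem hi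
  have hcol : ∀ i ∈ L, act i → (σ' i).color = tossColor (σ i).color (σ (σ i).succ).color := by
    intro i hi ha
    rw [hin i hi]
    simp [(h.active i hi).2 ha]
  have hsucc : ∀ i ∈ L, (σ' i).succ = (σ i).succ := fun i hi => by rw [hin i hi]
  refine ⟨σ', fun y => ?_, h.recolor hout fun i hi => ⟨_, _, hin i hi⟩,
    settled_congr hs fun i hi => by rw [hin i hi], fun i hi ha => ?_, hsucc⟩
  · funext i
    by_cases hi : i ∈ L
    · rw [hin i hi]
      refine (step_step_request h.phase h.done hsuccL (y 0) (y 1) hi).trans ?_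
      cases hac : (σ i).active <;> simp [wantsReply, hac, processAnswer, answer, drawn]
    · rw [hout i hi]
      exact h.step_step_out _ (y 0) (y 1) hi
  · have hj := h.forest.succ_mem_cycleNodes hi
    have haj := h.act_succ hs hi ha
    rw [hsucc i hi.1, hcol i hi.1 ha, hcol _ hj.1 haj]
    refine ⟨tossColor_lt hN (hc i hi ha).1 (hc _ hj haj).1, fun hne => tossColor_ne ?_⟩
    exact (hc i hi ha).2 hne

/-- The phase in which an iteration begins. -/
def firstPhase (n : ℕ) : Subroutine → Phase
  | .coinFlip => .request .mark
  | .coloring => .request (if tossSteps n = 0 then .mark else .toss 0)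

/-- With the deterministic subroutine, the nodes have six colours when they break the symmetry. -/
theorem Finding.toss_iterate (h : Finding M L f act (firstPhase n .coloring) σ)
    (hs : Settled L f act σ) (hc : ∀ i ∈ L, (σ i).color = i) :
    ∃ σ', Evolves .coloring (2 * tossSteps n) σ σ' ∧ Finding M L f act (.request .mark) σ' ∧
      Settled L f act σ' ∧ ProperlyColored L f act 6 σ' ∧ ∀ i ∈ L, (σ' i).succ = (σ i).succ := by
  have key : ∀ k ≤ tossSteps n, ∃ σ', Evolves .coloring (2 * k) σ σ' ∧
      Finding M L f act (.request (if k < tossSteps n then .toss k else .mark)) σ' ∧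
      Settled L f act σ' ∧ ProperlyColored L f act (palette n k) σ' ∧
      ∀ i ∈ L, (σ' i).succ = (σ i).succ := by
    intro k
    induction k with
    | zero =>
      intro _
      refine ⟨σ, Evolves.refl _ _, ?_, hs, fun i hi _ => ⟨?_, fun hne heq => hne ?_⟩,
        fun _ _ => rfl⟩
      · convert h using 1
        simp only [firstPhase]
        by_cases h0 : tossSteps n = 0
        · simp [h0]
        · simp [h0, Nat.pos_of_ne_zero h0]
      · rw [hc i hi.1]; exact i.isLt
      · rw [hc i hi.1, hc _ (h.forest.succ_mem hi.1)] at heq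
        exact (Fin.ext heq).symm
    | succ k ih =>
      intro hk
      obtain ⟨σ₁, h1, h2, h3, h4, h5⟩ := ih (by omega)
      rw [if_pos (by omega : k < tossSteps n)] at h2
      obtain ⟨σ₂, h6, h7, h8, h9, h10⟩ :=
        h2.toss h3 (by have := six_lt_palette (N := n) (k := k) (by omega); omega) h4
      exact ⟨σ₂, h1.trans h6, h7, h8, h9, fun i hi => (h10 i hi).trans (h5 i hi)⟩
  obtain ⟨σ', h1, h2, h3, h4, h5⟩ := key _ le_rfl
  rw [if_neg (lt_irrefl _)] at h2
  refine ⟨σ', h1, h2, h3, fun i hi ha => ?_, h5⟩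
  exact ⟨(h4 i hi ha).1.trans_le (palette_tossSteps_le n), (h4 i hi ha).2⟩

/-! ### Symmetry breaking and exploration -/

/-- The situation before the explore exchange number `k`: along a chain of inactive nodes the
colours increase, and the successor of an active node is active or has at least the colour `k`. -/
structure Exploring (M : HousingMarket n) (L : Finset (Fin n)) (f : Fin n → Fin n)
    (act : Fin n → Prop) (ph : Phase) (k : ℕ) (σ : Fin n → NodeState n) : Prop extends
    Finding M L f act ph σ where
  increasing : ∀ i, IsTop f L (fun i => (σ i).children) i → ¬ act i →
    (σ i).color < (σ (σ i).succ).color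
  color_lt : ∀ i, IsTop f L (fun i => (σ i).children) i → (σ i).color < 6
  le_color : ∀ i, IsTop f L (fun i => (σ i).children) i → act i → ¬ act (σ i).succ →
    k ≤ (σ (σ i).succ).color
  succActive : ∀ i ∈ L, act i → (σ i).succActive = true → act (σ i).succ

/-- The symmetry is broken by the colours `c`: nodes whose successors have greater colours become
inactive. -/
theorem Finding.mark (h : Finding M L f act (.request .mark) σ) (hs : Settled L f act σ)
    (alg : Subroutine) (x : Fin n → Bool) (c : Fin n → ℕ)
    (hc : ∀ i, c i = drawn alg .mark (x i) (σ i).color)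
    (hlt : ∀ i ∈ cycleNodes f L, act i → c i < 6) :
    ∃ σ', (∀ x', step alg (step alg σ x) x' = σ') ∧
      Exploring M L f (fun i => act i ∧ ¬ c i < c (σ i).succ) (.request (.explore 0)) 0 σ' ∧
      ∀ i ∈ L, (σ' i).succ = (σ i).succ := by
  classical
  let σ' : Fin n → NodeState n := fun i => if i ∈ L then { σ i with
    phase := .request (.explore 0)
    requesters := ∅
    color := c i
    active := (σ i).active && decide (¬ c i < c (σ i).succ)
    succActive := !(σ i).active && (σ i).succActive }
    else σ i
  have hin : ∀ i ∈ L, σ' i = { σ i with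
      phase := .request (.explore 0)
      requesters := ∅
      color := c i
      active := (σ i).active && decide (¬ c i < c (σ i).succ)
      succActive := !(σ i).active && (σ i).succActive } := fun i hi => if_pos hi
  have hout : ∀ i ∉ L, σ' i = σ i := fun i hi => if_neg hi
  have hsuccL : ∀ i ∈ L, (σ i).succ ∈ L := fun i hi => h.forest.succ_mem hi
  have hF : Finding M L f (fun i => act i ∧ ¬ c i < c (σ i).succ) (.request (.explore 0)) σ' := by
    refine ⟨h.toStage.congr hout fun i hi => ?_, fun i hi => ?_, fun i hi => ?_, ?_⟩
    · rw [hin i hi]; exact ⟨rfl, rfl, rfl, rfl, rfl, rfl, rfl⟩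
    · rw [hin i hi]
    · rw [hin i hi]; simp [h.active i hi]
    · refine (h.forest.deactivate (act' := fun i => act i ∧ ¬ c i < c (σ i).succ)
        (fun i _ ha => ha.1) fun i _ ha hna heq => hna ⟨ha, ?_⟩).congr (fun _ _ => Iff.rfl)
        (fun i hi => by rw [hin i hi]) (fun i hi => by rw [hin i hi])
      rw [heq]; exact lt_irrefl _
  have htop : ∀ i, IsTop f L (fun i => (σ' i).children) i →
      IsTop f L (fun i => (σ i).children) i := by
    intro i hi
    exact ⟨hi.1, fun p hp hip => hi.2 p hp (by simpa only [hin p hp.1] using hip)⟩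
  have hcol : ∀ i ∈ L, (σ' i).color = c i := fun i hi => by rw [hin i hi]
  have hsucc : ∀ i ∈ L, (σ' i).succ = (σ i).succ := fun i hi => by rw [hin i hi]
  refine ⟨σ', fun x' => ?_, ⟨hF, fun i hi hna => ?_, fun i hi => ?_,
    fun _ _ _ _ => Nat.zero_le _, fun i hi ha hsa => ?_⟩, hsucc⟩
  · funext i
    by_cases hi : i ∈ L
    · rw [hin i hi, step_step_request h.phase h.done hsuccL _ _ hi]
      cases hac : (σ i).active <;>
        simp [wantsReply, hac, processAnswer, answer, phaseAfter, ← hc]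
    · rw [hout i hi]
      exact h.step_step_out _ _ _ hi
  · have hi' := htop i hi
    rw [hsucc i hi.1.1, hcol i hi.1.1, hcol _ (hsuccL i hi.1.1)]
    by_contra hlt'
    exact hna ⟨hs i hi', hlt'⟩
  · rw [hcol i hi.1.1]
    exact hlt i hi.1 (hs i (htop i hi))
  · rw [hin i hi] at hsa
    simp [(h.active i hi).2 ha.1] at hsa

/-- Jumping over an inactive node leads to a node of a greater colour. -/
theorem Exploring.explore {k : ℕ} (h : Exploring M L f act (.request (.explore k)) k σ)
    (alg : Subroutine) :
    ∃ σ', Evolves alg 2 σ σ' ∧ Exploring M L f act (phaseAfter n (.explore k)) (k + 1) σ' ∧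
      ∀ i ∈ L, (σ i).succ = i → (σ' i).succ = i := by
  classical
  let J : Fin n → Prop := fun i => act i ∧ (σ i).succActive = false ∧ ¬ act (σ i).succ
  let σ' : Fin n → NodeState n := fun i => if i ∈ L then { σ i with
    phase := phaseAfter n (.explore k)
    requesters := ∅
    succActive := (σ i).succActive || ((σ i).active && (σ (σ i).succ).active)
    children := if J i then insert (σ i).succ (σ i).children else (σ i).children
    succ := if J i then (σ (σ i).succ).succ else (σ i).succ }
    else σ i
  have hin : ∀ i ∈ L, σ' i = { σ i with
      phase := phaseAfter n (.explore k)
      requesters := ∅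
      succActive := (σ i).succActive || ((σ i).active && (σ (σ i).succ).active)
      children := if J i then insert (σ i).succ (σ i).children else (σ i).children
      succ := if J i then (σ (σ i).succ).succ else (σ i).succ } := fun i hi => if_pos hi
  have hout : ∀ i ∉ L, σ' i = σ i := fun i hi => if_neg hi
  have hsuccL : ∀ i ∈ L, (σ i).succ ∈ L := fun i hi => h.forest.succ_mem hi
  have hsucc : ∀ i ∈ L, (σ' i).succ = if J i then (σ (σ i).succ).succ else (σ i).succ :=
    fun i hi => by rw [hin i hi]
  have hch : ∀ i ∈ L, (σ' i).children =
      if J i then insert (σ i).succ (σ i).children else (σ i).children :=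
    fun i hi => by rw [hin i hi]
  have hcol : ∀ i ∈ L, (σ' i).color = (σ i).color := fun i hi => by rw [hin i hi]
  have hforest : PointerForest f L act (fun i => (σ' i).succ) fun i => (σ' i).children :=
    h.forest.jump (J := J) (fun i _ hJ => ⟨hJ.1, hJ.2.2⟩) hsucc hch
  have htop : ∀ i, IsTop f L (fun i => (σ' i).children) i →
      IsTop f L (fun i => (σ i).children) i := by
    intro i hi
    refine ⟨hi.1, fun p hp hip => hi.2 p hp ?_⟩
    simp only [hch p hp.1]
    split_ifs
    · exact Finset.mem_insert_of_mem hip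
    · exact hip
  refine ⟨σ', fun y => ?_, ⟨⟨h.toStage.congr hout fun i hi => ?_, fun i hi => ?_,
    fun i hi => ?_, hforest⟩, fun i hi hna => ?_, fun i hi => ?_, fun i hi ha hna => ?_,
    fun i hi ha hsa => ?_⟩, fun i hi hroot => ?_⟩
  · funext i
    by_cases hi : i ∈ L
    · rw [hin i hi]
      refine (step_step_request h.phase h.done hsuccL (y 0) (y 1) hi).trans ?_
      have ha := h.active i hi
      have hb := h.active _ (hsuccL i hi)
      have hd : ∀ x c, drawn alg (.explore k) x c = c := by cases alg <;> exact fun _ _ => rfl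
      by_cases hac : (σ i).active = true <;> by_cases hsa : (σ i).succActive = true <;>
        by_cases hbc : (σ (σ i).succ).active = true <;>
        simp [wantsReply, processAnswer, answer, hd, J, ← ha, ← hb, hac, hsa, hbc]
    · rw [hout i hi]
      exact h.step_step_out _ (y 0) (y 1) hi
  · rw [hin i hi]; exact ⟨rfl, rfl, rfl, rfl, rfl, rfl, rfl⟩
  · rw [hin i hi]
  · rw [hin i hi]; exact h.active i hi
  · rw [hcol i hi.1.1, hcol _ (hforest.succ_mem hi.1.1), hsucc i hi.1.1,
      if_neg fun hJ : J i => hna hJ.1]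
    exact h.increasing i (htop i hi) hna
  · rw [hcol i hi.1.1]; exact h.color_lt i (htop i hi)
  · have hi' := htop i hi
    rw [hcol _ (hforest.succ_mem hi.1.1)]
    rw [hsucc i hi.1.1] at hna ⊢
    by_cases hJ : J i
    · rw [if_pos hJ]
      have h1 := h.le_color i hi' ha hJ.2.2
      have h2 := h.increasing _ (h.forest.succ_top i hi') hJ.2.2
      omega
    · rw [if_neg hJ] at hna
      exfalso
      refine hJ ⟨ha, ?_, hna⟩
      by_contra hsa
      exact hna (h.succActive i hi.1.1 ha (by simpa using hsa))
  · rw [hsucc i hi]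
    rw [hin i hi] at hsa
    simp only [Bool.or_eq_true, Bool.and_eq_true] at hsa
    have : act (σ i).succ := by
      rcases hsa with hsa | hsa
      · exact h.succActive i hi ha hsa
      · exact (h.active _ (hsuccL i hi)).1 hsa.2
    rw [if_neg fun hJ : J i => hJ.2.2 this]
    exact this
  · rw [hsucc i hi, if_neg fun hJ : J i => hJ.2.2 (hroot.symm ▸ hJ.1)]
    exact hroot

/-- After six explore exchanges the inactive nodes of the cycles have been jumped over. -/
theorem Exploring.settled {ph : Phase} (h : Exploring M L f act ph 6 σ) : Settled L f act σ := by
  classical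
  have key : ∀ c i, IsTop f L (fun i => (σ i).children) i → (σ i).color = c → act i := by
    intro c
    induction c using Nat.strong_induction_on with
    | _ c ih =>
      intro i hi hic
      by_contra hna
      -- the tops are permuted, so that `i` is the successor of a top
      let T : Finset (Fin n) := Finset.univ.filter (IsTop f L fun i => (σ i).children)
      have hT : ∀ j, j ∈ T ↔ IsTop f L (fun i => (σ i).children) j := by simp [T]
      have hsurj := Finset.surjOn_of_injOn_of_card_le (s := T) (t := T) (fun i => (σ i).succ)
        (fun j hj => by
          rw [Finset.mem_coe, hT] at hj ⊢; exact h.forest.succ_top j hj)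
        (fun j hj k hk => by
          rw [Finset.mem_coe, hT] at hj hk; exact h.forest.succ_inj j k hj hk) le_rfl
      obtain ⟨j, hj, hji⟩ := hsurj (Finset.mem_coe.2 ((hT i).2 hi))
      rw [Finset.mem_coe, hT] at hj
      simp only at hji
      by_cases haj : act j
      · have h1 := h.le_color j hj haj (by rw [hji]; exact hna)
        have h2 := h.color_lt i hi
        rw [hji] at h1
        omega
      · have h1 := h.increasing j hj haj
        rw [hji, hic] at h1
        exact haj (ih _ h1 j hj rfl)
  exact fun i hi => key _ i hi rfl

theorem Exploring.explore_iterate (h : Exploring M L f act (.request (.explore 0)) 0 σ)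
    (alg : Subroutine) :
    ∃ σ', Evolves alg 12 σ σ' ∧ Finding M L f act .check σ' ∧ Settled L f act σ' ∧
      ∀ i ∈ L, (σ i).succ = i → (σ' i).succ = i := by
  have key : ∀ k ≤ 6, ∃ σ', Evolves alg (2 * k) σ σ' ∧
      Exploring M L f act (if k < 6 then .request (.explore k) else .check) k σ' ∧
      ∀ i ∈ L, (σ i).succ = i → (σ' i).succ = i := by
    intro k
    induction k with
    | zero => exact fun _ => ⟨σ, Evolves.refl _ _, h, fun _ _ => id⟩
    | succ k ih =>
      intro hk
      obtain ⟨σ₁, h1, h2, h3⟩ := ih (by omega)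
      rw [if_pos (by omega)] at h2
      obtain ⟨σ₂, h4, h5, h6⟩ := h2.explore alg
      exact ⟨σ₂, h1.trans h4, h5, fun i hi h => h6 i hi (h3 i hi h)⟩
  obtain ⟨σ', h1, h2, h3⟩ := key 6 le_rfl
  exact ⟨σ', h1, h2.toFinding, h2.settled, h3⟩

/-! ### Iterations of cycle finding -/

/-- The beginning of an iteration. -/
structure Iteration (alg : Subroutine) (M : HousingMarket n) (L : Finset (Fin n))
    (f : Fin n → Fin n) (act : Fin n → Prop) (σ : Fin n → NodeState n) : Prop extends
    Finding M L f act (firstPhase n alg) σ where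
  settled : Settled L f act σ
  color : alg = .coloring → ∀ i ∈ L, (σ i).color = i

/-- The number of rounds of an iteration: two for each of the coin tossing steps, for breaking the
symmetry and for each of the six explore exchanges, and one for the check. -/
def iterationLength (n : ℕ) : Subroutine → ℕ
  | .coinFlip => 15
  | .coloring => 2 * tossSteps n + 15

/-- The colours by which the symmetry is broken, when the nodes draw the random bits `x` at the
beginning of the iteration. -/
def BreaksSymmetry (alg : Subroutine) (L : Finset (Fin n)) (f : Fin n → Fin n)
    (act : Fin n → Prop) (σ : Fin n → NodeState n) (x : Fin n → Bool) (c : Fin n → ℕ) : Prop :=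
  match alg with
  | .coinFlip => ∀ i, c i = (x i).toNat
  | .coloring => ∀ i ∈ cycleNodes f L, act i → (σ i).succ ≠ i → c i ≠ c (σ i).succ

/-- Up to the check for roots, an iteration deactivates the nodes whose successors have greater
colours, and keeps the roots. The random bits matter only in its first round, if at all. -/
theorem Iteration.find {alg : Subroutine} (h : Iteration alg M L f act σ) (x : Fin n → Bool) :
    ∃ c σ', Evolves alg (iterationLength n alg - 2) (step alg σ x) σ' ∧
      BreaksSymmetry alg L f act σ x c ∧
      Finding M L f (fun i => act i ∧ ¬ c i < c (σ i).succ) .check σ' ∧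
      Settled L f (fun i => act i ∧ ¬ c i < c (σ i).succ) σ' ∧
      ∀ i ∈ L, (σ i).succ = i → (σ' i).succ = i := by
  cases alg with
  | coinFlip =>
    obtain ⟨σ₁, h1, h2, h2'⟩ := h.toFinding.mark h.settled .coinFlip x (fun i => (x i).toNat)
      (fun _ => rfl) (fun i _ _ => (Bool.toNat_lt _).trans (by norm_num))
    obtain ⟨σ₂, h3, h4, h5, h6⟩ := h2.explore_iterate .coinFlip
    exact ⟨_, σ₂, (evolves_one h1).trans h3, fun _ => rfl, h4, h5,
      fun i hi h => h6 i hi ((h2' i hi).trans h)⟩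
  | coloring =>
    obtain ⟨σ₀, h01, h02, h03, h04, h05⟩ := h.toFinding.toss_iterate h.settled (h.color rfl)
    have hmark := fun x => h02.mark h03 .coloring x (fun i => (σ₀ i).color)
      (fun _ => rfl) (fun i hi ha => (h04 i hi ha).1)
    obtain ⟨σ₁, h1, h2, h2'⟩ := hmark x
    -- the random bits are not used
    have h1' : ∀ x x', step .coloring (step .coloring σ₀ x) x' = σ₁ := by
      intro x₁ x₂
      rw [← h1 x₂]
      funext i
      by_cases hi : i ∈ L
      · rw [step_step_request h02.phase h02.done (fun i hi => h02.forest.succ_mem hi) _ _ hi,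
          step_step_request h02.phase h02.done (fun i hi => h02.forest.succ_mem hi) _ _ hi]
        rfl
      · rw [h02.step_step_out _ _ _ hi, h02.step_step_out _ _ _ hi]
    obtain ⟨σ₂, h3, h4, h5, h6⟩ := h2.explore_iterate .coloring
    have hev : Evolves .coloring (2 * tossSteps n + 14) σ σ₂ :=
      h01.trans (Evolves.trans (s := 2) (fun y => h1' (y 0) (y 1)) h3)
    have hsucc : ∀ i ∈ L, (act i ∧ ¬ (σ₀ i).color < (σ₀ (σ i).succ).color ↔
        act i ∧ ¬ (σ₀ i).color < (σ₀ (σ₀ i).succ).color) := fun i hi => by rw [h05 i hi]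
    refine ⟨fun i => (σ₀ i).color, σ₂, fun y => ?_, fun i hi ha hne => ?_, ?_, ?_,
      fun i hi h => h6 i hi ((h2' i hi).trans ((h05 i hi).trans h))⟩
    · have := hev fun t => if t = 0 then x else y (t - 1)
      exact this
    · rw [← h05 i hi.1] at hne ⊢
      exact (h04 i hi ha).2 hne
    · exact ⟨h4.toStage, h4.phase, fun i hi => (h4.active i hi).trans (hsucc i hi).symm,
        h4.forest.congr hsucc (fun _ _ => rfl) fun _ _ => rfl⟩
    · exact fun i hi => (hsucc i hi.1.1).2 (h5 i hi)

end

/-! ### The beginning of a stage -/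

section

variable {M : HousingMarket n} {L : Finset (Fin n)} {f : Fin n → Fin n}
  {act : Fin n → Prop} {σ : Fin n → NodeState n}

theorem idxOf_head_filter_le {α : Type*} [DecidableEq α] {p : α → Bool} {l t : List α} {a : α}
    (h : l.filter p = a :: t) : ∀ b ∈ l, p b = true → l.idxOf a ≤ l.idxOf b := by
  induction l with
  | nil => simp at h
  | cons c l ih =>
    intro b hb hpb
    by_cases hc : p c = true
    · rw [List.filter_cons_of_pos hc] at h
      rw [(List.cons.inj h).1]; simp
    · rw [List.filter_cons_of_neg hc] at h
      have hcb : c ≠ b := by rintro rfl; exact hc hpb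
      have hca : c ≠ a := by
        rintro rfl
        have : c ∈ l.filter p := by rw [h]; simp
        exact hc (List.mem_filter.1 this).2
      rw [List.idxOf_cons_ne _ hca, List.idxOf_cons_ne _ hcb]
      have := ih h b ((List.mem_cons.1 hb).resolve_left hcb.symm) hpb
      omega

theorem beginIteration_fields (alg : Subroutine) (i : Fin n) (s : NodeState n) :
    ∃ c, beginIteration alg i s = { s with phase := firstPhase n alg, color := c } ∧
      (alg = .coloring → c = i) := by
  cases alg with
  | coinFlip => exact ⟨s.color, rfl, by simp⟩
  | coloring => exact ⟨i, rfl, fun _ => rfl⟩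

/-- A stage can begin if the agents in `L` have removed the houses of the other agents. -/
theorem exists_iteration (alg : Subroutine) {σ' : Fin n → NodeState n}
    (hdone : ∀ i ∉ L, (σ' i).phase = .done)
    (hstart : ∀ i ∈ L, σ' i = beginStage alg i (σ i))
    (hholder : ∀ i ∈ L, ∀ h, (σ i).holder h = M.endow.symm h)
    (hprefs : ∀ i ∈ L, (σ i).prefs = (M.prefs i).filter fun h => M.endow.symm h ∈ L)
    (hassigned : ∀ i ∈ L, (σ i).assigned = false)
    (htraded : ∃ rank r, M.TradedUntil L (fun i => (σ' i).house) rank r) :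
    ∃ f, Iteration alg M L f (fun _ => True) σ' := by
  have hfields : ∀ i ∈ L, ∃ c, σ' i = { σ i with
      top := (σ i).prefs.headD (σ i).house
      active := true
      succ := (σ i).holder ((σ i).prefs.headD (σ i).house)
      succActive := false
      children := ∅
      inCycle := false
      progress := .idle
      parent := i
      oks := ∅
      pending := ∅
      phase := firstPhase n alg
      color := c } ∧ (alg = .coloring → c = i) := by
    intro i hi
    rw [hstart i hi]
    exact beginIteration_fields alg i _
  have htop : ∀ i ∈ L, ∃ t, (σ i).prefs = (σ' i).top :: t := by
    intro i hi
    obtain ⟨c, hc, -⟩ := hfields i hi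
    have hmem : M.endow i ∈ (σ i).prefs := by
      rw [hprefs i hi, List.mem_filter]
      exact ⟨M.endow_mem i, by simpa using hi⟩
    rw [hc]
    cases hl : (σ i).prefs with
    | nil => rw [hl] at hmem; simp at hmem
    | cons a t => exact ⟨t, by simp⟩
  have htop_mem : ∀ i ∈ L, (σ' i).top ∈ M.prefs i ∧ M.endow.symm (σ' i).top ∈ L := by
    intro i hi
    obtain ⟨t, ht⟩ := htop i hi
    have : (σ' i).top ∈ (σ i).prefs := by rw [ht]; simp
    rw [hprefs i hi, List.mem_filter] at this
    exact ⟨this.1, by simpa using this.2⟩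
  have hsucc : ∀ i ∈ L, (σ' i).succ = M.endow.symm (σ' i).top := by
    intro i hi
    obtain ⟨c, hc, -⟩ := hfields i hi
    rw [hc]; exact hholder i hi _
  have hcolor : alg = .coloring → ∀ i ∈ L, (σ' i).color = i := by
    intro ha i hi
    obtain ⟨c, hc, h⟩ := hfields i hi
    rw [hc]; exact h ha
  have key : ∀ i ∈ L, (σ' i).holder = (σ i).holder ∧ (σ' i).prefs = (σ i).prefs ∧
      (σ' i).assigned = (σ i).assigned ∧ (σ' i).progress = .idle ∧ (σ' i).oks = ∅ ∧
      (σ' i).phase = firstPhase n alg ∧ (σ' i).active = true ∧ (σ' i).children = ∅ := by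
    intro i hi
    obtain ⟨c, hc, -⟩ := hfields i hi
    rw [hc]; exact ⟨rfl, rfl, rfl, rfl, rfl, rfl, rfl, rfl⟩
  refine ⟨fun i => M.endow.symm (σ' i).top, ⟨⟨⟨hdone, ?_, ?_, ?_, ?_, ?_, htraded, ?_, ?_, ?_⟩, ?_,
    ?_, ?_⟩, fun _ _ => trivial, hcolor⟩⟩
  · exact fun i hi h => by rw [(key i hi).1]; exact hholder i hi h
  · exact fun i hi => by rw [(key i hi).2.1]; exact hprefs i hi
  · exact fun i hi => by rw [(key i hi).2.2.1]; exact hassigned i hi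
  · exact fun i hi => (key i hi).2.2.2.1
  · exact fun i hi => (key i hi).2.2.2.2.1
  · exact fun _ _ => rfl
  · exact fun i hi => (htop_mem i hi).1
  · intro i hi h hh hL
    obtain ⟨t, ht⟩ := htop i hi
    rw [hprefs i hi] at ht
    exact idxOf_head_filter_le ht h hh (by simpa using hL)
  · exact fun i hi => (key i hi).2.2.2.2.2.1
  · exact fun i hi => by simp [(key i hi).2.2.2.2.2.2.1]
  · exact pointerForest_init (fun i hi => (htop_mem i hi).2) (fun _ => trivial) hsucc
      fun i hi => (key i hi).2.2.2.2.2.2.2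

/-! ### The check for roots -/

theorem Finding.removers_eq (h : Finding M L f act .check σ) (i : Fin n) :
    removers (inbox σ i) = L.filter fun r => (σ r).succ = r := by
  ext j
  rw [mem_removers, Finset.mem_filter]
  by_cases hj : j ∈ L
  · simp [send, h.phase j hj, hj]
  · simp [send_of_done (h.done j hj), hj]

theorem Finding.remove_senders (h : Finding M L f act .check σ) (i x : Fin n) :
    senders (inbox σ i) (.remove x) = L.filter fun r => (σ r).succ = r ∧ (σ r).top = x := by
  ext j
  rw [mem_senders, Finset.mem_filter]
  by_cases hj : j ∈ L
  · simp [send, h.phase j hj, hj]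
  · simp [send_of_done (h.done j hj), hj]

/-- If there is no root, the next iteration begins. -/
theorem Finding.next_iteration {alg : Subroutine} (h : Finding M L f act .check σ)
    (hs : Settled L f act σ) (hroot : ∀ i ∈ L, (σ i).succ ≠ i) :
    ∃ σ', Evolves alg 1 σ σ' ∧ Iteration alg M L f act σ' := by
  have hno : L.filter (fun r => (σ r).succ = r) = ∅ :=
    Finset.filter_eq_empty_iff.2 fun i hi => hroot i hi
  have hdrop : ∀ i, dropRemoved (inbox σ i) (σ i).prefs = (σ i).prefs := by
    intro i
    unfold dropRemoved
    rw [List.filter_eq_self]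
    intro x _
    rw [decide_eq_true_eq, h.remove_senders, Finset.filter_eq_empty_iff]
    exact fun r hr h1 => hroot r hr h1.1
  have hstep : ∀ x, ∀ i ∈ L, step alg σ x i = beginIteration alg i (σ i) := by
    intro x i hi
    simp only [step, receive, h.phase i hi, h.removers_eq, hno, if_true]
    rw [hdrop i]
    congr 1
    rw [← h.phase i hi]
  let σ' : Fin n → NodeState n := fun i => if i ∈ L then beginIteration alg i (σ i) else σ i
  have hin : ∀ i ∈ L, ∃ c, σ' i = { σ i with phase := firstPhase n alg, color := c } ∧
      (alg = .coloring → c = i) := by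
    intro i hi
    have : σ' i = beginIteration alg i (σ i) := if_pos hi
    rw [this]
    exact beginIteration_fields alg i (σ i)
  have hout : ∀ i ∉ L, σ' i = σ i := fun i hi => if_neg hi
  refine ⟨σ', evolves_one fun x => ?_, ⟨h.recolor hout fun i hi => ?_,
    settled_congr hs fun i hi => ?_, fun ha i hi => ?_⟩⟩
  · funext i
    by_cases hi : i ∈ L
    · rw [hstep x i hi]; exact (if_pos hi).symm
    · rw [step_of_done (h.done i hi), hout i hi]
  · obtain ⟨c, hc, -⟩ := hin i hi
    exact ⟨_, c, hc⟩
  · obtain ⟨c, hc, -⟩ := hin i hi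
    rw [hc]
  · obtain ⟨c, hc, h1⟩ := hin i hi
    rw [hc]; exact h1 ha

/-! ### Trading -/

/-- The state after `s` rounds of trading. The nodes of `K` lie below roots; a node of depth `d`
learns that it trades at time `2 * d - 1`, announces this, forwards the message at time `2 * d`, and
waits from time `2 * d + 1` until it reports at time `w`. The functions `sc`, `ch` and `tp` are the
successors, the children and the top choices. -/
structure Trading (M : HousingMarket n) (L : Finset (Fin n)) (sc : Fin n → Fin n)
    (ch : Fin n → Finset (Fin n)) (tp : Fin n → Fin n) (K : Finset (Fin n)) (d w : Fin n → ℕ)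
    (s : ℕ) (σ : Fin n → NodeState n) : Prop where
  done : ∀ i ∉ L, (σ i).phase = .done
  phase : ∀ i ∈ L, (σ i).phase = .trade
  holder : ∀ i ∈ L, ∀ h, (σ i).holder h = M.endow.symm h
  succ : ∀ i ∈ L, (σ i).succ = sc i
  children : ∀ i ∈ L, (σ i).children = ch i
  top : ∀ i ∈ L, (σ i).top = tp i
  traded : ∃ m rank r, M.TradedUntil L m rank r ∧ ∀ i ∉ L, (σ i).house = m i
  prefs : ∀ i ∈ L, (σ i).prefs = (M.prefs i).filter fun h =>
    M.endow.symm h ∈ L ∧ ∀ c ∈ K, 2 * d c ≤ s → tp c ≠ h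
  progress : ∀ i ∈ K, (σ i).progress =
    if s + 1 < 2 * d i then .idle else if s + 1 = 2 * d i then .announce
    else if s = 2 * d i then .forward else if s ≤ w i then .wait else .finished
  progress_out : ∀ i ∈ L, i ∉ K → (σ i).progress = .idle
  assigned : ∀ i ∈ L, (σ i).assigned = true ↔ i ∈ K ∧ 2 * d i ≤ s + 1
  house : ∀ i ∈ K, 2 * d i ≤ s + 1 → (σ i).house = tp i
  parent : ∀ i ∈ K, sc i ≠ i → 2 * d i ≤ s + 1 → (σ i).parent ∈ K ∧ i ∈ ch (σ i).parent
  oks : ∀ i ∈ K, (σ i).oks = (ch i).filter fun c => w c < s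
  pending : ∀ i ∈ L, (σ i).pending = L.filter fun r => sc r = r ∧ s ≤ w r

theorem Schedule.depth_pos {α : Type*} {f : α → α} {L : Finset α} {succ : α → α}
    {ch : α → Finset α} {K : Finset α} {d w : α → ℕ} (S : Schedule f L succ ch K d w) {i : α}
    (hi : i ∈ K) (h : succ i ≠ i) : 0 < d i := by
  obtain ⟨p, hp, hip⟩ := S.exists_parent i hi h
  have := (S.child p hp i hip).2.1
  omega

theorem Schedule.subset {α : Type*} {f : α → α} {L : Finset α} {succ : α → α}
    {ch : α → Finset α} {K : Finset α} {d w : α → ℕ} (S : Schedule f L succ ch K d w) {i : α}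
    (hi : i ∈ K) : i ∈ L := (S.mem_cycleNodes i hi).1

/-- If there are roots, trading begins. -/
theorem Finding.begin_trading {alg : Subroutine} (h : Finding M L f act .check σ)
    {K : Finset (Fin n)} {d w : Fin n → ℕ}
    (S : Schedule f L (fun i => (σ i).succ) (fun i => (σ i).children) K d w)
    {r : Fin n} (hr : r ∈ L) (hrr : (σ r).succ = r) :
    ∃ σ', Evolves alg 1 σ σ' ∧ Trading M L (fun i => (σ i).succ) (fun i => (σ i).children)
      (fun i => (σ i).top) K d w 0 σ' := by
  have hroots : L.filter (fun r => (σ r).succ = r) ≠ ∅ :=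
    Finset.ne_empty_of_mem (Finset.mem_filter.2 ⟨hr, hrr⟩)
  let s₂ : Fin n → NodeState n := fun i => { σ i with
    prefs := dropRemoved (inbox σ i) (σ i).prefs
    phase := .trade
    pending := L.filter fun r => (σ r).succ = r }
  let σ' : Fin n → NodeState n := fun i => if i ∈ L then
    if (σ i).succ = i then enterCycle i .forward (s₂ i) else s₂ i else σ i
  have hin : ∀ i ∈ L, σ' i = if (σ i).succ = i then enterCycle i .forward (s₂ i) else s₂ i :=
    fun i hi => if_pos hi
  have hout : ∀ i ∉ L, σ' i = σ i := fun i hi => if_neg hi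
  have hroot_in : ∀ i ∈ L, (σ i).succ = i → σ' i = enterCycle i .forward (s₂ i) :=
    fun i hi h1 => by rw [hin i hi, if_pos h1]
  have hroot_out : ∀ i ∈ L, (σ i).succ ≠ i → σ' i = s₂ i :=
    fun i hi h1 => by rw [hin i hi, if_neg h1]
  have key : ∀ i ∈ L, (σ' i).phase = .trade ∧ (σ' i).holder = (σ i).holder ∧
      (σ' i).succ = (σ i).succ ∧ (σ' i).children = (σ i).children ∧ (σ' i).top = (σ i).top ∧
      (σ' i).prefs = dropRemoved (inbox σ i) (σ i).prefs ∧ (σ' i).oks = (σ i).oks ∧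
      (σ' i).pending = L.filter fun r => (σ r).succ = r := by
    intro i hi
    rw [hin i hi]
    split_ifs <;> exact ⟨rfl, rfl, rfl, rfl, rfl, rfl, rfl, rfl⟩
  refine ⟨σ', evolves_one fun x => ?_, ⟨fun i hi => ?_, fun i hi => (key i hi).1, fun i hi x => ?_,
    fun i hi => (key i hi).2.2.1, fun i hi => (key i hi).2.2.2.1, fun i hi => (key i hi).2.2.2.2.1,
    ?_, fun i hi => ?_, fun i hi => ?_, fun i hi hK => ?_, fun i hi => ?_, fun i hi hd => ?_,
    fun i hi hne hd => ?_, fun i hi => ?_, fun i hi => ?_⟩⟩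
  · funext i
    by_cases hi : i ∈ L
    · rw [hin i hi]
      simp only [step, receive, h.phase i hi, h.removers_eq, hroots, if_false, s₂]
    · rw [step_of_done (h.done i hi), hout i hi]
  · rw [hout i hi]; exact h.done i hi
  · rw [(key i hi).2.1]; exact h.holder i hi x
  · obtain ⟨rank, r, ht⟩ := h.traded
    exact ⟨_, rank, r, ht, fun i hi => by rw [hout i hi]⟩
  · rw [(key i hi).2.2.2.2.2.1, h.prefs i hi]
    unfold dropRemoved
    rw [List.filter_filter]
    refine List.filter_congr fun x _ => ?_
    rw [Bool.eq_iff_iff]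
    simp only [Bool.and_eq_true, decide_eq_true_eq, h.remove_senders, Finset.filter_eq_empty_iff]
    rw [and_comm]
    refine and_congr_right fun _ => ⟨fun h1 c hc hd heq => ?_, fun h1 c hc h2 => ?_⟩
    · by_cases h2 : (σ c).succ = c
      · exact h1 (S.subset hc) ⟨h2, heq⟩
      · have := S.depth_pos hc h2; omega
    · obtain ⟨h3, h4⟩ := S.root c hc h2.1
      exact h1 c h3 (by omega) h2.2
  · have hiL := S.subset hi
    by_cases h1 : (σ i).succ = i
    · rw [hroot_in i hiL h1, (S.root i hiL h1).2]; rfl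
    · rw [hroot_out i hiL h1]
      have := S.depth_pos hi h1
      rw [if_pos (by omega)]
      exact h.progress i hiL
  · have h1 : (σ i).succ ≠ i := fun h1 => hK (S.root i hi h1).1
    rw [hroot_out i hi h1]
    exact h.progress i hi
  · by_cases h1 : (σ i).succ = i
    · rw [hroot_in i hi h1]
      obtain ⟨h2, h3⟩ := S.root i hi h1
      simp [enterCycle, h2, h3]
    · rw [hroot_out i hi h1]
      have : (s₂ i).assigned = false := h.assigned i hi
      rw [this]
      simp only [Bool.false_eq_true, false_iff, not_and]
      intro h2
      have := S.depth_pos h2 h1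
      omega
  · have hiL := S.subset hi
    have h1 : (σ i).succ = i := by
      by_contra h1
      have := S.depth_pos hi h1
      omega
    rw [hroot_in i hiL h1]; rfl
  · have := S.depth_pos hi hne
    omega
  · have hiL := S.subset hi
    rw [(key i hiL).2.2.2.2.2.2.1, h.oks i hiL]
    simp
  · rw [(key i hi).2.2.2.2.2.2.2]
    simp

section

variable {sc : Fin n → Fin n} {ch : Fin n → Finset (Fin n)} {tp : Fin n → Fin n}
  {K : Finset (Fin n)} {d w : Fin n → ℕ} {s : ℕ}

/-- A waiting node reports at the scheduled time. -/
theorem Trading.children_subset_oks (T : Trading M L sc ch tp K d w s σ)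
    (S : Schedule f L sc ch K d w) {i : Fin n} (hi : i ∈ K) (h1 : 2 * d i < s) (h2 : s ≤ w i) :
    (σ i).children ⊆ (σ i).oks ↔ s = w i := by
  rw [T.children i (S.subset hi), T.oks i hi]
  constructor
  · intro h
    rcases S.w_eq i hi with h3 | ⟨c, hc, h3⟩
    · omega
    · have := (Finset.mem_filter.1 (h hc)).2
      omega
  · intro h c hc
    have := (S.child i hi c hc).2.2.1
    exact Finset.mem_filter.2 ⟨hc, by omega⟩

/-- What a node sends while the cycles trade. -/
theorem Trading.send_eq (T : Trading M L sc ch tp K d w s σ) (S : Schedule f L sc ch K d w)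
    (i : Fin n) :
    send i (σ i) = if i ∈ K then
      if s + 1 = 2 * d i then some (.remove (tp i), Finset.univ)
      else if s = 2 * d i then some (.cycle, ch i)
      else if s = w i then
        if sc i = i then some (.nextStage, Finset.univ) else some (.ok, {(σ i).parent})
      else none
    else none := by
  by_cases hK : i ∈ K
  · have hL := S.subset hK
    have hle := S.le_w i hK
    have hp := T.progress i hK
    rw [if_pos hK]
    simp only [send, T.phase i hL, T.succ i hL, T.top i hL]
    by_cases h1 : s + 1 < 2 * d i
    · rw [if_pos h1] at hp
      simp only [hp]
      rw [if_neg (by omega), if_neg (by omega), if_neg (by omega)]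
    rw [if_neg h1] at hp
    by_cases h2 : s + 1 = 2 * d i
    · rw [if_pos h2] at hp
      simp only [hp, if_pos h2]
    rw [if_neg h2] at hp
    by_cases h3 : s = 2 * d i
    · rw [if_pos h3] at hp
      simp only [hp, if_neg h2, if_pos h3, T.children i hL]
    rw [if_neg h3] at hp
    by_cases h4 : s ≤ w i
    · rw [if_pos h4] at hp
      have := T.children_subset_oks S hK (by omega) h4
      simp only [hp, if_neg h2, if_neg h3, this]
    · rw [if_neg h4] at hp
      simp only [hp, if_neg h2, if_neg h3]
      rw [if_neg (by omega)]
  · rw [if_neg hK]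
    by_cases hL : i ∈ L
    · simp [send, T.phase i hL, T.progress_out i hL hK]
    · exact send_of_done (T.done i hL) i

theorem Trading.remove_senders (T : Trading M L sc ch tp K d w s σ) (S : Schedule f L sc ch K d w)
    (i j x : Fin n) : j ∈ senders (inbox σ i) (.remove x) ↔ j ∈ K ∧ s + 1 = 2 * d j ∧ tp j = x := by
  rw [mem_senders, T.send_eq S]
  split_ifs <;> simp_all

theorem Trading.cycle_senders (T : Trading M L sc ch tp K d w s σ) (S : Schedule f L sc ch K d w)
    (i j : Fin n) : j ∈ senders (inbox σ i) .cycle ↔ j ∈ K ∧ s = 2 * d j ∧ i ∈ ch j := by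
  rw [mem_senders, T.send_eq S]
  by_cases hK : j ∈ K
  · by_cases h1 : s + 1 = 2 * d j
    · have : s ≠ 2 * d j := by omega
      rw [if_pos hK, if_pos h1]
      simp [this]
    · rw [if_pos hK, if_neg h1]
      by_cases h2 : s = 2 * d j
      · rw [if_pos h2]
        constructor
        · rintro ⟨R, h3, h4⟩
          simp only [Option.some.injEq, Prod.mk.injEq, true_and] at h3
          exact ⟨hK, h2, h3 ▸ h4⟩
        · rintro ⟨-, -, h4⟩
          exact ⟨_, rfl, h4⟩
      · rw [if_neg h2]
        split_ifs <;> simp [h2]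
  · simp [hK]

theorem Trading.ok_senders (T : Trading M L sc ch tp K d w s σ) (S : Schedule f L sc ch K d w)
    (i j : Fin n) :
    j ∈ senders (inbox σ i) .ok ↔ j ∈ K ∧ s = w j ∧ sc j ≠ j ∧ (σ j).parent = i := by
  rw [mem_senders, T.send_eq S]
  by_cases hK : j ∈ K
  · have := S.le_w j hK
    by_cases h3 : s = w j
    · have h1 : s + 1 ≠ 2 * d j := by omega
      have h2 : s ≠ 2 * d j := by omega
      rw [if_pos hK, if_neg h1, if_neg h2, if_pos h3]
      split_ifs with h4
      · simp [h4]
      · simp only [Option.some.injEq, Prod.mk.injEq, true_and, exists_eq_left',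
          Finset.mem_singleton]
        exact ⟨fun h => ⟨hK, h3, h4, h.symm⟩, fun h => h.2.2.2.symm⟩
    · split_ifs <;> simp_all
  · simp [hK]

theorem Trading.nextStage_senders (T : Trading M L sc ch tp K d w s σ)
    (S : Schedule f L sc ch K d w) (i j : Fin n) :
    j ∈ senders (inbox σ i) .nextStage ↔ j ∈ L ∧ s = w j ∧ sc j = j := by
  rw [mem_senders, T.send_eq S]
  by_cases hK : j ∈ K
  · have := S.le_w j hK
    have hL := S.subset hK
    by_cases h3 : s = w j
    · have h1 : s + 1 ≠ 2 * d j := by omega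
      have h2 : s ≠ 2 * d j := by omega
      rw [if_pos hK, if_neg h1, if_neg h2, if_pos h3]
      split_ifs <;> simp_all
    · split_ifs <;> simp_all
  · have : ¬ (j ∈ L ∧ s = w j ∧ sc j = j) := fun h => hK (S.root j h.1 h.2.2).1
    simp [hK, this]

/-- One round of trading, without the transition to the next stage. -/
def tradeStep (σ : Fin n → NodeState n) (i : Fin n) : NodeState n :=
  if (σ i).phase = .done then σ i else
    { advance (σ i) (inbox σ i) with
      prefs := dropRemoved (inbox σ i) (σ i).prefs
      oks := (σ i).oks ∪ senders (inbox σ i) .ok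
      pending := (σ i).pending \ senders (inbox σ i) .nextStage }

theorem step_of_trade {alg : Subroutine} {i : Fin n} (h : (σ i).phase = .trade)
    (x : Fin n → Bool) : step alg σ x i =
      if (tradeStep σ i).pending = ∅ then
        if (tradeStep σ i).assigned then { tradeStep σ i with phase := .done }
        else beginStage alg i (tradeStep σ i)
      else tradeStep σ i := by
  have h1 : (σ i).phase ≠ .done := by simp [h]
  simp only [step, receive, h, tradeStep, reduceCtorEq, if_false]

theorem firstSender_spec {inb : Fin n → Option (Message n)} {m : Message n} :
    (firstSender inb m = none ∧ senders inb m = ∅) ∨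
      ∃ j ∈ senders inb m, firstSender inb m = some j := by
  unfold firstSender
  cases h : (List.finRange n).find? fun j => inb j = some m with
  | none =>
    left
    rw [List.find?_eq_none] at h
    refine ⟨rfl, Finset.filter_eq_empty_iff.2 fun j _ => ?_⟩
    simpa using h j (List.mem_finRange j)
  | some j =>
    right
    have := List.find?_some h
    exact ⟨j, by simpa [senders] using this, rfl⟩

theorem advance_fields (s : NodeState n) (inb : Fin n → Option (Message n)) :
    (advance s inb).phase = s.phase ∧ (advance s inb).holder = s.holder ∧
      (advance s inb).succ = s.succ ∧ (advance s inb).children = s.children ∧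
      (advance s inb).top = s.top := by
  unfold advance
  cases s.progress
  · cases firstSender inb .cycle <;> exact ⟨rfl, rfl, rfl, rfl, rfl⟩
  · exact ⟨rfl, rfl, rfl, rfl, rfl⟩
  · exact ⟨rfl, rfl, rfl, rfl, rfl⟩
  · dsimp only; split_ifs <;> exact ⟨rfl, rfl, rfl, rfl, rfl⟩
  · exact ⟨rfl, rfl, rfl, rfl, rfl⟩

theorem Trading.advance_mem (T : Trading M L sc ch tp K d w s σ) (S : Schedule f L sc ch K d w)
    {i : Fin n} (hi : i ∈ K) :
    (advance (σ i) (inbox σ i)).progress = (if s + 1 + 1 < 2 * d i then .idle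
      else if s + 1 + 1 = 2 * d i then .announce else if s + 1 = 2 * d i then .forward
      else if s + 1 ≤ w i then .wait else .finished) ∧
    ((advance (σ i) (inbox σ i)).assigned = true ↔ 2 * d i ≤ s + 1 + 1) ∧
    (2 * d i ≤ s + 1 + 1 → (advance (σ i) (inbox σ i)).house = tp i) ∧
    (sc i ≠ i → 2 * d i ≤ s + 1 + 1 → (advance (σ i) (inbox σ i)).parent ∈ K ∧
      i ∈ ch (advance (σ i) (inbox σ i)).parent) := by
  have hL := S.subset hi
  have hle := S.le_w i hi
  have hp := T.progress i hi
  have ha := T.assigned i hL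
  have hh := T.house i hi
  have hpar := T.parent i hi
  simp only [hi, true_and] at ha
  by_cases h1 : s + 1 < 2 * d i
  · rw [if_pos h1] at hp
    have hcyc : ∀ j, j ∈ senders (inbox σ i) .cycle → s + 1 + 1 = 2 * d i := by
      intro j hj
      obtain ⟨h2, h3, h4⟩ := (T.cycle_senders S i j).1 hj
      have := (S.child j h2 i h4).2.1
      omega
    rcases firstSender_spec (inb := inbox σ i) (m := .cycle) with ⟨h2, h3⟩ | ⟨j, h2, h3⟩
    · have h4 : s + 1 + 1 ≠ 2 * d i := by
        intro h4
        have hne : sc i ≠ i := fun h5 => by have := (S.root i hL h5).2; omega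
        obtain ⟨p, hp1, hp2⟩ := S.exists_parent i hi hne
        have h5 := (S.child p hp1 i hp2).2.1
        have : p ∈ senders (inbox σ i) .cycle := (T.cycle_senders S i p).2 ⟨hp1, by omega, hp2⟩
        rw [h3] at this
        exact Finset.notMem_empty p this
      have h6 : advance (σ i) (inbox σ i) = σ i := by simp [advance, hp, h2]
      rw [h6, hp, if_pos (by omega), ha]
      exact ⟨rfl, by omega, by omega, by omega⟩
    · have h4 := hcyc j h2
      obtain ⟨h5, -, h6⟩ := (T.cycle_senders S i j).1 h2
      have h7 : advance (σ i) (inbox σ i) = enterCycle j .announce (σ i) := by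
        simp [advance, hp, h3]
      rw [h7, if_neg (by omega), if_pos h4]
      refine ⟨rfl, ?_, fun _ => T.top i hL, fun _ _ => ⟨h5, h6⟩⟩
      simp [enterCycle]; omega
  rw [if_neg h1] at hp
  have key : ∀ p, advance (σ i) (inbox σ i) = { σ i with progress := p } →
      p = (if s + 1 + 1 < 2 * d i then .idle
        else if s + 1 + 1 = 2 * d i then .announce else if s + 1 = 2 * d i then .forward
        else if s + 1 ≤ w i then .wait else .finished) →
      (advance (σ i) (inbox σ i)).progress = (if s + 1 + 1 < 2 * d i then .idle
        else if s + 1 + 1 = 2 * d i then .announce else if s + 1 = 2 * d i then .forward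
        else if s + 1 ≤ w i then .wait else .finished) ∧
      ((advance (σ i) (inbox σ i)).assigned = true ↔ 2 * d i ≤ s + 1 + 1) ∧
      (2 * d i ≤ s + 1 + 1 → (advance (σ i) (inbox σ i)).house = tp i) ∧
      (sc i ≠ i → 2 * d i ≤ s + 1 + 1 → (advance (σ i) (inbox σ i)).parent ∈ K ∧
        i ∈ ch (advance (σ i) (inbox σ i)).parent) := by
    intro p h2 h3
    rw [h2]
    refine ⟨h3, ?_, fun _ => hh (by omega), fun h4 _ => hpar h4 (by omega)⟩
    rw [ha]; omega
  by_cases h2 : s + 1 = 2 * d i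
  · rw [if_pos h2] at hp
    refine key .forward (by simp [advance, hp]) ?_
    rw [if_neg (by omega), if_neg (by omega), if_pos h2]
  rw [if_neg h2] at hp
  by_cases h3 : s = 2 * d i
  · rw [if_pos h3] at hp
    refine key .wait (by simp [advance, hp]) ?_
    rw [if_neg (by omega), if_neg (by omega), if_neg (by omega), if_pos (by omega)]
  rw [if_neg h3] at hp
  by_cases h4 : s ≤ w i
  · rw [if_pos h4] at hp
    have h5 := T.children_subset_oks S hi (by omega) h4
    by_cases h6 : s = w i
    · refine key .finished (by simp [advance, hp, h5, h6]) ?_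
      rw [if_neg (by omega), if_neg (by omega), if_neg (by omega), if_neg (by omega)]
    · refine key .wait ?_ ?_
      · have : advance (σ i) (inbox σ i) = σ i := by simp [advance, hp, h5, h6]
        rw [this, ← hp]
      · rw [if_neg (by omega), if_neg (by omega), if_neg (by omega), if_pos (by omega)]
  · rw [if_neg h4] at hp
    refine key .finished ?_ ?_
    · have : advance (σ i) (inbox σ i) = σ i := by simp [advance, hp]
      rw [this, ← hp]
    · rw [if_neg (by omega), if_neg (by omega), if_neg (by omega), if_neg (by omega)]

theorem Trading.next_round (T : Trading M L sc ch tp K d w s σ) (S : Schedule f L sc ch K d w) :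
    Trading M L sc ch tp K d w (s + 1) (tradeStep σ) := by
  have hin : ∀ i ∈ L, tradeStep σ i = { advance (σ i) (inbox σ i) with
      prefs := dropRemoved (inbox σ i) (σ i).prefs
      oks := (σ i).oks ∪ senders (inbox σ i) .ok
      pending := (σ i).pending \ senders (inbox σ i) .nextStage } :=
    fun i hi => if_neg (by simp [T.phase i hi])
  have hout : ∀ i ∉ L, tradeStep σ i = σ i := fun i hi => if_pos (T.done i hi)
  have hadv := fun i => advance_fields (σ i) (inbox σ i)
  have hK : ∀ i ∈ L, i ∉ K → advance (σ i) (inbox σ i) = σ i := by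
    intro i hi hiK
    rcases firstSender_spec (inb := inbox σ i) (m := .cycle) with ⟨h2, -⟩ | ⟨j, h2, -⟩
    · simp [advance, T.progress_out i hi hiK, h2]
    · obtain ⟨h3, -, h4⟩ := (T.cycle_senders S i j).1 h2
      exact absurd (S.child j h3 i h4).1 hiK
  refine ⟨fun i hi => ?_, fun i hi => ?_, fun i hi h => ?_, fun i hi => ?_, fun i hi => ?_,
    fun i hi => ?_, ?_, fun i hi => ?_, fun i hi => ?_, fun i hi hiK => ?_, fun i hi => ?_,
    fun i hi hd => ?_, fun i hi hne hd => ?_, fun i hi => ?_, fun i hi => ?_⟩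
  · rw [hout i hi]; exact T.done i hi
  · rw [hin i hi]; exact (hadv i).1.trans (T.phase i hi)
  · rw [hin i hi]; exact (congrFun (hadv i).2.1 h).trans (T.holder i hi h)
  · rw [hin i hi]; exact (hadv i).2.2.1.trans (T.succ i hi)
  · rw [hin i hi]; exact (hadv i).2.2.2.1.trans (T.children i hi)
  · rw [hin i hi]; exact (hadv i).2.2.2.2.trans (T.top i hi)
  · obtain ⟨m, rank, r, h1, h2⟩ := T.traded
    exact ⟨m, rank, r, h1, fun i hi => by rw [hout i hi]; exact h2 i hi⟩
  · rw [hin i hi]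
    change dropRemoved (inbox σ i) (σ i).prefs = _
    unfold dropRemoved
    rw [T.prefs i hi, List.filter_filter]
    refine List.filter_congr fun x _ => ?_
    rw [Bool.eq_iff_iff]
    simp only [Bool.and_eq_true, decide_eq_true_eq, Finset.eq_empty_iff_forall_notMem,
      T.remove_senders S]
    constructor
    · rintro ⟨h1, h2, h3⟩
      refine ⟨h2, fun c hc hd heq => ?_⟩
      by_cases h4 : 2 * d c ≤ s
      · exact h3 c hc h4 heq
      · exact h1 c ⟨hc, by omega, heq⟩
    · rintro ⟨h1, h2⟩
      exact ⟨fun c hc => h2 c hc.1 (by omega) hc.2.2, h1, fun c hc hd => h2 c hc (by omega)⟩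
  · rw [hin i (S.subset hi)]; exact (T.advance_mem S hi).1
  · rw [hin i hi]
    change (advance (σ i) (inbox σ i)).progress = _
    rw [hK i hi hiK]; exact T.progress_out i hi hiK
  · rw [hin i hi]
    change (advance (σ i) (inbox σ i)).assigned = true ↔ _
    by_cases hiK : i ∈ K
    · simpa only [hiK, true_and] using (T.advance_mem S hiK).2.1
    · rw [hK i hi hiK, T.assigned i hi]; simp [hiK]
  · rw [hin i (S.subset hi)]; exact (T.advance_mem S hi).2.2.1 hd
  · rw [hin i (S.subset hi)]; exact (T.advance_mem S hi).2.2.2 hne hd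
  · rw [hin i (S.subset hi)]
    change (σ i).oks ∪ senders (inbox σ i) .ok = _
    ext c
    rw [T.oks i hi, Finset.mem_union, Finset.mem_filter, Finset.mem_filter, T.ok_senders S]
    constructor
    · rintro (h1 | ⟨h1, h2, h3, rfl⟩)
      · exact ⟨h1.1, by omega⟩
      · have := S.le_w c h1
        exact ⟨(T.parent c h1 h3 (by omega)).2, by omega⟩
    · rintro ⟨h1, h2⟩
      by_cases h3 : w c < s
      · exact Or.inl ⟨h1, h3⟩
      obtain ⟨h4, -, -, h5⟩ := S.child i hi c h1
      have h6 := S.le_w c h4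
      have h7 := T.parent c h4 h5 (by omega)
      exact Or.inr ⟨h4, by omega, h5, S.parent_unique _ h7.1 i hi c h7.2 h1⟩
  · rw [hin i hi]
    change (σ i).pending \ senders (inbox σ i) .nextStage = _
    ext r
    rw [T.pending i hi, Finset.mem_sdiff, Finset.mem_filter, Finset.mem_filter,
      T.nextStage_senders S]
    constructor
    · rintro ⟨⟨h1, h2, h3⟩, h4⟩
      refine ⟨h1, h2, ?_⟩
      by_contra h5
      exact h4 ⟨h1, by omega, h2⟩
    · rintro ⟨h1, h2, h3⟩
      exact ⟨⟨h1, h2, by omega⟩, fun h4 => by omega⟩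

/-- When the last root has broadcast `nextStage`, all nodes below roots have traded, and the next
stage begins. -/
theorem Trading.next_stage {alg : Subroutine} (T : Trading M L sc ch tp K d w s σ)
    (S : Schedule f L sc ch K d w) (hgraph : ∀ i ∈ L, f i = M.endow.symm (tp i))
    (hmem : ∀ i ∈ L, tp i ∈ M.prefs i)
    (hbest : ∀ i ∈ L, ∀ h ∈ M.prefs i, M.endow.symm h ∈ L →
      (M.prefs i).idxOf (tp i) ≤ (M.prefs i).idxOf h)
    (hw : ∀ r ∈ L, sc r = r → w r ≤ s) :
    ∃ σ' f', Evolves alg 1 σ σ' ∧ Iteration alg M (L \ K) f' (fun _ => True) σ' := by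
  have T' := T.next_round S
  have hpend : ∀ i ∈ L, (tradeStep σ i).pending = ∅ := by
    intro i hi
    rw [T'.pending i hi, Finset.filter_eq_empty_iff]
    intro r hr h
    have := hw r hr h.1
    omega
  have hwK : ∀ i ∈ K, 2 * d i < s := by
    intro i hi
    obtain ⟨r, hr, h1, h2⟩ := S.le_root i hi
    have := hw r (S.subset hr) h1
    have := S.le_w i hi
    omega
  have hass : ∀ i ∈ L, (tradeStep σ i).assigned = true ↔ i ∈ K := by
    intro i hi
    rw [T'.assigned i hi]
    exact ⟨fun h => h.1, fun h => ⟨h, by have := hwK i h; omega⟩⟩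
  let σ' : Fin n → NodeState n := step alg σ fun _ => false
  have hσ' : ∀ x, ∀ i, step alg σ x i = if i ∈ L then
      if i ∈ K then { tradeStep σ i with phase := .done }
      else beginStage alg i (tradeStep σ i) else σ i := by
    intro x i
    by_cases hi : i ∈ L
    · rw [if_pos hi, step_of_trade (T.phase i hi), if_pos (hpend i hi)]
      simp only [hass i hi]
    · rw [if_neg hi, step_of_done (T.done i hi)]
  have hσ : ∀ i, σ' i = if i ∈ L then
      if i ∈ K then { tradeStep σ i with phase := .done }
      else beginStage alg i (tradeStep σ i) else σ i := hσ' _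
  obtain ⟨m, rank, r, h1, h2⟩ := T'.traded
  have hinj : Set.InjOn f (cycleNodes f L) := injOn_cycleNodes
  have hiter : ∃ f', Iteration alg M (L \ K) f' (fun _ => True) σ' := by
    refine exists_iteration (σ := tradeStep σ) alg (fun i hi => ?_) (fun i hi => ?_)
      (fun i hi => ?_) (fun i hi => ?_) (fun i hi => ?_) ?_
    · rw [hσ]
      by_cases hiL : i ∈ L
      · have hiK : i ∈ K := by
          by_contra hiK; exact hi (Finset.mem_sdiff.2 ⟨hiL, hiK⟩)
        rw [if_pos hiL, if_pos hiK]
      · rw [if_neg hiL]; exact T.done i hiL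
    · obtain ⟨hiL, hiK⟩ := Finset.mem_sdiff.1 hi
      rw [hσ, if_pos hiL, if_neg hiK]
    · exact T'.holder i (Finset.mem_sdiff.1 hi).1
    · rw [T'.prefs i (Finset.mem_sdiff.1 hi).1]
      refine List.filter_congr fun x _ => ?_
      rw [decide_eq_decide, Finset.mem_sdiff]
      -- the top choices of the nodes of `K` are the houses of the nodes of `K`
      refine and_congr_right fun _ => ⟨fun h3 hx => ?_, fun h3 c hc _ heq => ?_⟩
      · obtain ⟨p, hp, hper⟩ := (S.mem_cycleNodes _ hx).2
        obtain ⟨q, rfl⟩ : ∃ q, p = q + 1 := ⟨p - 1, by omega⟩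
        have h4 : f (f^[q] (M.endow.symm x)) = M.endow.symm x := by
          rw [← Function.iterate_succ_apply' f]; exact hper
        have h5 : f^[q] (M.endow.symm x) ∈ K := iterate_mem S.closed hx q
        rw [hgraph _ (S.subset h5)] at h4
        refine h3 _ h5 ?_ (M.endow.symm.injective h4)
        have := hwK _ h5; omega
      · refine h3 ?_
        rw [← heq, ← hgraph c (S.subset hc)]
        exact S.closed c hc
    · obtain ⟨hiL, hiK⟩ := Finset.mem_sdiff.1 hi
      have := (hass i hiL).not.2 hiK
      simpa using this
    · have hhouse : ∀ i ∈ K, (σ' i).house = tp i := by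
        intro i hi
        rw [hσ, if_pos (S.subset hi), if_pos hi]
        exact T'.house i hi (by have := hwK i hi; omega)
      refine ⟨_, _, h1.sdiff (K := K) (fun i hi => S.subset hi) (fun i hi => ?_)
        (fun i hi j hj hij => ?_) (fun i hi => ?_) (fun i hi => ?_) (fun i hi x hx hxL => ?_)⟩
      · rw [hσ, if_neg hi, ← h2 i hi]
        have : tradeStep σ i = σ i := if_pos (T.done i hi)
        rw [this]
      · rw [hhouse i hi, hhouse j hj] at hij
        refine hinj (S.mem_cycleNodes i hi) (S.mem_cycleNodes j hj) ?_
        rw [hgraph i (S.subset hi), hgraph j (S.subset hj), hij]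
      · rw [hhouse i hi, ← hgraph i (S.subset hi)]
        exact S.closed i hi
      · rw [hhouse i hi]; exact hmem i (S.subset hi)
      · rw [hhouse i hi]; exact hbest i (S.subset hi) x hx hxL
  obtain ⟨f', hf'⟩ := hiter
  refine ⟨σ', f', evolves_one fun x => ?_, hf'⟩
  funext i
  rw [hσ' x, hσ]

/-- Trading takes at most three rounds per trading agent. -/
theorem Trading.finish {alg : Subroutine} (T : Trading M L sc ch tp K d w 0 σ)
    (S : Schedule f L sc ch K d w) (hgraph : ∀ i ∈ L, f i = M.endow.symm (tp i))
    (hmem : ∀ i ∈ L, tp i ∈ M.prefs i)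
    (hbest : ∀ i ∈ L, ∀ h ∈ M.prefs i, M.endow.symm h ∈ L →
      (M.prefs i).idxOf (tp i) ≤ (M.prefs i).idxOf h) :
    ∃ t σ' f', t ≤ 3 * K.card + 1 ∧ Evolves alg t σ σ' ∧
      Iteration alg M (L \ K) f' (fun _ => True) σ' := by
  have key : ∀ N s σ, (∀ r ∈ L, sc r = r → w r ≤ s + N) → Trading M L sc ch tp K d w s σ →
      ∃ t σ' f', t ≤ N + 1 ∧ Evolves alg t σ σ' ∧
        Iteration alg M (L \ K) f' (fun _ => True) σ' := by
    intro N
    induction N with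
    | zero =>
      intro s σ hw T
      obtain ⟨σ', f', h1, h2⟩ := T.next_stage (alg := alg) S hgraph hmem hbest hw
      exact ⟨1, σ', f', by omega, h1, h2⟩
    | succ N ih =>
      intro s σ hw T
      by_cases hdone : ∀ r ∈ L, sc r = r → w r ≤ s
      · obtain ⟨σ', f', h1, h2⟩ := T.next_stage (alg := alg) S hgraph hmem hbest hdone
        exact ⟨1, σ', f', by omega, h1, h2⟩
      push Not at hdone
      obtain ⟨r, hr, hrr, hlt⟩ := hdone
      have T' := T.next_round S
      obtain ⟨t, σ', f', h1, h2, h3⟩ := ih (s + 1) _ (fun r hr h => by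
        have := hw r hr h; omega) T'
      refine ⟨1 + t, σ', f', by omega, Evolves.trans (evolves_one fun x => ?_) h2, h3⟩
      funext i
      by_cases hi : i ∈ L
      · rw [step_of_trade (T.phase i hi), if_neg]
        rw [T'.pending i hi]
        exact Finset.ne_empty_of_mem (Finset.mem_filter.2 ⟨hr, hrr, hlt⟩)
      · rw [step_of_done (T.done i hi)]
        exact (if_pos (T.done i hi)).symm
  obtain ⟨t, σ', f', h1, h2, h3⟩ := key (3 * K.card) 0 σ (fun r hr h => by
    have := S.w_lt r (S.root r hr h).1; omega) T
  exact ⟨t, σ', f', h1, h2, h3⟩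

end

end

/-! ### The potential -/

variable {M : HousingMarket n} {L : Finset (Fin n)} {σ : Fin n → NodeState n}
  {alg : Subroutine}

/-- An iteration begins, and the potential is `φ`. If not all agents have left, `φ` is twice the
number of the remaining agents, minus the number of inactive nodes on a shortest cycle `C`. -/
def Ready (alg : Subroutine) (M : HousingMarket n) (L : Finset (Fin n)) (φ : ℕ)
    (σ : Fin n → NodeState n) : Prop :=
  ∃ f act, Iteration alg M L f act σ ∧ (L = ∅ ∧ φ = 0 ∨
    ∃ C : Finset (Fin n), C.Nonempty ∧ (∀ i ∈ C, i ∈ cycleNodes f L) ∧ (∀ i ∈ C, f i ∈ C) ∧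
      (∀ K : Finset (Fin n), K.Nonempty → (∀ i ∈ K, i ∈ cycleNodes f L) → (∀ i ∈ K, f i ∈ K) →
        C.card ≤ K.card) ∧
      ∃ A : Finset (Fin n), (∀ i, i ∈ A ↔ i ∈ C ∧ act i) ∧ φ + C.card = 2 * L.card + A.card)

theorem Iteration.ready {f : Fin n → Fin n} (h : Iteration alg M L f (fun _ => True) σ) :
    Ready alg M L (2 * L.card) σ := by
  classical
  refine ⟨f, _, h, ?_⟩
  by_cases hL : L = ∅
  · exact Or.inl ⟨hL, by simp [hL]⟩
  right
  obtain ⟨i, hi⟩ := Finset.nonempty_of_ne_empty hL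
  obtain ⟨j, hj⟩ := cycleNodes_nonempty h.forest.maps hi
  have hne : (Finset.univ.filter fun K : Finset (Fin n) => K.Nonempty ∧
      (∀ i ∈ K, i ∈ cycleNodes f L) ∧ ∀ i ∈ K, f i ∈ K).Nonempty := by
    refine ⟨Finset.univ.filter (· ∈ cycleNodes f L), ?_⟩
    simp only [Finset.mem_filter, Finset.mem_univ, true_and]
    exact ⟨⟨j, by simpa using hj⟩, fun i hi => hi, fun i hi =>
      iterate_mem_cycleNodes h.forest.maps hi 1⟩
  obtain ⟨C, hC, hmin⟩ := Finset.exists_min_image _ Finset.card hne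
  simp only [Finset.mem_filter, Finset.mem_univ, true_and] at hC hmin
  exact ⟨C, hC.1, hC.2.1, hC.2.2, fun K h1 h2 h3 => hmin K ⟨h1, h2, h3⟩, C, by simp, rfl⟩

/-- Two given nodes flip heads and tails, respectively, with probability one quarter. -/
theorem card_heads_tails {a b : Fin n} (hab : a ≠ b) :
    2 ^ n ≤ 4 * (Finset.univ.filter fun x : Fin n → Bool => x a = false ∧ x b = true).card := by
  have h := Finset.card_le_mul_card_image_of_maps_to (s := (Finset.univ : Finset (Fin n → Bool)))
    (t := Finset.univ.filter fun x : Fin n → Bool => x a = false ∧ x b = true)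
    (f := fun x => Function.update (Function.update x a false) b true)
    (fun x _ => by simp [Function.update_of_ne hab]) 4 (fun z _ => ?_)
  · simpa using h
  · refine (Finset.card_le_card_of_injOn (t := (Finset.univ : Finset (Bool × Bool)))
      (fun x => (x a, x b)) (fun _ _ => Finset.mem_univ _) ?_).trans (by simp)
    intro x hx y hy hxy
    simp only [Finset.coe_filter, Finset.mem_univ, true_and, Set.mem_ofPred_eq] at hx hy
    simp only [Prod.mk.injEq] at hxy
    funext i
    by_cases hb : i = b
    · rw [hb]; exact hxy.2
    by_cases ha : i = a
    · rw [ha]; exact hxy.1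
    have := congrFun (hx.trans hy.symm) i
    simpa [Function.update_of_ne hb, Function.update_of_ne ha] using this

/-- The progress made in one iteration, and in the trading that may follow it. The potential never
increases. It decreases for at least one quarter of the outcomes of the random bits, and always
with the deterministic subroutine; the number of rounds is bounded by the decrease. -/
theorem Ready.iterate {φ : ℕ} (h : Ready alg M L φ σ) (hL : L ≠ ∅) :
    ∃ good : Finset (Fin n → Bool), 2 ^ n ≤ 4 * good.card ∧
      (alg = .coloring → good = Finset.univ) ∧
      ∀ x, ∃ t L' σ' φ', Evolves alg t (step alg σ x) σ' ∧ Ready alg M L' φ' σ' ∧ φ' ≤ φ ∧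
        t + 1 ≤ iterationLength n alg * (φ - φ' + 1) ∧
        (x ∈ good → φ' < φ ∧ t + 1 ≤ iterationLength n alg * (φ - φ')) := by
  classical
  obtain ⟨f, act, h1, h2 | ⟨C, hCne, hCP, hCf, hCmin, A, hA, hφ⟩⟩ := h
  · exact absurd h2.1 hL
  have hR : 15 ≤ iterationLength n alg := by cases alg <;> simp [iterationLength]
  have hCL : C ⊆ L := fun i hi => (hCP i hi).1
  obtain ⟨a, haC, haT⟩ := h1.forest.exists_top_mem hCP hCf hCne
  have haA : a ∈ A := (hA a).2 ⟨haC, h1.settled a haT⟩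
  have hsuccA : ∀ i ∈ A, (σ i).succ ∈ A := by
    intro i hi
    obtain ⟨h2, h3⟩ := (hA i).1 hi
    exact (hA _).2 ⟨h1.forest.succ_mem_of_closed hCL hCf h2, h1.act_succ h1.settled (hCP i h2) h3⟩
  set b := (σ a).succ with hb
  let good : Finset (Fin n → Bool) := if alg = .coloring ∨ a = b then Finset.univ else
    Finset.univ.filter fun x => x a = false ∧ x b = true
  refine ⟨good, ?_, fun h => by simp [good, h], fun x => ?_⟩
  · simp only [good]
    split_ifs with h2
    · simp
    · exact card_heads_tails fun h3 => h2 (Or.inr h3)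
  obtain ⟨c, σ₁, h3, h4, h5, h6, h7⟩ := h1.find x
  have hCA : A ⊆ C := fun i hi => ((hA i).1 hi).1
  have hCAcard := Finset.card_le_card hCA
  have hApos : 0 < A.card := Finset.card_pos.2 ⟨a, haA⟩
  have hCLcard := Finset.card_le_card hCL
  by_cases hroot : ∃ r ∈ L, (σ₁ r).succ = r
  · obtain ⟨r, hr, hrr⟩ := hroot
    obtain ⟨K, d, w, S⟩ := h5.forest.exists_schedule
    obtain ⟨σ₂, h8, h9⟩ := h5.begin_trading (alg := alg) S hr hrr
    obtain ⟨t, σ₃, f', ht, h10, h11⟩ := h9.finish (alg := alg) S h5.graph h5.top_mem h5.top_best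
    have hKpos : 0 < K.card := Finset.card_pos.2 ⟨r, (S.root r hr hrr).1⟩
    have hCK := hCmin K (Finset.card_pos.1 hKpos) S.mem_cycleNodes S.closed
    have hKL : K ⊆ L := fun i hi => S.subset hi
    have hKLcard := Finset.card_le_card hKL
    have hsd := Finset.card_sdiff_of_subset hKL
    have hdrop : K.card + 1 ≤ φ - 2 * (L \ K).card := by omega
    have hrounds : iterationLength n alg - 2 + (1 + t) + 1 ≤
        iterationLength n alg * (φ - 2 * (L \ K).card) := by
      refine le_trans ?_ (Nat.mul_le_mul_left _ hdrop)
      have : 15 * K.card ≤ iterationLength n alg * K.card := Nat.mul_le_mul_right _ hR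
      rw [Nat.mul_succ]
      omega
    refine ⟨_, L \ K, σ₃, 2 * (L \ K).card, h3.trans (h8.trans h10), h11.ready, by omega, ?_,
      fun _ => ⟨by omega, hrounds⟩⟩
    exact hrounds.trans (Nat.mul_le_mul_left _ (Nat.le_succ _))
  · push Not at hroot
    obtain ⟨σ₂, h8, h9⟩ := h5.next_iteration (alg := alg) h6 hroot
    have hnofix : ∀ i ∈ A, (σ i).succ ≠ i := fun i hi h10 =>
      hroot i (hCL (hCA hi)) (h7 i (hCL (hCA hi)) h10)
    set A' : Finset (Fin n) := A.filter fun i => ¬ c i < c (σ i).succ with hA'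
    have hA'A : A'.card ≤ A.card := Finset.card_le_card (Finset.filter_subset _ _)
    have hready : Ready alg M L (2 * L.card + A'.card - C.card) σ₂ :=
      ⟨f, _, h9, Or.inr ⟨C, hCne, hCP, hCf, hCmin, A', fun i => by
        rw [hA', Finset.mem_filter, hA, and_assoc], by omega⟩⟩
    refine ⟨_, L, σ₂, _, h3.trans h8, hready, by omega, ?_, fun hx => ?_⟩
    · refine le_trans ?_ (Nat.le_mul_of_pos_right _ (Nat.succ_pos _))
      omega
    · have hlt : A'.card < A.card := by
        refine Finset.card_lt_card (Finset.filter_ssubset.2 ?_)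
        cases alg with
        | coinFlip =>
          have hab : a ≠ b := fun h10 => hnofix a haA h10.symm
          simp only [good, hab, or_false, reduceCtorEq, if_false, Finset.mem_filter,
            Finset.mem_univ, true_and] at hx
          refine ⟨a, haA, not_not.2 ?_⟩
          rw [h4 a, h4 (σ a).succ, ← hb, hx.1, hx.2]
          exact Nat.zero_lt_one
        | coloring =>
          -- an active node of the cycle with the smallest colour becomes inactive
          obtain ⟨i, hi, hmin⟩ := Finset.exists_min_image A c ⟨a, haA⟩
          obtain ⟨h10, h11⟩ := (hA i).1 hi
          refine ⟨i, hi, not_not.2 (lt_of_le_of_ne (hmin _ (hsuccA i hi)) ?_)⟩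
          exact h4 i (hCP i h10) h11 (hnofix i hi)
      refine ⟨by omega, ?_⟩
      refine le_trans ?_ (Nat.le_mul_of_pos_right _ (by omega : 0 < φ - _))
      omega

/-! ### Halting and correctness -/

/-- All nodes have halted. -/
def AllDone (σ : Fin n → NodeState n) : Prop := ∀ i, (σ i).phase = .done

theorem AllDone.evolve_eq (h : AllDone σ) (y : ℕ → Fin n → Bool) (t : ℕ) :
    evolve alg σ y t = σ := by
  induction t generalizing y with
  | zero => rfl
  | succ t ih =>
    have : step alg σ (y 0) = σ := funext fun i => step_of_done (h i) _
    rw [evolve, this]; exact ih _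

theorem Ready.allDone_iff {φ : ℕ} (h : Ready alg M L φ σ) : AllDone σ ↔ L = ∅ := by
  obtain ⟨f, act, h1, -⟩ := h
  constructor
  · intro h2
    by_contra hL
    obtain ⟨i, hi⟩ := Finset.nonempty_of_ne_empty hL
    have := h1.phase i hi
    rw [h2 i] at this
    cases alg <;> simp [firstPhase] at this
  · rintro rfl i
    exact h1.done i (Finset.notMem_empty i)

/-- When all nodes have halted, the houses have been assigned by top trading. -/
theorem Ready.traded {φ : ℕ} (h : Ready alg M L φ σ) (y : ℕ → Fin n → Bool) (t : ℕ)
    (ht : AllDone (evolve alg σ y t)) :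
    ∃ rank r, M.TradedUntil ∅ (fun i => (evolve alg σ y t i).house) rank r := by
  induction t using Nat.strong_induction_on generalizing L σ φ y with
  | _ t ih =>
    by_cases hL : L = ∅
    · rw [(h.allDone_iff.2 hL).evolve_eq]
      obtain ⟨f, act, h1, -⟩ := h
      exact hL ▸ h1.traded
    obtain ⟨good, -, -, hx⟩ := h.iterate hL
    obtain ⟨s, L', σ', φ', h1, h2, -⟩ := hx (y 0)
    have hs : evolve alg σ y (s + 1) = σ' := h1 _
    by_cases hst : s + 1 ≤ t
    · obtain ⟨k, rfl⟩ : ∃ k, t = s + 1 + k := ⟨t - (s + 1), by omega⟩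
      rw [evolve_add, hs] at ht ⊢
      exact ih k (by omega) h2 _ ht
    · obtain ⟨k, hk⟩ : ∃ k, s + 1 = t + k := ⟨s + 1 - t, by omega⟩
      rw [hk, evolve_add, ht.evolve_eq] at hs
      rw [hs] at ht ⊢
      obtain rfl := h2.allDone_iff.1 ht
      obtain ⟨f, act, h3, -⟩ := h2
      exact h3.traded

/-- With the deterministic subroutine, the potential bounds the number of iterations. -/
theorem Ready.halts {φ : ℕ} (h : Ready .coloring M L φ σ) (y : ℕ → Fin n → Bool) :
    ∃ t ≤ iterationLength n .coloring * φ, AllDone (evolve .coloring σ y t) := by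
  induction φ using Nat.strong_induction_on generalizing L σ y with
  | _ φ ih =>
    by_cases hL : L = ∅
    · exact ⟨0, Nat.zero_le _, h.allDone_iff.2 hL⟩
    obtain ⟨good, -, hgood, hx⟩ := h.iterate hL
    obtain ⟨s, L', σ', φ', h1, h2, -, -, h3⟩ := hx (y 0)
    obtain ⟨h4, h5⟩ := h3 (by rw [hgood rfl]; exact Finset.mem_univ _)
    obtain ⟨t, ht, hd⟩ := ih φ' h4 h2 (fun r => y (r + (s + 1)))
    refine ⟨s + 1 + t, ?_, ?_⟩
    · calc s + 1 + t ≤ iterationLength n .coloring * (φ - φ') + iterationLength n .coloring * φ' :=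
          Nat.add_le_add h5 ht
        _ = iterationLength n .coloring * φ := by
          rw [← Nat.mul_add, Nat.sub_add_cancel h4.le]
    · have hs : evolve .coloring σ y (s + 1) = σ' := h1 _
      rw [evolve_add, hs]; exact hd

/-- In the first round the nodes learn who holds which house, and the first stage begins. -/
theorem ready_start (alg : Subroutine) (M : HousingMarket n) (x : Fin n → Bool) :
    Ready alg M Finset.univ (2 * n) (step alg (fun i => start i (inputs M i)) x) := by
  classical
  set σ₀ : Fin n → NodeState n := fun i => start i (inputs M i) with hσ₀
  have hown : ∀ i h, (firstSender (inbox σ₀ i) (.owner h)).getD i = M.endow.symm h := by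
    intro i h
    have hs : ∀ j, j ∈ senders (inbox σ₀ i) (.owner h) ↔ j = M.endow.symm h := by
      intro j
      rw [mem_senders, Equiv.eq_symm_apply]
      simp [send, hσ₀, start, inputs]
    rcases firstSender_spec (inb := inbox σ₀ i) (m := .owner h) with ⟨-, h2⟩ | ⟨j, h2, h3⟩
    · have := (hs _).2 rfl
      rw [h2] at this
      exact absurd this (Finset.notMem_empty _)
    · rw [h3, Option.getD_some]; exact (hs j).1 h2
  obtain ⟨f, hf⟩ := exists_iteration (M := M) (L := Finset.univ) alg
    (σ := fun i => { σ₀ i with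
      holder := fun h => (firstSender (inbox σ₀ i) (.owner h)).getD i })
    (σ' := step alg σ₀ x) (by simp) (fun i _ => rfl) (fun i _ h => hown i h)
    (fun i _ => by simp [hσ₀, start, inputs]) (fun i _ => rfl) ⟨_, _, M.tradedUntil_univ _⟩
  simpa using hf.ready

theorem run_eq_evolve (alg : Subroutine) (M : HousingMarket n) (ω : ℕ × Fin n → Bool) (t : ℕ) :
    (protocol n alg).run (inputs M) ω t =
      evolve alg (fun i => start i (inputs M i)) (fun s i => ω (s, i)) t := by
  induction t with
  | zero => rfl
  | succ t ih =>
    rw [run_succ, ih, evolve_add]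
    simp only [evolve, Nat.zero_add]

theorem haltedAt_iff (alg : Subroutine) (M : HousingMarket n) (ω : ℕ × Fin n → Bool) (t : ℕ) :
    (protocol n alg).HaltedAt (inputs M) ω t ↔
      AllDone (evolve alg (fun i => start i (inputs M i)) (fun s i => ω (s, i)) t) := by
  rw [← run_eq_evolve]; rfl

theorem core_of_haltedAt (alg : Subroutine) (M : HousingMarket n) (ω : ℕ × Fin n → Bool) (t : ℕ)
    (h : (protocol n alg).HaltedAt (inputs M) ω t) :
    ∃ μ : M.Matching, M.core = {μ} ∧
      ∀ i, μ.house i = some ((protocol n alg).run (inputs M) ω t i).house := by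
  rw [haltedAt_iff] at h
  have key : ∃ rank r, M.TradedUntil ∅
      (fun i => ((protocol n alg).run (inputs M) ω t i).house) rank r := by
    rw [run_eq_evolve]
    cases t with
    | zero =>
      -- initially, all nodes have halted only if there are none
      have hn : IsEmpty (Fin n) := ⟨fun i => by
        have h' : Phase.hello = Phase.done := h i
        cases h'⟩
      exact ⟨fun _ => 0, 0, by constructor <;> exact fun i => hn.elim i⟩
    | succ t => exact (ready_start alg M _).traded _ t h
  obtain ⟨rank, r, hr⟩ := key
  exact ⟨hr.matching, hr.core_eq, fun i => rfl⟩

/-- The summand `n` accounts for the first round, unless there are no nodes. -/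
theorem exists_haltedAt_coloring (M : HousingMarket n) (ω : ℕ × Fin n → Bool) :
    ∃ t ≤ iterationLength n .coloring * (2 * n) + n,
      (protocol n .coloring).HaltedAt (inputs M) ω t := by
  rcases Nat.eq_zero_or_pos n with rfl | hn
  · exact ⟨0, Nat.zero_le _, fun i => i.elim0⟩
  obtain ⟨t, ht, hd⟩ := (ready_start .coloring M fun i => ω (0, i)).halts fun s i => ω (s + 1, i)
  exact ⟨t + 1, by omega, (haltedAt_iff _ _ _ _).2 hd⟩

open MeasureTheory

/-! ### The random bits, round by round -/

/-- The law of the random bits of one round. -/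
noncomputable def roundMeasure (n : ℕ) : Measure (Fin n → Bool) :=
  Measure.infinitePi fun _ => (PMF.uniformOfFintype Bool).toMeasure

/-- The law of the sequence of the random bits of all rounds. -/
noncomputable def roundsMeasure (n : ℕ) : Measure (ℕ → Fin n → Bool) :=
  Measure.infinitePi fun _ => roundMeasure n

instance : IsProbabilityMeasure (roundMeasure n) := by unfold roundMeasure; infer_instance

instance : IsProbabilityMeasure (roundsMeasure n) := by unfold roundsMeasure; infer_instance

instance : IsProbabilityMeasure (coinMeasure n) := by unfold coinMeasure; infer_instance

theorem map_curry_coinMeasure :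
    (coinMeasure n).map (MeasurableEquiv.curry ℕ (Fin n) Bool) = roundsMeasure n :=
  Measure.infinitePi_map_curry (fun _ : ℕ => fun _ : Fin n => (PMF.uniformOfFintype Bool).toMeasure)

theorem roundMeasure_singleton (x : Fin n → Bool) : (roundMeasure n).real {x} = 1 / 2 ^ n := by
  unfold roundMeasure Measure.real
  rw [Measure.infinitePi_singleton_of_fintype]
  have : ∀ b : Bool, (PMF.uniformOfFintype Bool).toMeasure {b} = 2⁻¹ := by
    intro b
    rw [PMF.toMeasure_apply_singleton _ _ (measurableSet_singleton b)]
    simp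
  simp [this]

/-- Adding a round in front of a sequence of rounds. -/
def consRound (p : (Fin n → Bool) × (ℕ → Fin n → Bool)) : ℕ → Fin n → Bool
  | 0 => p.1
  | t + 1 => p.2 t

theorem measurable_consRound : Measurable (consRound (n := n)) := by
  refine measurable_pi_lambda _ fun t => ?_
  cases t with
  | zero => exact measurable_fst
  | succ t => exact (measurable_pi_apply t).comp measurable_snd

theorem map_consRound :
    ((roundMeasure n).prod (roundsMeasure n)).map consRound = roundsMeasure n := by
  refine Measure.eq_infinitePi _ fun s t ht => ?_
  rw [Measure.map_apply measurable_consRound (.pi s.countable_toSet fun i _ => ht i)]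
  have hpre : consRound (n := n) ⁻¹' (Set.pi s t) =
      (if 0 ∈ s then t 0 else Set.univ) ×ˢ
        Set.pi (s.preimage Nat.succ Nat.succ_injective.injOn : Finset ℕ) (fun i => t (i + 1)) := by
    ext ⟨x, y⟩
    simp only [Set.mem_preimage, Set.mem_pi, Set.mem_prod, Finset.coe_preimage, Finset.mem_coe]
    constructor
    · intro h
      refine ⟨?_, fun i hi => h (i + 1) hi⟩
      split_ifs with h0
      · exact h 0 h0
      · exact Set.mem_univ _
    · rintro ⟨h1, h2⟩ i hi
      cases i with
      | zero => rw [if_pos hi] at h1; exact h1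
      | succ i => exact h2 i hi
  rw [hpre, Measure.prod_prod, roundsMeasure, Measure.infinitePi_pi _ fun i _ => ht _]
  by_cases h0 : 0 ∈ s
  · rw [if_pos h0, ← Finset.mul_prod_erase s _ h0]
    congr 1
    rw [← Finset.prod_image (s := s.preimage Nat.succ Nat.succ_injective.injOn) (g := Nat.succ)
      (f := fun i => roundMeasure n (t i)) (Nat.succ_injective.injOn)]
    refine Finset.prod_congr ?_ fun _ _ => rfl
    ext i
    cases i <;> simp
  · rw [if_neg h0, measure_univ, one_mul,
      ← Finset.prod_image (s := s.preimage Nat.succ Nat.succ_injective.injOn) (g := Nat.succ)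
      (f := fun i => roundMeasure n (t i)) (Nat.succ_injective.injOn)]
    refine Finset.prod_congr ?_ fun _ _ => rfl
    ext i
    cases i <;> simp [h0]

/-! ### The running time of the randomized subroutine -/

/-- The sequences of random bits for which not all nodes have halted after `t` rounds from `σ`. -/
def notDone (alg : Subroutine) (σ : Fin n → NodeState n) (t : ℕ) : Set (ℕ → Fin n → Bool) :=
  {y | ¬ AllDone (evolve alg σ y t)}

theorem measurableSet_notDone (alg : Subroutine) (σ : Fin n → NodeState n) (t : ℕ) :
    MeasurableSet (notDone alg σ t) := by
  induction t generalizing σ with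
  | zero => exact MeasurableSet.const (¬ AllDone σ)
  | succ t ih =>
    have : notDone alg σ (t + 1) = ⋃ x : Fin n → Bool, {y | y 0 = x} ∩
        (fun (y : ℕ → Fin n → Bool) s => y (s + 1)) ⁻¹' notDone alg (step alg σ x) t := by
      ext y
      simp [notDone, evolve]
    rw [this]
    refine MeasurableSet.iUnion fun x => MeasurableSet.inter ?_ ?_
    · exact measurableSet_eq_fun (measurable_pi_apply 0) measurable_const
    · exact measurable_pi_lambda _ (fun s => measurable_pi_apply (s + 1)) (ih _)

/-- The probability that not all nodes have halted after `t` rounds from `σ`. -/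
noncomputable def failure (alg : Subroutine) (σ : Fin n → NodeState n) (t : ℕ) : ℝ :=
  (roundsMeasure n).real (notDone alg σ t)

theorem failure_le_one (alg : Subroutine) (σ : Fin n → NodeState n) (t : ℕ) :
    failure alg σ t ≤ 1 := measureReal_le_one

theorem failure_succ (alg : Subroutine) (σ : Fin n → NodeState n) (t : ℕ) :
    failure alg σ (t + 1) = (∑ x, failure alg (step alg σ x) t) / 2 ^ n := by
  have h1 : roundsMeasure n (notDone alg σ (t + 1)) =
      ∑ x, roundsMeasure n (notDone alg (step alg σ x) t) * roundMeasure n {x} := by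
    rw [← lintegral_fintype]
    conv_lhs => rw [← map_consRound]
    rw [Measure.map_apply measurable_consRound (measurableSet_notDone _ _ _),
      Measure.prod_apply (measurable_consRound (measurableSet_notDone _ _ _))]
    rfl
  unfold failure Measure.real
  rw [h1, ENNReal.toReal_sum fun x _ => ENNReal.mul_ne_top (measure_ne_top _ _)
    (measure_ne_top _ _), Finset.sum_div]
  refine Finset.sum_congr rfl fun x _ => ?_
  have := roundMeasure_singleton x
  unfold Measure.real at this
  rw [ENNReal.toReal_mul, this]
  ring

theorem failure_add {t : ℕ} {σ' : Fin n → NodeState n} (h : Evolves alg t σ σ') (s : ℕ) :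
    failure alg σ (t + s) = failure alg σ' s := by
  induction t generalizing σ with
  | zero =>
    obtain rfl : σ = σ' := h fun _ _ => false
    rw [Nat.zero_add]
  | succ t ih =>
    have h1 : ∀ x, Evolves alg t (step alg σ x) σ' := by
      intro x y
      exact h fun s => if s = 0 then x else y (s - 1)
    rw [Nat.succ_add, failure_succ, Finset.sum_congr rfl fun x _ => ih (h1 x)]
    simp

/-- The exponential decay of the probability of failure: in an iteration, the potential decreases
with probability at least one quarter. -/
theorem Ready.failure_le {φ : ℕ} (h : Ready .coinFlip M L φ σ) (t : ℕ) :
    failure .coinFlip σ t ≤ 2 ^ φ / (120 / 119) ^ t := by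
  -- the base is such that its power over an iteration is at most the inverse of the mean factor
  -- `7 / 8`
  obtain ⟨r, hr⟩ : ∃ r : ℝ, r = 120 / 119 := ⟨_, rfl⟩
  rw [← hr]
  have hr1 : 1 ≤ r := by norm_num [hr]
  have hr0 : 0 < r := one_pos.trans_le hr1
  have hr15 : r ^ 15 ≤ 8 / 7 := by norm_num [hr]
  have hr2 : r ^ 15 ≤ 2 := hr15.trans (by norm_num)
  induction t using Nat.strong_induction_on generalizing L φ σ with
  | _ t ih =>
    by_cases hL : L = ∅
    · have : notDone .coinFlip σ t = ∅ := by
        have hd := h.allDone_iff.2 hL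
        ext y
        simp [notDone, hd.evolve_eq, hd]
      rw [failure, this]
      simp only [measureReal_empty]
      positivity
    cases t with
    | zero =>
      rw [pow_zero, div_one]
      exact (failure_le_one _ _ _).trans (one_le_pow₀ (by norm_num))
    | succ t =>
      obtain ⟨good, hgood, -, hx⟩ := h.iterate hL
      set g : (Fin n → Bool) → ℝ := fun x => if x ∈ good then 1 / 2 else 1 with hg
      have hbound : ∀ x, failure .coinFlip (step .coinFlip σ x) t ≤
          2 ^ φ / r ^ (t + 1) * r ^ 15 * g x := by
        intro x
        obtain ⟨s, L', σ', φ', h1, h2, h3, h4, h5⟩ := hx x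
        -- the rounds of this iteration are paid for by the decrease of the potential
        have key : 2 ^ φ' * r ^ (s + 1) ≤ 2 ^ φ * r ^ 15 * g x := by
          simp only [iterationLength] at h4 h5
          obtain ⟨δ, rfl⟩ : ∃ δ, φ = φ' + δ := ⟨φ - φ', by omega⟩
          rw [Nat.add_sub_cancel_left] at h4 h5
          by_cases hxg : x ∈ good
          · obtain ⟨h6, h7⟩ := h5 hxg
            obtain ⟨ε, rfl⟩ : ∃ ε, δ = ε + 1 := ⟨δ - 1, by omega⟩
            have h8 : r ^ (s + 1) ≤ 2 ^ ε * r ^ 15 := by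
              calc r ^ (s + 1) ≤ r ^ (15 * (ε + 1)) := pow_le_pow_right₀ hr1 h7
                _ = (r ^ 15) ^ ε * r ^ 15 := by rw [pow_mul, pow_succ]
                _ ≤ 2 ^ ε * r ^ 15 := by gcongr
            have h9 : g x = 1 / 2 := if_pos hxg
            rw [h9]
            calc (2 : ℝ) ^ φ' * r ^ (s + 1) ≤ 2 ^ φ' * (2 ^ ε * r ^ 15) := by gcongr
              _ = 2 ^ (φ' + (ε + 1)) * r ^ 15 * (1 / 2) := by ring
          · have h8 : r ^ (s + 1) ≤ 2 ^ δ * r ^ 15 := by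
              calc r ^ (s + 1) ≤ r ^ (15 * (δ + 1)) := pow_le_pow_right₀ hr1 h4
                _ = (r ^ 15) ^ δ * r ^ 15 := by rw [pow_mul, pow_succ]
                _ ≤ 2 ^ δ * r ^ 15 := by gcongr
            have h9 : g x = 1 := if_neg hxg
            rw [h9]
            calc (2 : ℝ) ^ φ' * r ^ (s + 1) ≤ 2 ^ φ' * (2 ^ δ * r ^ 15) := by gcongr
              _ = 2 ^ (φ' + δ) * r ^ 15 * 1 := by ring
        rw [div_mul_eq_mul_div, div_mul_eq_mul_div, le_div_iff₀ (by positivity)]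
        refine le_trans ?_ key
        by_cases hst : s ≤ t
        · obtain ⟨k, rfl⟩ : ∃ k, t = s + k := ⟨t - s, by omega⟩
          rw [failure_add h1]
          have h6 := ih k (by omega) h2
          rw [le_div_iff₀ (by positivity)] at h6
          calc failure .coinFlip σ' k * r ^ (s + k + 1)
              = failure .coinFlip σ' k * r ^ k * r ^ (s + 1) := by ring
            _ ≤ 2 ^ φ' * r ^ (s + 1) := by gcongr
        · calc failure .coinFlip (step .coinFlip σ x) t * r ^ (t + 1) ≤ 1 * r ^ (s + 1) := by
                gcongr
                · exact failure_le_one _ _ _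
                · omega
            _ ≤ 2 ^ φ' * r ^ (s + 1) := by
                gcongr
                exact one_le_pow₀ (by norm_num)
      have hsum : ∑ x, g x ≤ 7 / 8 * 2 ^ n := by
        have h1 : ∀ x, g x = 1 - (if x ∈ good then 1 / 2 else 0) := by
          intro x
          simp only [hg]
          split_ifs <;> norm_num
        have h2 : (2 : ℝ) ^ n ≤ 4 * good.card := by exact_mod_cast hgood
        simp only [h1, Finset.sum_sub_distrib, Finset.sum_ite_mem, Finset.univ_inter,
          Finset.sum_const, Finset.card_univ, nsmul_eq_mul]
        simp only [Fintype.card_pi, Fintype.card_bool, Finset.prod_const, Finset.card_univ,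
          Fintype.card_fin]
        push_cast
        linarith
      rw [failure_succ, div_le_iff₀ (by positivity)]
      calc ∑ x, failure .coinFlip (step .coinFlip σ x) t
          ≤ ∑ x, 2 ^ φ / r ^ (t + 1) * r ^ 15 * g x := Finset.sum_le_sum fun x _ => hbound x
        _ = 2 ^ φ / r ^ (t + 1) * (r ^ 15 * ∑ x, g x) := by rw [← Finset.mul_sum]; ring
        _ ≤ 2 ^ φ / r ^ (t + 1) * (8 / 7 * (7 / 8 * 2 ^ n)) := by
            gcongr
        _ = 2 ^ φ / r ^ (t + 1) * 2 ^ n := by ring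

/-- With the randomized subroutine, the probability that not all nodes have halted decreases
exponentially. -/
theorem measureReal_not_haltedAt_le (M : HousingMarket n) (t : ℕ) :
    (coinMeasure n).real {ω | ¬ (protocol n .coinFlip).HaltedAt (inputs M) ω (t + 1)} ≤
      4 ^ n / (120 / 119) ^ t := by
  have h1 : (coinMeasure n).real {ω | ¬ (protocol n .coinFlip).HaltedAt (inputs M) ω (t + 1)} =
      failure .coinFlip (fun i => start i (inputs M i)) (t + 1) := by
    unfold failure Measure.real
    rw [← map_curry_coinMeasure, Measure.map_apply (MeasurableEquiv.measurable _)
      (measurableSet_notDone _ _ _)]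
    congr 2
    ext ω
    rw [Set.mem_ofPred_eq, haltedAt_iff]
    rfl
  rw [h1, failure_succ, div_le_iff₀ (by positivity)]
  calc ∑ x, failure .coinFlip (step .coinFlip (fun i => start i (inputs M i)) x) t
      ≤ ∑ _x : Fin n → Bool, (4 : ℝ) ^ n / (120 / 119) ^ t := by
        refine Finset.sum_le_sum fun x _ => ?_
        refine ((ready_start .coinFlip M x).failure_le t).trans_eq ?_
        rw [pow_mul]; norm_num
    _ = 4 ^ n / (120 / 119) ^ t * 2 ^ n := by simp; ring

theorem measurableSet_haltedAt (M : HousingMarket n) (t : ℕ) :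
    MeasurableSet {ω | (protocol n .coinFlip).HaltedAt (inputs M) ω t} := by
  have := (MeasurableEquiv.measurable (MeasurableEquiv.curry ℕ (Fin n) Bool)
    (measurableSet_notDone .coinFlip (fun i => start i (inputs M i)) t)).compl
  convert this using 1
  ext ω
  rw [Set.mem_ofPred_eq, haltedAt_iff]
  exact not_not.symm

theorem ae_exists_haltedAt (M : HousingMarket n) :
    ∀ᵐ ω ∂(coinMeasure n), ∃ t, (protocol n .coinFlip).HaltedAt (inputs M) ω t := by
  rw [ae_iff, ← measureReal_eq_zero_iff]
  refine le_antisymm ?_ measureReal_nonneg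
  have hlim : Filter.Tendsto (fun t : ℕ => (4 : ℝ) ^ n / (120 / 119) ^ t) Filter.atTop (nhds 0) :=
    Filter.Tendsto.div_atTop tendsto_const_nhds
      (tendsto_pow_atTop_atTop_of_one_lt (by norm_num))
  refine ge_of_tendsto' hlim fun t => le_trans ?_ (measureReal_not_haltedAt_le M t)
  refine measureReal_mono fun ω hω => ?_
  exact fun h => hω ⟨_, h⟩

/-- The probability of failure within a multiple of `n` rounds is polynomially small. -/
theorem exists_measureReal_haltedAt_ge (c : ℕ) :
    ∃ k : ℕ, ∀ (n : ℕ) (M : HousingMarket n), 0 < n → 1 - 1 / (n : ℝ) ^ c ≤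
      (coinMeasure n).real {ω | (protocol n .coinFlip).HaltedAt (inputs M) ω (k * n + 1)} := by
  obtain ⟨k, hk⟩ := pow_unbounded_of_one_lt ((4 : ℝ) * 2 ^ c)
    (show (1 : ℝ) < 120 / 119 by norm_num)
  refine ⟨k, fun n M hn => ?_⟩
  have h1 := measureReal_not_haltedAt_le M (k * n)
  have h2 := probReal_compl_eq_one_sub (μ := coinMeasure n) (measurableSet_haltedAt M (k * n + 1))
  have h3 : (4 : ℝ) ^ n / (120 / 119) ^ (k * n) ≤ 1 / (n : ℝ) ^ c := by
    have hn' : (0 : ℝ) < n := by exact_mod_cast hn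
    rw [div_le_div_iff₀ (by positivity) (by positivity), one_mul]
    calc (4 : ℝ) ^ n * (n : ℝ) ^ c ≤ 4 ^ n * (2 ^ n) ^ c := by
          gcongr
          exact_mod_cast Nat.lt_two_pow_self.le
      _ = (4 * 2 ^ c) ^ n := by rw [mul_pow, ← pow_mul, ← pow_mul, Nat.mul_comm]
      _ ≤ ((120 / 119) ^ k) ^ n := by gcongr
      _ = (120 / 119) ^ (k * n) := by rw [pow_mul]
  have h4 : {ω | ¬ (protocol n .coinFlip).HaltedAt (inputs M) ω (k * n + 1)} =
      {ω | (protocol n .coinFlip).HaltedAt (inputs M) ω (k * n + 1)}ᶜ := rfl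
  rw [h4] at h1
  linarith

end DistributedTTC

/-! ### The algorithm is correct and efficient -/

theorem mainTheorem5 :
    -- messages have `O(log n)` bits
    (∃ B : ℕ, ∀ (n : ℕ) (alg : DistributedTTC.Subroutine) (M : HousingMarket n)
      (ω : ℕ × Fin n → Bool) (t : ℕ) (i : Fin n) (m : DistributedTTC.Message n)
      (R : Finset (Fin n)),
      (DistributedTTC.protocol n alg).send i
        ((DistributedTTC.protocol n alg).run (DistributedTTC.inputs M) ω t i) = some (m, R) →
      m.encode.length ≤ B * (Nat.log 2 n + 1)) ∧
    -- when all nodes have halted, the houses they hold form the unique core matching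
    (∀ (n : ℕ) (alg : DistributedTTC.Subroutine) (M : HousingMarket n)
      (ω : ℕ × Fin n → Bool) (t : ℕ),
      (DistributedTTC.protocol n alg).HaltedAt (DistributedTTC.inputs M) ω t →
      ∃ μ : M.Matching, M.core = {μ} ∧
        ∀ i, μ.house i =
          some ((DistributedTTC.protocol n alg).run (DistributedTTC.inputs M) ω t i).house) ∧
    -- randomized subroutine: termination with probability one
    (∀ (n : ℕ) (M : HousingMarket n), ∀ᵐ ω ∂(coinMeasure n), ∃ t : ℕ,
      (DistributedTTC.protocol n .coinFlip).HaltedAt (DistributedTTC.inputs M) ω t) ∧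
    -- randomized subroutine: `O(n)` rounds and `O(n ^ 2)` messages with high probability
    (∀ c : ℕ, ∃ C : ℕ, ∀ (n : ℕ) (M : HousingMarket n),
      1 - 1 / (n : ℝ) ^ c ≤ (coinMeasure n).real {ω | ∃ t : ℕ,
        (DistributedTTC.protocol n .coinFlip).HaltedAt (DistributedTTC.inputs M) ω t ∧
        t ≤ C * n ∧
        (DistributedTTC.protocol n .coinFlip).messages (DistributedTTC.inputs M) ω t
          ≤ C * n ^ 2}) ∧
    -- deterministic subroutine: an additional factor `log* n`
    (∃ C : ℕ, ∀ (n : ℕ) (M : HousingMarket n) (ω : ℕ × Fin n → Bool), ∃ t : ℕ,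
      (DistributedTTC.protocol n .coloring).HaltedAt (DistributedTTC.inputs M) ω t ∧
      t ≤ C * (n * (logStar n + 1)) ∧
      (DistributedTTC.protocol n .coloring).messages (DistributedTTC.inputs M) ω t
        ≤ C * (n ^ 2 * (logStar n + 1))) := by
  refine ⟨⟨8, fun n alg M ω t i m R h => ?_⟩, fun _ => DistributedTTC.core_of_haltedAt,
    fun n M => DistributedTTC.ae_exists_haltedAt M, fun c => ?_, ?_⟩
  · refine DistributedTTC.length_encode_le ?_
    rintro c rfl
    rw [DistributedTTC.color_eq_of_send h]
    exact DistributedTTC.run_color_lt alg _ ω t i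
  · obtain ⟨k, hk⟩ := DistributedTTC.exists_measureReal_haltedAt_ge c
    refine ⟨2 * k + 7, fun n M => ?_⟩
    rcases Nat.eq_zero_or_pos n with rfl | hn
    · -- without agents there is nothing to do, and the bound is at most one
      have huniv : {ω | ∃ t : ℕ,
          (DistributedTTC.protocol 0 .coinFlip).HaltedAt (DistributedTTC.inputs M) ω t ∧
          t ≤ (2 * k + 7) * 0 ∧
          (DistributedTTC.protocol 0 .coinFlip).messages (DistributedTTC.inputs M) ω t
            ≤ (2 * k + 7) * 0 ^ 2} = Set.univ :=
        Set.eq_univ_of_forall fun ω => ⟨0, fun i => i.elim0, le_rfl,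
          by simp [CliqueProtocol.messages]⟩
      rw [huniv, MeasureTheory.probReal_univ]
      have : (0 : ℝ) ≤ 1 / ((0 : ℕ) : ℝ) ^ c := by positivity
      linarith
    refine (hk n M hn).trans (MeasureTheory.measureReal_mono fun ω hω => ?_)
    refine ⟨k * n + 1, hω, by nlinarith, ?_⟩
    refine (DistributedTTC.messages_le .coinFlip _ ω _).trans ?_
    nlinarith
  · set s := tossSteps 512
    refine ⟨16 * s + 160, fun n M ω => ?_⟩
    obtain ⟨t, ht, hd⟩ := DistributedTTC.exists_haltedAt_coloring M ω
    have h1 : t ≤ n * (8 * logStar n + 4 * s + 31) := by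
      have h2 := Nat.mul_le_mul_left (4 * n) (tossSteps_le n)
      simp only [DistributedTTC.iterationLength] at ht
      nlinarith
    have h3 : 8 * logStar n + 4 * s + 31 ≤ (4 * s + 40) * (logStar n + 1) := by
      nlinarith [Nat.zero_le (s * logStar n)]
    have h4 : t ≤ (4 * s + 40) * (n * (logStar n + 1)) := by
      calc t ≤ n * (8 * logStar n + 4 * s + 31) := h1
        _ ≤ n * ((4 * s + 40) * (logStar n + 1)) := Nat.mul_le_mul_left _ h3
        _ = (4 * s + 40) * (n * (logStar n + 1)) := by ring
    refine ⟨t, hd, h4.trans (Nat.mul_le_mul_right _ (by omega)), ?_⟩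
    calc _ ≤ 2 * n * t + 5 * n ^ 2 := DistributedTTC.messages_le _ _ _ _
      _ ≤ 2 * n * ((4 * s + 40) * (n * (logStar n + 1))) + 5 * (n ^ 2 * (logStar n + 1)) := by
          gcongr
          exact Nat.le_mul_of_pos_right _ (Nat.succ_pos _)
      _ = (8 * s + 85) * (n ^ 2 * (logStar n + 1)) := by ring
      _ ≤ _ := Nat.mul_le_mul_right _ (by omega)
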